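/- **Theorem 1.2.** Let $a=(a_{ij})$, $b=(b_{ij})$ ($i=0,1$, $j=0,1,2$) be complex constants and set $$N_1(u,v)=(a_{00}u+a_{10}\bar u)|v|^2+(a_{01}u+a_{11}\bar u)v^2+(a_{02}u+a_{12}\bar u)\bar v^2,$$ $$N_2(u,v)=(b_{00}v+b_{10}\bar v)|u|^2+(b_{01}v+b_{11}\bar v)u^2+(b_{02}v+b_{12}\bar v)\bar u^2$$ (in particular, $N_1=(\alpha_1u+\alpha_2\bar u)(\alpha_3|v|^2+\alpha_4v^2+\alpha_5\bar v^2)$ and $N_2=(\beta_1v+\beta_2\bar v)(\beta_3|u|^2+\beta_4u^2+\beta_5\bar u^2)$ are allowed). Suppose that $\operatorname{Re}\big(i\bar uN_1(u,v)+i\bar vN_2(u,v)\big)=0$ for all $u,v\in\mathbb C$. Then there is a constant $C_0>0$, depending only on $a$ and $b$, such that the following holds for every $m\ge 0$, for the system $$i(u_t+u_x)=-mv+N_1(u,v),\qquad i(v_t-v_x)=-mu+N_2(u,v)\qquad (t\ge 0,\ x\in\mathbb R).\tag{D}$$ Let $(u_{0k},v_{0k})\in H^1(\mathbb R)$ be a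 sequence with $\|u_{0k}\|_{L^2}^2+\|v_{0k}\|_{L^2}^2\le C_0$ for all $k$ and $\|u_{0k}-u_{0\infty}\|_{L^2}+\|v_{0k}-v_{0\infty}\|_{L^2}\to0$ for some $(u_{0\infty},v_{0\infty})\in L^2(\mathbb R)$. Then for each $k$ the system (D) has a unique global classical solution $(u_k,v_k)\in C([0,\infty);H^1(\mathbb R))\cap C^1([0,\infty);L^2(\mathbb R))$ with initial data $(u_{0k},v_{0k})$, and there is $(u_\infty,v_\infty)\in C([0,\infty);L^2(\mathbb R))$ such that for every $T\ge0$ $$\|u_k-u_\infty\|_{C([0,T];L^2(\mathbb R))}+\|v_k-v_\infty\|_{C([0,T];L^2(\mathbb R))}\to0,$$ $$N_l(u_k,v_k)\to N_l(u_\infty,v_\infty)\quad\text{in }L^1((0,T)\times\mathbb R),\qquad l=1,2,$$ as $k\to\infty$, and $(u_\infty,v_\infty)$ is a weak solution of (D) with initial data $(u_{0\infty},v_{0\infty})$. That is, $(u_\infty,v_\infty)(0)=(u_{0\infty},v_{0\infty})$, $N_l(u_\infty,v_\infty)\in L^1((0,T)\times\mathbb R)$ for all $T$ and $l=1,2$,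 and for every $\varphi\in C_c^\infty(\mathbb R^2;\mathbb C)$ $$-i\int_{\mathbb R}u_{0\infty}\,\varphi(0,x)\,dx-i\int_0^\infty\!\!\int_{\mathbb R}u_\infty(\varphi_t+\varphi_x)\,dx\,dt=\int_0^\infty\!\!\int_{\mathbb R}\big(-mv_\infty+N_1(u_\infty,v_\infty)\big)\varphi\,dx\,dt,$$ $$-i\int_{\mathbb R}v_{0\infty}\,\varphi(0,x)\,dx-i\int_0^\infty\!\!\int_{\mathbb R}v_\infty(\varphi_t-\varphi_x)\,dx\,dt=\int_0^\infty\!\!\int_{\mathbb R}\big(-mu_\infty+N_2(u_\infty,v_\infty)\big)\varphi\,dx\,dt.$$ -/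

import Mathlib

open MeasureTheory Set Filter Topology
open scoped ContDiff ENNReal ComplexConjugate

noncomputable section

namespace Dirac

/-- The space `L²(ℝ; ℂ)`. -/
abbrev L2 : Type := Lp ℂ 2 (volume : Measure ℝ)

/-- The space `L¹(ℝ; ℂ)`. -/
abbrev L1 : Type := Lp ℂ 1 (volume : Measure ℝ)

/-- `g` is the weak (distributional) derivative of `f` on `ℝ`. -/
def IsWeakDeriv (f g : L2) : Prop :=
  ∀ φ : ℝ → ℂ, ContDiff ℝ ∞ φ → HasCompactSupport φ →
    ∫ x, f x * deriv φ x = -∫ x, g x * φ x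

/-- `f ∈ H¹(ℝ)`. -/
def MemH1 (f : L2) : Prop := ∃ g : L2, IsWeakDeriv f g

/-- The general cubic expression
`∑ (a₀ⱼ z + a₁ⱼ z̄) qⱼ(w)` with `q₀ = |w|²`, `q₁ = w²`, `q₂ = w̄²`. -/
def cubic (a : Fin 2 → Fin 3 → ℂ) (z w : ℂ) : ℂ :=
  (a 0 0 * z + a 1 0 * conj z) * ((‖w‖ ^ 2 : ℝ) : ℂ)
    + (a 0 1 * z + a 1 1 * conj z) * w ^ 2
    + (a 0 2 * z + a 1 2 * conj z) * (conj w) ^ 2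

/-- The factored nonlinearities are the case of coefficients of product form. -/
theorem cubic_factored (p : Fin 2 → ℂ) (q : Fin 3 → ℂ) (z w : ℂ) :
    cubic (fun i j => p i * q j) z w =
      (p 0 * z + p 1 * conj z) *
        (q 0 * ((‖w‖ ^ 2 : ℝ) : ℂ) + q 1 * w ^ 2 + q 2 * (conj w) ^ 2) := by
  unfold cubic; ring

/-- The first nonlinear term `N₁(u, v)`. -/
def N1 (a : Fin 2 → Fin 3 → ℂ) (u v : ℂ) : ℂ := cubic a u v

/-- The second nonlinear term `N₂(u, v)`. -/
def N2 (b : Fin 2 → Fin 3 → ℂ) (u v : ℂ) : ℂ := cubic b v u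

/-- The charge condition `Re (i ū N₁(u,v) + i v̄ N₂(u,v)) = 0` for all `u, v`. -/
def ChargeCondition (a b : Fin 2 → Fin 3 → ℂ) : Prop :=
  ∀ u v : ℂ,
    (Complex.I * conj u * N1 a u v + Complex.I * conj v * N2 b u v).re = 0

/-- `(u, v)` is a global classical solution with data `(u₀, v₀)`:
`u, v ∈ C([0,∞); H¹) ∩ C¹([0,∞); L²)`, the equations
`i(u_t + u_x) = -m v + N₁(u,v)`, `i(v_t - v_x) = -m u + N₂(u,v)` hold in `L²` at every `t ≥ 0`,
and `u(0) = u₀`, `v(0) = v₀`. Values at negative times play no role. -/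
def IsClassicalSolution (a b : Fin 2 → Fin 3 → ℂ) (m : ℝ) (u₀ v₀ : L2) (u v : ℝ → L2) : Prop :=
  u 0 = u₀ ∧ v 0 = v₀ ∧
  ContinuousOn u (Ici 0) ∧ ContinuousOn v (Ici 0) ∧
  ∃ ux vx ut vt : ℝ → L2,
    ContinuousOn ux (Ici 0) ∧ ContinuousOn vx (Ici 0) ∧
    ContinuousOn ut (Ici 0) ∧ ContinuousOn vt (Ici 0) ∧
    ∀ t : ℝ, 0 ≤ t →
      IsWeakDeriv (u t) (ux t) ∧ IsWeakDeriv (v t) (vx t) ∧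
      HasDerivWithinAt u (ut t) (Ici 0) t ∧ HasDerivWithinAt v (vt t) (Ici 0) t ∧
      (∀ᵐ x : ℝ, Complex.I * (ut t x + ux t x) = -(m : ℂ) * v t x + N1 a (u t x) (v t x)) ∧
      (∀ᵐ x : ℝ, Complex.I * (vt t x - vx t x) = -(m : ℂ) * u t x + N2 b (u t x) (v t x))

/-- The function `(t, x) ↦ N (u(t,x)) (v(t,x))` belongs to `L¹((0,T) × ℝ) = L¹((0,T); L¹(ℝ))`
for every `T`. -/
def NonlinearL1 (N : ℂ → ℂ → ℂ) (u v : ℝ → L2) : Prop :=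
  ∃ n : ℝ → L1, (∀ T : ℝ, IntegrableOn n (Ioc 0 T)) ∧
    ∀ᵐ t ∂(volume.restrict (Ioi (0 : ℝ))), ∀ᵐ x : ℝ, n t x = N (u t x) (v t x)

/-- `(u, v)` is a global weak `L²` solution with data `(u₀, v₀)`:
`u, v ∈ C([0,∞); L²)` with `u(0) = u₀`, `v(0) = v₀`, the nonlinear terms are integrable on
`(0,T) × ℝ` for all `T`, and the equations hold when tested against every
`φ ∈ C_c^∞(ℝ × ℝ)` over `t > 0`, with the initial data as boundary term.
A point of `ℝ × ℝ` is `(t, x)`, so `fderiv ℝ φ (t, x) (1, ±1)` is `φ_t ± φ_x`. -/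
def IsWeakSolution (a b : Fin 2 → Fin 3 → ℂ) (m : ℝ) (u₀ v₀ : L2) (u v : ℝ → L2) : Prop :=
  u 0 = u₀ ∧ v 0 = v₀ ∧
  ContinuousOn u (Ici 0) ∧ ContinuousOn v (Ici 0) ∧
  NonlinearL1 (N1 a) u v ∧ NonlinearL1 (N2 b) u v ∧
  ∀ φ : ℝ × ℝ → ℂ, ContDiff ℝ ∞ φ → HasCompactSupport φ →
    (-Complex.I * (∫ x, u₀ x * φ (0, x))
        - Complex.I * (∫ t in Ioi (0 : ℝ), ∫ x, u t x * fderiv ℝ φ (t, x) (1, 1))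
      = ∫ t in Ioi (0 : ℝ), ∫ x, (-(m : ℂ) * v t x + N1 a (u t x) (v t x)) * φ (t, x)) ∧
    (-Complex.I * (∫ x, v₀ x * φ (0, x))
        - Complex.I * (∫ t in Ioi (0 : ℝ), ∫ x, v t x * fderiv ℝ φ (t, x) (1, -1))
      = ∫ t in Ioi (0 : ℝ), ∫ x, (-(m : ℂ) * u t x + N2 b (u t x) (v t x)) * φ (t, x))

/-- `N(u_k, v_k) → N(u, v)` in `L¹((0,T) × ℝ)`. -/
def NonlinearTendsto (N : ℂ → ℂ → ℂ) (uk vk : ℕ → ℝ → L2) (u v : ℝ → L2) (T : ℝ) : Prop :=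
  Tendsto (fun k => ∫⁻ t in Ioc 0 T, ∫⁻ x,
    ‖N (uk k t x) (vk k t x) - N (u t x) (v t x)‖ₑ) atTop (𝓝 0)

end Dirac

end

noncomputable section

namespace Dirac

/-! ### Translations on `L²` and weak derivatives -/

/-! Along characteristics, with `f(t,x) = u(t,x+t)` and `g(t,x) = v(t,x-t)`, the spatial derivatives
disappear. The system becomes an ordinary differential equation whose right-hand side couples
`f(t,x)` to `g(t,x+2t)`. Every estimate rests on one consequence of the charge condition:
integrating the local conservation law over a light triangle bounds the `L²` mass of each component
along every characteristic of the other by half the charge (`CharSol.flux`).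

The cubic term in the equation for `f` is linear in `f` with coefficient of size `κ|g|²`, where `κ`
is the sum of the moduli of the coefficients. If `κ` times the charge is small, this coefficient has
integral at most 1/2 on each characteristic and is absorbed. Thus the supremum in time of
`|f(t,x)|²` has a majorant that is integrable in `x` (`CharSol.enorm_sq_le_majorant`). The
difference of two solutions is treated in the same way. Its source contains
`|g-g'|(|f|+|f'|)(|g|+|g'|)`, which Cauchy–Schwarz bounds by the majorants and the mass of `g-g'` on
the characteristic. A majorant in `x` of `|f-f'|²`, uniform in time, controls both the `L²` norm at
each time and the mass on the transverse lines `x-2s`. So the norms and the characteristic masses of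
the two differences form a closed system, with contraction factor 1/2 when the charge and `m T` are
small (`CharSol.stability_half`, `CharSol.stability`). The same quantities bound the `L¹` distance
of the nonlinear terms (`CharSol.cubicDist_sq_le`). The charge does not grow, so the argument can be
restarted on intervals of equal length, giving Lipschitz dependence in `L²` on every bounded time
interval (`CharSol.stability_long`).

Global existence in `H¹` comes from the same stability. Comparing a solution with its translate by
`h`, dividing by `h²` and letting `h` tend to 0 bounds the `L²` norm of the spatial derivative
(`IsCurve.deriv_sq_le`). In characteristic coordinates the vector field is Lipschitz on bounded sets
of `H¹ × H¹`, so a truncated equation is solved by Picard–Lindelöf. The truncation acts as a scalar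
damping factor depending on time only. The a priori bound allows such a factor and shows that the
truncation is inactive (`exists_curve`). Classical solutions correspond to the resulting curves,
which gives uniqueness.

For convergent data, stability makes the solutions Cauchy in `C([0,T]; L²)` and their nonlinear
terms Cauchy in `L¹`. Almost everywhere convergence along subsequences identifies the nonlinear
limits, and the weak form passes to the limit (`exists_weak_limit`). -/

/-- The translation `f ↦ f (· + h)` on `L²(ℝ)`. -/
def shift (h : ℝ) : L2 →ₗᵢ[ℂ] L2 :=
  Lp.compMeasurePreservingₗᵢ ℂ (· + h) (measurePreserving_add_right volume h)

lemma coeFn_shift (h : ℝ) (f : L2) : shift h f =ᵐ[volume] fun x => f (x + h) :=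
  Lp.coeFn_compMeasurePreserving f (measurePreserving_add_right volume h)

lemma ae_comp_add_right {p : ℝ → Prop} (hp : ∀ᵐ x : ℝ, p x) (h : ℝ) : ∀ᵐ x : ℝ, p (x + h) :=
  (measurePreserving_add_right volume h).quasiMeasurePreserving.ae hp

lemma shift_shift (h k : ℝ) (f : L2) : shift h (shift k f) = shift (h + k) f := by
  apply Lp.ext
  filter_upwards [coeFn_shift h (shift k f), coeFn_shift (h + k) f,
    ae_comp_add_right (coeFn_shift k f) h] with x h1 h2 h3
  rw [h1, h2, h3, add_assoc]

@[simp] lemma shift_zero (f : L2) : shift 0 f = f := by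
  apply Lp.ext
  filter_upwards [coeFn_shift 0 f] with x h1
  rw [h1, add_zero]

lemma continuous_shift : Continuous fun p : ℝ × L2 => shift p.1 p.2 := by
  have hg : Continuous fun p : ℝ × L2 => (⟨fun x : ℝ => x + p.1, by fun_prop⟩ : C(ℝ, ℝ)) :=
    ContinuousMap.continuous_of_continuous_uncurry _ (by dsimp [Function.uncurry]; fun_prop)
  exact continuous_snd.compMeasurePreservingLp hg
    (fun p => measurePreserving_add_right volume p.1) (by simp)

lemma continuous_shift_comp {X : Type*} [TopologicalSpace X] {h : X → ℝ} {f : X → L2}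
    (hh : Continuous h) (hf : Continuous f) : Continuous fun x => shift (h x) (f x) :=
  continuous_shift.comp (hh.prodMk hf)

/-- The bilinear pairing `f ↦ ∫ f φ`. -/
def pairing (φ : L2) : L2 →L[ℂ] ℂ :=
  (ContinuousLinearMap.lpPairing volume 2 2 (ContinuousLinearMap.mul ℂ ℂ)).flip φ

lemma pairing_apply (φ f : L2) : pairing φ f = ∫ x, f x * φ x := by
  simp only [pairing, ContinuousLinearMap.flip_apply,
    ContinuousLinearMap.lpPairing_eq_integral, ContinuousLinearMap.mul_apply']

lemma pairing_toLp {φ : ℝ → ℂ} (hφ : MemLp φ 2) (f : L2) :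
    pairing (hφ.toLp φ) f = ∫ x, f x * φ x := by
  rw [pairing_apply]
  apply integral_congr_ae
  filter_upwards [hφ.coeFn_toLp] with x hx
  rw [hx]

lemma memLp_of_hasCompactSupport {φ : ℝ → ℂ} (h : ContDiff ℝ ∞ φ) (hc : HasCompactSupport φ) :
    MemLp φ 2 :=
  h.continuous.memLp_of_hasCompactSupport hc

lemma contDiff_deriv {φ : ℝ → ℂ} (h : ContDiff ℝ ∞ φ) : ContDiff ℝ ∞ (deriv φ) :=
  (contDiff_infty_iff_deriv.1 h).2

lemma locallyIntegrable_L2 (f : L2) : LocallyIntegrable f :=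
  (Lp.memLp f).locallyIntegrable (by norm_num)

/-- An element of `L²` that pairs to zero with all test functions vanishes. -/
lemma eq_zero_of_pairing {w : L2}
    (h : ∀ φ : ℝ → ℂ, ContDiff ℝ ∞ φ → HasCompactSupport φ → ∫ x, w x * φ x = 0) : w = 0 := by
  rw [Lp.eq_zero_iff_ae_eq_zero]
  apply ae_eq_zero_of_integral_contDiff_smul_eq_zero (locallyIntegrable_L2 w)
  intro g hg hc
  rw [← h (fun x => (g x : ℂ)) (Complex.ofRealCLM.contDiff.comp hg)
    (hc.comp_left (g := fun r : ℝ => (r : ℂ)) (by simp))]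
  congr 1; ext x
  rw [Complex.real_smul, mul_comm]

lemma integral_shift_mul (h : ℝ) (f : L2) (φ : ℝ → ℂ) :
    ∫ x, shift h f x * φ x = ∫ x, f x * φ (x - h) := by
  rw [← integral_add_right_eq_self (fun x => f x * φ (x - h)) h]
  apply integral_congr_ae
  filter_upwards [coeFn_shift h f] with x hx
  rw [hx, add_sub_cancel_right]

/-- As a function of the shift, the pairing is a convolution of `f` with the reflected test
function. The derivative therefore falls on `φ`, and `f` needs only local integrability. -/
lemma hasDerivAt_integral_shift_mul (f : L2) {φ : ℝ → ℂ} (hφ : ContDiff ℝ ∞ φ)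
    (hc : HasCompactSupport φ) (h : ℝ) :
    HasDerivAt (fun h => ∫ x, shift h f x * φ x) (-∫ x, shift h f x * deriv φ x) h := by
  have hc' : HasCompactSupport (fun x => φ (-x)) := hc.comp_homeomorph (Homeomorph.neg ℝ)
  have hs : ContDiff ℝ ∞ (fun x => φ (-x)) := hφ.comp contDiff_neg
  have key := HasCompactSupport.hasDerivAt_convolution_right (ContinuousLinearMap.mul ℝ ℂ)
    (locallyIntegrable_L2 f) hc' (hs.of_le (by norm_cast)) (μ := volume) h
  have hd : deriv (fun x => φ (-x)) = fun x => - deriv φ (-x) := by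
    ext x; exact deriv_comp_neg φ x
  rw [hd] at key
  convert! key using 1
  · ext k
    simp only [convolution, ContinuousLinearMap.mul_apply', integral_shift_mul, neg_sub]
  · simp only [convolution, ContinuousLinearMap.mul_apply', integral_shift_mul, neg_sub,
      mul_neg, integral_neg]

lemma IsWeakDeriv.shift {f g : L2} (hfg : IsWeakDeriv f g) (h : ℝ) :
    IsWeakDeriv (shift h f) (Dirac.shift h g) := by
  intro φ hφ hc
  have hφ' : ContDiff ℝ ∞ (fun x => φ (x - h)) := hφ.comp (contDiff_id.sub contDiff_const)
  have hc' : HasCompactSupport (fun x => φ (x - h)) :=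
    hc.comp_homeomorph (Homeomorph.subRight h)
  rw [integral_shift_mul, integral_shift_mul, ← hfg _ hφ' hc']
  congr 1; ext x
  rw [deriv_comp_sub_const]

/-- A function with weak derivative `g` in `L²` moves along translations with velocity `g`. -/
lemma IsWeakDeriv.shift_sub {f g : L2} (hfg : IsWeakDeriv f g) (h : ℝ) :
    Dirac.shift h f - f = ∫ s in (0 : ℝ)..h, Dirac.shift s g := by
  have hcont : Continuous fun s : ℝ => Dirac.shift s g :=
    continuous_shift_comp continuous_id continuous_const
  rw [← sub_eq_zero]
  apply eq_zero_of_pairing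
  intro φ hφ hc
  have hm := memLp_of_hasCompactSupport hφ hc
  rw [← pairing_toLp hm, map_sub, map_sub,
    ← ContinuousLinearMap.intervalIntegral_comp_comm _ (hcont.intervalIntegrable _ _)]
  have hder : ∀ s : ℝ, HasDerivAt (fun h => pairing (hm.toLp φ) (Dirac.shift h f))
      (pairing (hm.toLp φ) (Dirac.shift s g)) s := by
    intro s
    have := hasDerivAt_integral_shift_mul f hφ hc s
    rw [hfg.shift s φ hφ hc, neg_neg] at this
    simpa only [pairing_toLp hm] using this
  rw [intervalIntegral.integral_eq_sub_of_hasDerivAt (fun s _ => hder s)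
    (((pairing _).continuous.comp hcont).intervalIntegrable _ _)]
  simp

lemma IsWeakDeriv.hasDerivAt_shift {f g : L2} (hfg : IsWeakDeriv f g) (h : ℝ) :
    HasDerivAt (fun h => Dirac.shift h f) (Dirac.shift h g) h := by
  have hcont : Continuous fun s : ℝ => Dirac.shift s g :=
    continuous_shift_comp continuous_id continuous_const
  have := (intervalIntegral.integral_hasDerivAt_right (hcont.intervalIntegrable 0 h)
    (hcont.stronglyMeasurableAtFilter _ _) hcont.continuousAt).add_const f
  convert! this using 1
  ext1 k
  rw [← hfg.shift_sub k, sub_add_cancel]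

/-- Together with `IsWeakDeriv.hasDerivAt_shift`, this identifies weak differentiation with the
generator of the translation group. Later arguments can use difference quotients instead of test
functions. -/
lemma isWeakDeriv_of_hasDerivAt_shift {f g : L2}
    (h : HasDerivAt (fun h => shift h f) g 0) : IsWeakDeriv f g := by
  intro φ hφ hc
  have hm := memLp_of_hasCompactSupport hφ hc
  have h1 := hasDerivAt_integral_shift_mul f hφ hc 0
  have h2 := (pairing (hm.toLp φ)).restrictScalars ℝ |>.hasFDerivAt.comp_hasDerivAt (0 : ℝ) h
  have h3 : HasDerivAt (fun h => ∫ x, shift h f x * φ x) (∫ x, g x * φ x) 0 := by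
    rw [← pairing_toLp hm]
    convert! h2 using 1
    ext k
    exact (pairing_toLp hm _).symm
  have := h1.unique h3
  rw [shift_zero] at this
  rw [← this, neg_neg]

lemma IsWeakDeriv.unique {f g g' : L2} (h : IsWeakDeriv f g) (h' : IsWeakDeriv f g') : g = g' := by
  have := (h.hasDerivAt_shift 0).unique (h'.hasDerivAt_shift 0)
  simpa using this

/-! ### The Sobolev space `H¹` -/

/-- The graph of the weak derivative. -/
def H1Graph : Submodule ℂ (L2 × L2) where
  -- Membership is phrased through translations so that the product rule and conjugation reduce to
  -- difference quotients.
  carrier := {p | HasDerivAt (fun h => shift h p.1) p.2 0}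
  add_mem' {p q} hp hq := by
    simp only [mem_ofPred_eq, Prod.fst_add, Prod.snd_add, map_add] at *
    exact hp.add hq
  zero_mem' := by
    simp only [mem_ofPred_eq, Prod.fst_zero, Prod.snd_zero, map_zero]
    exact hasDerivAt_const _ _
  smul_mem' c p hp := by
    simp only [mem_ofPred_eq, Prod.smul_fst, Prod.smul_snd, map_smul] at *
    exact hp.const_smul c

/-- `H¹(ℝ)` as the graph of the weak derivative. -/
abbrev H1 : Type := H1Graph

lemma mem_H1 {p : L2 × L2} : p ∈ H1Graph ↔ IsWeakDeriv p.1 p.2 :=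
  ⟨isWeakDeriv_of_hasDerivAt_shift, fun h => by
    have := h.hasDerivAt_shift 0
    rwa [shift_zero] at this⟩

lemma H1.isWeakDeriv (p : H1) : IsWeakDeriv p.1.1 p.1.2 := mem_H1.1 p.2

/-- Each test function imposes a closed linear condition on the pair. Closedness gives the
completeness that Picard–Lindelöf and the integration of `H¹`-valued curves require. -/
lemma isClosed_H1 : IsClosed (H1Graph : Set (L2 × L2)) := by
  have : (H1Graph : Set (L2 × L2)) = ⋂ (φ : ℝ → ℂ) (h : ContDiff ℝ ∞ φ) (hc : HasCompactSupport φ),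
      {p | pairing ((memLp_of_hasCompactSupport (contDiff_deriv h) hc.deriv).toLp _) p.1
        = -pairing ((memLp_of_hasCompactSupport h hc).toLp _) p.2} := by
    ext p
    simp only [SetLike.mem_coe, mem_H1, mem_iInter, mem_ofPred_eq, pairing_toLp]
    rfl
  rw [this]
  refine isClosed_iInter fun φ => isClosed_iInter fun h => isClosed_iInter fun hc => ?_
  exact isClosed_eq (by fun_prop) (by fun_prop)

instance : CompleteSpace H1 := isClosed_H1.completeSpace_coe

/-- The inclusion `H¹ → L²`. -/
def H1.toL2 : H1 →L[ℂ] L2 := (ContinuousLinearMap.fst ℂ L2 L2).comp H1Graph.subtypeL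

/-- The derivative `H¹ → L²`. -/
def H1.deriv : H1 →L[ℂ] L2 := (ContinuousLinearMap.snd ℂ L2 L2).comp H1Graph.subtypeL

lemma H1.hasDerivAt_shift (p : H1) (h : ℝ) :
    HasDerivAt (fun h => Dirac.shift h p.toL2) (Dirac.shift h p.deriv) h :=
  p.isWeakDeriv.hasDerivAt_shift h

lemma H1.norm_eq (p : H1) : ‖p‖ = max ‖p.toL2‖ ‖p.deriv‖ := rfl

lemma H1.norm_toL2_le (p : H1) : ‖p.toL2‖ ≤ ‖p‖ := by rw [H1.norm_eq]; exact le_max_left _ _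

lemma H1.norm_deriv_le (p : H1) : ‖p.deriv‖ ≤ ‖p‖ := by rw [H1.norm_eq]; exact le_max_right _ _

lemma H1.toL2_injective : Function.Injective H1.toL2 := by
  intro p q h
  have h2 : p.1.2 = q.1.2 := p.isWeakDeriv.unique (by
    have := q.isWeakDeriv
    rwa [show q.1.1 = p.1.1 from h.symm] at this)
  exact Subtype.ext (Prod.ext h h2)

/-- Translation on `H¹`. -/
def H1.shift (h : ℝ) : H1 →ₗ[ℂ] H1 where
  toFun p := ⟨(Dirac.shift h p.1.1, Dirac.shift h p.1.2), mem_H1.2 (p.isWeakDeriv.shift h)⟩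
  map_add' p q := by ext1; simp
  map_smul' c p := by ext1; simp

@[simp] lemma H1.toL2_shift (h : ℝ) (p : H1) : (H1.shift h p).toL2 = Dirac.shift h p.toL2 := rfl

@[simp] lemma H1.deriv_shift (h : ℝ) (p : H1) : (H1.shift h p).deriv = Dirac.shift h p.deriv := rfl

@[simp] lemma H1.norm_shift (h : ℝ) (p : H1) : ‖H1.shift h p‖ = ‖p‖ := by
  rw [H1.norm_eq, H1.norm_eq, H1.toL2_shift, H1.deriv_shift, LinearIsometry.norm_map,
    LinearIsometry.norm_map]

lemma H1.continuous_shift_comp {X : Type*} [TopologicalSpace X] {h : X → ℝ} {f : X → H1}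
    (hh : Continuous h) (hf : Continuous f) : Continuous fun x => H1.shift (h x) (f x) :=
  Continuous.subtype_mk ((Dirac.continuous_shift_comp hh (H1.toL2.continuous.comp hf)).prodMk
    (Dirac.continuous_shift_comp hh (H1.deriv.continuous.comp hf))) _

@[simp] lemma H1.shift_zero (p : H1) : H1.shift 0 p = p :=
  H1.toL2_injective (by simp)

/-! ### The continuous representative -/

lemma memLp_indicator_Ioc {c : ℝ → ℂ} (hc : Continuous c) :
    MemLp ((Ioc (0 : ℝ) 1).indicator c) 2 := by
  rw [memLp_indicator_iff_restrict measurableSet_Ioc]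
  obtain ⟨B, hB⟩ := (isCompact_Icc (a := (0 : ℝ)) (b := 1)).exists_bound_of_continuousOn
    hc.continuousOn
  refine MemLp.of_bound hc.aestronglyMeasurable B ?_
  filter_upwards [ae_restrict_mem measurableSet_Ioc] with s hs
  exact hB s (Ioc_subset_Icc_self hs)

lemma memLp_indicator_one : MemLp ((Ioc (0 : ℝ) 1).indicator (fun _ => (1 : ℂ))) 2 :=
  memLp_indicator_Ioc continuous_const

lemma memLp_indicator_one_sub :
    MemLp ((Ioc (0 : ℝ) 1).indicator (fun s : ℝ => 1 - (s : ℂ))) 2 :=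
  memLp_indicator_Ioc (by fun_prop)

/-- Point evaluation on `H¹`, through `p(x) = ∫₀¹ (p(x+s) - (1-s) p'(x+s)) ds`. -/
def H1.ev (x : ℝ) : H1 →ₗ[ℂ] ℂ :=
  ((pairing (memLp_indicator_one.toLp _)).toLinearMap ∘ₗ H1.toL2.toLinearMap -
    (pairing (memLp_indicator_one_sub.toLp _)).toLinearMap ∘ₗ H1.deriv.toLinearMap) ∘ₗ H1.shift x

lemma H1.ev_apply (x : ℝ) (p : H1) : H1.ev x p =
    pairing (memLp_indicator_one.toLp _) (Dirac.shift x p.toL2) -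
    pairing (memLp_indicator_one_sub.toLp _) (Dirac.shift x p.deriv) := rfl

lemma H1.ev_shift (x h : ℝ) (p : H1) : H1.ev x (H1.shift h p) = H1.ev (x + h) p := by
  simp [H1.ev_apply, Dirac.shift_shift]

lemma H1.continuous_ev_comp {X : Type*} [TopologicalSpace X] {x : X → ℝ} {f : X → H1}
    (hx : Continuous x) (hf : Continuous f) : Continuous fun z => H1.ev (x z) (f z) := by
  simp only [H1.ev_apply]
  exact ((pairing _).continuous.comp (Dirac.continuous_shift_comp hx
    (H1.toL2.continuous.comp hf))).sub
    ((pairing _).continuous.comp (Dirac.continuous_shift_comp hx (H1.deriv.continuous.comp hf)))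

/-- This is the one-dimensional Sobolev bound. The constant does not depend on the point because
translations are isometries. -/
lemma H1.exists_norm_ev_le : ∃ C : ℝ, 0 ≤ C ∧ ∀ (x : ℝ) (p : H1), ‖H1.ev x p‖ ≤ C * ‖p‖ := by
  refine ⟨‖pairing (memLp_indicator_one.toLp _)‖ + ‖pairing (memLp_indicator_one_sub.toLp _)‖,
    by positivity, fun x p => ?_⟩
  rw [H1.ev_apply, add_mul]
  refine (norm_sub_le _ _).trans (add_le_add ?_ ?_)
  · refine ((pairing _).le_opNorm _).trans ?_
    rw [LinearIsometry.norm_map]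
    gcongr
    exact p.norm_toL2_le
  · refine ((pairing _).le_opNorm _).trans ?_
    rw [LinearIsometry.norm_map]
    gcongr
    exact p.norm_deriv_le

/-- Point evaluation as a continuous linear functional. -/
def H1.evL (x : ℝ) : H1 →L[ℂ] ℂ :=
  ⟨H1.ev x, H1.continuous_ev_comp continuous_const continuous_id⟩

lemma integral_mul_indicator (f : ℝ → ℂ) (c : ℝ → ℂ) :
    ∫ s, f s * (Ioc (0 : ℝ) 1).indicator c s = ∫ s in Ioc (0 : ℝ) 1, f s * c s := by
  rw [← integral_indicator measurableSet_Ioc]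
  congr 1; ext s
  by_cases hs : s ∈ Ioc (0 : ℝ) 1 <;> simp [hs]

/-- Fubini for the translates of an `L²` function against a test function. -/
lemma integral_average_shift (f : L2) {c : ℝ → ℂ} (hc : Continuous c) {φ : ℝ → ℂ}
    (hφ : MemLp φ 2) :
    ∫ x, (∫ s in Ioc (0 : ℝ) 1, f (x + s) * c s) * φ x =
      ∫ s in Ioc (0 : ℝ) 1, c s * ∫ x, shift s f x * φ x := by
  have hmeas : AEStronglyMeasurable (fun z : ℝ × ℝ => f (z.2 + z.1) * c z.1 * φ z.2)
      ((volume.restrict (Ioc (0 : ℝ) 1)).prod volume) := by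
    refine AEStronglyMeasurable.mul (AEStronglyMeasurable.mul ?_ ?_) ?_
    · exact ((Lp.stronglyMeasurable f).comp_measurable
        (measurable_snd.add measurable_fst)).aestronglyMeasurable
    · exact (hc.comp continuous_fst).aestronglyMeasurable
    · exact hφ.1.comp_snd
  have hsh : ∀ s : ℝ, MemLp (fun x => f (x + s)) 2 := fun s =>
    (Lp.memLp f).comp_measurePreserving (measurePreserving_add_right volume s)
  have hint : ∀ s : ℝ, Integrable fun x => f (x + s) * φ x := fun s =>
    (hsh s).integrable_mul hφ
  obtain ⟨B, hB⟩ := (isCompact_Icc (a := (0 : ℝ)) (b := 1)).exists_bound_of_continuousOn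
    hc.continuousOn
  have hprod : Integrable (fun z : ℝ × ℝ => f (z.2 + z.1) * c z.1 * φ z.2)
      ((volume.restrict (Ioc (0 : ℝ) 1)).prod volume) := by
    rw [integrable_prod_iff hmeas]
    constructor
    · refine Eventually.of_forall fun s => ?_
      convert! (hint s).const_mul (c s) using 1
      ext x; ring
    -- The elementary bound `ab ≤ a² + b²` and translation invariance make the inner integrals
    -- bounded uniformly in `s`.
    · have hm2 := hmeas.norm.integral_prod_right'
      refine Integrable.of_bound hm2 (B * ((∫ x, ‖f x‖ ^ 2) + ∫ x, ‖φ x‖ ^ 2)) ?_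
      filter_upwards [ae_restrict_mem measurableSet_Ioc] with s hs
      rw [Real.norm_of_nonneg (integral_nonneg fun x => norm_nonneg _)]
      have h1 : ∫ x, ‖f (x + s) * c s * φ x‖ = ‖c s‖ * ∫ x, ‖f (x + s)‖ * ‖φ x‖ := by
        rw [← integral_const_mul]
        congr 1; ext x; rw [norm_mul, norm_mul]; ring
      have h2 : ∫ x, ‖f (x + s)‖ * ‖φ x‖ ≤ (∫ x, ‖f x‖ ^ 2) + ∫ x, ‖φ x‖ ^ 2 := by
        rw [← integral_add_right_eq_self (fun x => ‖f x‖ ^ 2) s,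
          ← integral_add ((hsh s).integrable_norm_pow two_ne_zero)
            (hφ.integrable_norm_pow two_ne_zero)]
        refine integral_mono ?_ (((hsh s).integrable_norm_pow two_ne_zero).add
            (hφ.integrable_norm_pow two_ne_zero)) fun x => ?_
        · simpa only [norm_mul] using (hint s).norm
        · nlinarith [sq_nonneg (‖f (x + s)‖ - ‖φ x‖), sq_nonneg (‖f (x + s)‖),
            sq_nonneg (‖φ x‖)]
      rw [h1]
      exact mul_le_mul (hB s (Ioc_subset_Icc_self hs)) h2
        (integral_nonneg fun x => by positivity)
        ((norm_nonneg _).trans (hB 0 (by simp)))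
  have hsw := integral_integral_swap (f := fun (s x : ℝ) => f (x + s) * c s * φ x) hprod
  calc _ = ∫ x, ∫ s in Ioc (0 : ℝ) 1, f (x + s) * c s * φ x := by
        congr 1; ext x
        rw [← integral_mul_const]
    _ = ∫ s in Ioc (0 : ℝ) 1, ∫ x, f (x + s) * c s * φ x := hsw.symm
    _ = _ := by
        congr 1; ext s
        rw [← integral_const_mul]
        apply integral_congr_ae
        filter_upwards [coeFn_shift s f] with x hx
        rw [hx]; ring

lemma pairing_indicator_shift (f : L2) {c : ℝ → ℂ} (hc : Continuous c) (x : ℝ) :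
    pairing ((memLp_indicator_Ioc hc).toLp _) (shift x f) =
      ∫ s in Ioc (0 : ℝ) 1, f (x + s) * c s := by
  rw [pairing_toLp, ← integral_mul_indicator]
  apply integral_congr_ae
  filter_upwards [coeFn_shift x f] with s hs
  rw [hs, add_comm]

/-- Every element of `H¹` agrees a.e. with its continuous representative. -/
lemma H1.coeFn_ae_eq (p : H1) : p.toL2 =ᵐ[volume] fun x => H1.ev x p := by
  have hcont : Continuous fun x => H1.ev x p :=
    H1.continuous_ev_comp continuous_id continuous_const
  suffices h : ∀ᵐ x, p.toL2 x - H1.ev x p = 0 from h.mono fun x hx => sub_eq_zero.1 hx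
  apply ae_eq_zero_of_integral_contDiff_smul_eq_zero
    ((locallyIntegrable_L2 _).sub hcont.locallyIntegrable)
  intro φr hφr hcr
  set φ : ℝ → ℂ := fun x => (φr x : ℂ) with hφdef
  have hφ : ContDiff ℝ ∞ φ := Complex.ofRealCLM.contDiff.comp hφr
  have hc : HasCompactSupport φ := hcr.comp_left (g := fun r : ℝ => (r : ℂ)) (by simp)
  have hm := memLp_of_hasCompactSupport hφ hc
  have hc1 : Continuous fun _ : ℝ => (1 : ℂ) := continuous_const
  have hc2 : Continuous fun s : ℝ => 1 - (s : ℂ) := by fun_prop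
  set L := pairing (hm.toLp φ)
  have i1 : Integrable fun x => pairing (memLp_indicator_one.toLp _)
      (Dirac.shift x p.toL2) * φ x := by
    refine Continuous.integrable_of_hasCompactSupport ?_ hc.mul_left
    exact ((pairing _).continuous.comp (Dirac.continuous_shift_comp continuous_id
      continuous_const)).mul hφ.continuous
  have i2 : Integrable fun x => pairing (memLp_indicator_one_sub.toLp _)
      (Dirac.shift x p.deriv) * φ x := by
    refine Continuous.integrable_of_hasCompactSupport ?_ hc.mul_left
    exact ((pairing _).continuous.comp (Dirac.continuous_shift_comp continuous_id
      continuous_const)).mul hφ.continuous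
  have hev : ∫ x, H1.ev x p * φ x = ∫ x, p.toL2 x * φ x := by
    have e1 : ∫ x, H1.ev x p * φ x = (∫ s in Ioc (0 : ℝ) 1, (1 : ℂ) * L (Dirac.shift s p.toL2)) -
        ∫ s in Ioc (0 : ℝ) 1, (1 - (s : ℂ)) * L (Dirac.shift s p.deriv) := by
      simp only [H1.ev_apply, sub_mul]
      rw [integral_sub i1 i2]
      congr 1
      · rw [integral_congr_ae (Eventually.of_forall fun x =>
          congrArg (· * φ x) (pairing_indicator_shift p.toL2 hc1 x))]
        rw [integral_average_shift p.toL2 hc1 hm]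
        simp only [L, pairing_toLp hm]
      · rw [integral_congr_ae (Eventually.of_forall fun x =>
          congrArg (· * φ x) (pairing_indicator_shift p.deriv hc2 x))]
        rw [integral_average_shift p.deriv hc2 hm]
        simp only [L, pairing_toLp hm, sub_mul]
    -- The primitive `-(1-s) p(x+s)` vanishes at `s = 1` and equals `-p(x)` at `s = 0`, so
    -- integration over `[0,1]` returns exactly `p(x)`.
    have hF : ∀ s : ℝ, HasDerivAt (fun s : ℝ => -(1 - (s : ℂ)) * L (Dirac.shift s p.toL2))
        (1 * L (Dirac.shift s p.toL2) - (1 - (s : ℂ)) * L (Dirac.shift s p.deriv)) s := by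
      intro s
      have h1 : HasDerivAt (fun s : ℝ => -(1 - (s : ℂ))) 1 s := by
        have := ((Complex.ofRealCLM.hasDerivAt (x := s)).const_sub (1 : ℂ)).neg
        convert! this using 1
        simp
      have h2 := (L.restrictScalars ℝ).hasFDerivAt.comp_hasDerivAt s (p.hasDerivAt_shift s)
      convert! h1.mul h2 using 1
      simp only [ContinuousLinearMap.coe_restrictScalars']
      simp; ring
    have hcs : Continuous fun s : ℝ => Dirac.shift s p.toL2 :=
      Dirac.continuous_shift_comp continuous_id continuous_const
    have hcs' : Continuous fun s : ℝ => Dirac.shift s p.deriv :=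
      Dirac.continuous_shift_comp continuous_id continuous_const
    rw [e1, ← intervalIntegral.integral_of_le zero_le_one,
      ← intervalIntegral.integral_of_le zero_le_one, ← intervalIntegral.integral_sub,
      intervalIntegral.integral_eq_sub_of_hasDerivAt (fun s _ => hF s)]
    · simp [L, pairing_toLp hm]
    · apply Continuous.intervalIntegrable
      fun_prop
    · apply Continuous.intervalIntegrable
      fun_prop
    · apply Continuous.intervalIntegrable
      fun_prop
  have i3 : Integrable fun x => p.toL2 x * φ x := (Lp.memLp p.toL2).integrable_mul hm
  have i4 : Integrable fun x => H1.ev x p * φ x :=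
    (hcont.mul hφ.continuous).integrable_of_hasCompactSupport hc.mul_left
  calc _ = ∫ x, (p.toL2 x * φ x - H1.ev x p * φ x) := by
        congr 1; ext x; rw [Complex.real_smul, Pi.sub_apply]; simp only [φ]; ring
    _ = 0 := by rw [integral_sub i3 i4, hev, sub_self]

/-! ### Products and conjugates in `H¹` -/

lemma memLp_ev_mul (p : H1) (f : L2) : MemLp (fun x => H1.ev x p * f x) 2 := by
  obtain ⟨C, -, hC⟩ := H1.exists_norm_ev_le
  have hcont : Continuous fun x => H1.ev x p :=
    H1.continuous_ev_comp continuous_id continuous_const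
  refine (Lp.memLp f).of_le_mul (c := C * ‖p‖)
    (hcont.aestronglyMeasurable.mul (Lp.aestronglyMeasurable f)) ?_
  refine Eventually.of_forall fun x => ?_
  rw [norm_mul]
  gcongr
  exact hC x p

/-- Multiplication of an `L²` function by an `H¹` function. -/
def evMul : H1 →L[ℂ] L2 →L[ℂ] L2 :=
  LinearMap.mkContinuous₂
    (LinearMap.mk₂ ℂ (fun p f => (memLp_ev_mul p f).toLp _)
      (fun p q f => by
        rw [← MemLp.toLp_add]
        congr 1; ext x; simp [add_mul])
      (fun c p f => by
        rw [← MemLp.toLp_const_smul]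
        congr 1; ext x; simp [mul_assoc])
      (fun p f g => by
        rw [← MemLp.toLp_add, MemLp.toLp_eq_toLp_iff]
        filter_upwards [Lp.coeFn_add f g] with x hx
        change H1.ev x p * (f + g : L2) x = H1.ev x p * f x + H1.ev x p * g x
        rw [hx, Pi.add_apply, mul_add])
      (fun c p f => by
        rw [← MemLp.toLp_const_smul, MemLp.toLp_eq_toLp_iff]
        filter_upwards [Lp.coeFn_smul c f] with x hx
        simp [hx, mul_left_comm]))
    H1.exists_norm_ev_le.choose
    (fun p f => by
      obtain ⟨hC, hC'⟩ := H1.exists_norm_ev_le.choose_spec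
      apply Lp.norm_le_mul_norm_of_ae_le_mul
      filter_upwards [(memLp_ev_mul p f).coeFn_toLp] with x hx
      simp only [LinearMap.mk₂_apply]
      rw [hx, norm_mul]
      gcongr
      exact hC' x p)

lemma coeFn_evMul (p : H1) (f : L2) : evMul p f =ᵐ[volume] fun x => H1.ev x p * f x :=
  (memLp_ev_mul p f).coeFn_toLp

lemma shift_evMul (h : ℝ) (p : H1) (f : L2) :
    shift h (evMul p f) = evMul (H1.shift h p) (shift h f) := by
  apply Lp.ext
  filter_upwards [coeFn_shift h (evMul p f), ae_comp_add_right (coeFn_evMul p f) h,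
    coeFn_evMul (H1.shift h p) (shift h f), coeFn_shift h f] with x h1 h2 h3 h4
  rw [h1, h2, h3, h4, H1.ev_shift]

lemma evMul_toL2_comm (p q : H1) : evMul p q.toL2 = evMul q p.toL2 := by
  apply Lp.ext
  filter_upwards [coeFn_evMul p q.toL2, coeFn_evMul q p.toL2, p.coeFn_ae_eq,
    q.coeFn_ae_eq] with x h1 h2 h3 h4
  rw [h1, h2, h3, h4, mul_comm]

/-- The Leibniz rule. -/
lemma mul_mem_H1 (p q : H1) :
    ((evMul p q.toL2, evMul q p.deriv + evMul p q.deriv) : L2 × L2) ∈ H1Graph := by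
  change HasDerivAt (fun h => shift h (evMul p q.toL2)) (evMul q p.deriv + evMul p q.deriv) 0
  have hp := hasDerivAt_iff_tendsto_slope_zero.1 (p.hasDerivAt_shift 0)
  have hq := hasDerivAt_iff_tendsto_slope_zero.1 (q.hasDerivAt_shift 0)
  simp only [zero_add, shift_zero] at hp hq
  rw [hasDerivAt_iff_tendsto_slope_zero]
  have hsp : Tendsto (fun h => evMul (H1.shift h p)) (𝓝[≠] 0) (𝓝 (evMul p)) := by
    have : Continuous fun h => evMul (H1.shift h p) :=
      evMul.continuous.comp (H1.continuous_shift_comp continuous_id continuous_const)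
    have := this.tendsto 0
    rw [H1.shift_zero] at this
    exact this.mono_left nhdsWithin_le_nhds
  have h1 := (((evMul q).continuous.tendsto _).comp hp).add 
    ((isBoundedBilinearMap_apply.continuous.tendsto (evMul p, q.deriv)).comp (hsp.prodMk_nhds hq))
  refine h1.congr fun h => ?_
  simp only [zero_add, shift_zero, Function.comp_apply]
  -- Discrete product rule: one difference is multiplied by an unshifted factor and the other by a
  -- shifted one, which converges as a multiplier because `H¹` translations are strongly continuous.
  have e : shift h (evMul p q.toL2) - evMul p q.toL2 =
      evMul q (shift h p.toL2 - p.toL2) + evMul (H1.shift h p) (shift h q.toL2 - q.toL2) := by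
    rw [shift_evMul, map_sub, map_sub, ← H1.toL2_shift h p, evMul_toL2_comm q,
      evMul_toL2_comm q p]
    abel
  rw [e, smul_add]
  congr 1
  · exact (evMul q).map_smul_of_tower _ _
  · exact (evMul (H1.shift h p)).map_smul_of_tower _ _

/-- The product of two elements of `H¹`. -/
def H1.mul (p q : H1) : H1 := ⟨_, mul_mem_H1 p q⟩

lemma H1.ext_ev {p q : H1} (h : ∀ x, H1.ev x p = H1.ev x q) : p = q := by
  apply H1.toL2_injective
  apply Lp.ext
  filter_upwards [p.coeFn_ae_eq, q.coeFn_ae_eq] with x h1 h2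
  rw [h1, h2, h x]

/-- A continuous function which agrees a.e. with `p` is the representative of `p`. -/
lemma H1.ev_eq_of_ae {p : H1} {f : ℝ → ℂ} (hf : Continuous f) (h : p.toL2 =ᵐ[volume] f) (x : ℝ) :
    H1.ev x p = f x :=
  congrFun (Measure.eq_of_ae_eq (μ := volume) (p.coeFn_ae_eq.symm.trans h)
    (H1.continuous_ev_comp continuous_id continuous_const) hf) x

@[simp] lemma H1.ev_mul (x : ℝ) (p q : H1) : H1.ev x (p.mul q) = H1.ev x p * H1.ev x q := by
  apply H1.ev_eq_of_ae (f := fun x => H1.ev x p * H1.ev x q)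
  · exact (H1.continuous_ev_comp continuous_id continuous_const).mul
      (H1.continuous_ev_comp continuous_id continuous_const)
  · filter_upwards [coeFn_evMul p q.toL2, q.coeFn_ae_eq] with x h1 h2
    rw [← h2]; exact h1

/-- Multiplication on `H¹` as a continuous bilinear map. -/
def H1.mulL : H1 →L[ℂ] H1 →L[ℂ] H1 :=
  LinearMap.mkContinuous₂
    (LinearMap.mk₂ ℂ H1.mul
      (fun p q r => H1.ext_ev fun x => by simp [add_mul])
      (fun c p r => H1.ext_ev fun x => by simp [mul_assoc])
      (fun p q r => H1.ext_ev fun x => by simp [mul_add])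
      (fun c p q => H1.ext_ev fun x => by simp [mul_left_comm]))
    (‖evMul‖ + ‖evMul‖)
    (fun p q => by
      have b : ∀ (p q : H1) (f : L2), ‖f‖ ≤ ‖q‖ → ‖evMul p f‖ ≤ ‖evMul‖ * ‖p‖ * ‖q‖ :=
        fun p q f hf => (evMul.le_opNorm₂ p f).trans (by gcongr)
      rw [H1.norm_eq]
      refine max_le ?_ ?_
      · refine (b p q _ q.norm_toL2_le).trans ?_
        have : 0 ≤ ‖evMul‖ * ‖p‖ * ‖q‖ := by positivity
        linarith
      · refine (norm_add_le _ _).trans ?_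
        have h1 := b q p _ p.norm_deriv_le
        have h2 := b p q _ q.norm_deriv_le
        linarith)

@[simp] lemma H1.mulL_apply (p q : H1) : H1.mulL p q = p.mul q := rfl

/-- Complex conjugation on `L²`. -/
def conjL2 : L2 →L[ℝ] L2 := Complex.conjCLE.toContinuousLinearMap.compLpL 2 volume

lemma coeFn_conjL2 (f : L2) : conjL2 f =ᵐ[volume] fun x => conj (f x) :=
  Complex.conjCLE.toContinuousLinearMap.coeFn_compLp f

lemma shift_conjL2 (h : ℝ) (f : L2) : shift h (conjL2 f) = conjL2 (shift h f) := by
  apply Lp.ext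
  filter_upwards [coeFn_shift h (conjL2 f), ae_comp_add_right (coeFn_conjL2 f) h,
    coeFn_conjL2 (shift h f), coeFn_shift h f] with x h1 h2 h3 h4
  rw [h1, h2, h3, h4]

lemma conj_mem_H1 (p : H1) : ((conjL2 p.toL2, conjL2 p.deriv) : L2 × L2) ∈ H1Graph := by
  have := (conjL2.hasFDerivAt).comp_hasDerivAt (0 : ℝ) (p.hasDerivAt_shift 0)
  change HasDerivAt (fun h => Dirac.shift h (conjL2 p.toL2)) (conjL2 p.deriv) 0
  simp only [shift_conjL2]
  rwa [Dirac.shift_zero] at this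

/-- Complex conjugation on `H¹`. -/
def H1.conjL : H1 →L[ℝ] H1 where
  toFun p := ⟨(conjL2 p.toL2, conjL2 p.deriv), conj_mem_H1 p⟩
  map_add' p q := by ext1; simp
  map_smul' c p := by
    ext1
    simp only [RingHom.id_apply]
    exact Prod.ext (map_smul conjL2 c p.toL2) (map_smul conjL2 c p.deriv)
  cont := Continuous.subtype_mk ((conjL2.continuous.comp H1.toL2.continuous).prodMk
    (conjL2.continuous.comp H1.deriv.continuous)) conj_mem_H1

@[simp] lemma H1.ev_conjL (x : ℝ) (p : H1) : H1.ev x (H1.conjL p) = conj (H1.ev x p) := by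
  apply H1.ev_eq_of_ae (f := fun x => conj (H1.ev x p))
  · exact Complex.continuous_conj.comp (H1.continuous_ev_comp continuous_id continuous_const)
  · filter_upwards [coeFn_conjL2 p.toL2, p.coeFn_ae_eq] with x h1 h2
    rw [← h2]; exact h1

/-- The cubic nonlinearity on `H¹`. -/
def H1.cubic (a : Fin 2 → Fin 3 → ℂ) (p q : H1) : H1 :=
  H1.mulL (a 0 0 • p + a 1 0 • H1.conjL p) (H1.mulL q (H1.conjL q))
    + H1.mulL (a 0 1 • p + a 1 1 • H1.conjL p) (H1.mulL q q)
    + H1.mulL (a 0 2 • p + a 1 2 • H1.conjL p) (H1.mulL (H1.conjL q) (H1.conjL q))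

@[simp] lemma H1.ev_cubic (a : Fin 2 → Fin 3 → ℂ) (p q : H1) (x : ℝ) :
    H1.ev x (H1.cubic a p q) = Dirac.cubic a (H1.ev x p) (H1.ev x q) := by
  simp only [H1.cubic, Dirac.cubic, H1.mulL_apply]
  simp only [map_add, H1.ev_mul, H1.ev_conjL, map_smul, smul_eq_mul]
  rw [← Complex.normSq_eq_norm_sq, Complex.normSq_eq_conj_mul_self]
  ring

/-! ### Fields that are Lipschitz on bounded sets, uniformly in time -/

/-- `A` is jointly continuous, and bounded and Lipschitz on bounded sets uniformly in time. -/
def BddLip {E G : Type*} [NormedAddCommGroup E] [NormedAddCommGroup G] (A : ℝ → E → G) : Prop :=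
  Continuous (Function.uncurry A) ∧ ∀ R : ℝ, ∃ K : ℝ, 0 ≤ K ∧ ∀ t x y, ‖x‖ ≤ R → ‖y‖ ≤ R →
    ‖A t x‖ ≤ K ∧ ‖A t x - A t y‖ ≤ K * ‖x - y‖

section BddLip

variable {E G G' G'' : Type*} [NormedAddCommGroup E] [NormedAddCommGroup G]
  [NormedAddCommGroup G'] [NormedAddCommGroup G'']

lemma BddLip.add {A B : ℝ → E → G} (hA : BddLip A) (hB : BddLip B) :
    BddLip fun t x => A t x + B t x := by
  refine ⟨hA.1.add hB.1, fun R => ?_⟩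
  obtain ⟨K, hK, h⟩ := hA.2 R
  obtain ⟨K', hK', h'⟩ := hB.2 R
  refine ⟨K + K', by positivity, fun t x y hx hy => ⟨?_, ?_⟩⟩
  · exact (norm_add_le _ _).trans (add_le_add (h t x y hx hy).1 (h' t x y hx hy).1)
  · rw [add_sub_add_comm, add_mul]
    exact (norm_add_le _ _).trans (add_le_add (h t x y hx hy).2 (h' t x y hx hy).2)

lemma BddLip.prodMk {A : ℝ → E → G} {B : ℝ → E → G'} (hA : BddLip A) (hB : BddLip B) :
    BddLip fun t x => (A t x, B t x) := by
  refine ⟨hA.1.prodMk hB.1, fun R => ?_⟩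
  obtain ⟨K, hK, h⟩ := hA.2 R
  obtain ⟨K', hK', h'⟩ := hB.2 R
  refine ⟨max K K', by positivity, fun t x y hx hy => ⟨?_, ?_⟩⟩
  · exact max_le_max (h t x y hx hy).1 (h' t x y hx hy).1
  · rw [max_mul_of_nonneg _ _ (norm_nonneg _)]
    exact max_le_max (h t x y hx hy).2 (h' t x y hx hy).2

lemma BddLip.clm {𝕜 : Type*} [NontriviallyNormedField 𝕜] [NormedSpace 𝕜 G] [NormedSpace 𝕜 G']
    {A : ℝ → E → G} (hA : BddLip A) (L : G →L[𝕜] G') : BddLip fun t x => L (A t x) := by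
  refine ⟨L.continuous.comp hA.1, fun R => ?_⟩
  obtain ⟨K, hK, h⟩ := hA.2 R
  refine ⟨‖L‖ * K, by positivity, fun t x y hx hy => ⟨?_, ?_⟩⟩
  · exact (L.le_opNorm _).trans (by gcongr; exact (h t x y hx hy).1)
  · rw [← map_sub, mul_assoc]
    exact (L.le_opNorm _).trans (by gcongr; exact (h t x y hx hy).2)

lemma BddLip.bilin {𝕜 : Type*} [NontriviallyNormedField 𝕜] [NormedSpace 𝕜 G] [NormedSpace 𝕜 G']
    [NormedSpace 𝕜 G''] {A : ℝ → E → G} {B : ℝ → E → G'} (hA : BddLip A) (hB : BddLip B)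
    (L : G →L[𝕜] G' →L[𝕜] G'') : BddLip fun t x => L (A t x) (B t x) := by
  refine ⟨(L.continuous.comp hA.1).clm_apply hB.1, fun R => ?_⟩
  obtain ⟨K, hK, h⟩ := hA.2 R
  obtain ⟨K', hK', h'⟩ := hB.2 R
  refine ⟨‖L‖ * K * K' + ‖L‖ * K * K', by positivity, fun t x y hx hy => ⟨?_, ?_⟩⟩
  · have : ‖L (A t x) (B t x)‖ ≤ ‖L‖ * K * K' := (L.le_opNorm₂ _ _).trans (by
      gcongr
      exacts [(h t x y hx hy).1, (h' t x y hx hy).1])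
    have h0 : 0 ≤ ‖L‖ * K * K' := by positivity
    linarith
  · have e : L (A t x) (B t x) - L (A t y) (B t y) =
        L (A t x - A t y) (B t x) + L (A t y) (B t x - B t y) := by
      simp
    have h1 : ‖L (A t x - A t y) (B t x)‖ ≤ ‖L‖ * (K * ‖x - y‖) * K' :=
      (L.le_opNorm₂ _ _).trans (by
        gcongr
        exacts [(h t x y hx hy).2, (h' t x y hx hy).1])
    have h2 : ‖L (A t y) (B t x - B t y)‖ ≤ ‖L‖ * K * (K' * ‖x - y‖) :=
      (L.le_opNorm₂ _ _).trans (by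
        gcongr
        exacts [(h t y x hy hx).1, (h' t x y hx hy).2])
    rw [e]
    refine (norm_add_le _ _).trans ?_
    linarith

lemma bddLip_fst : BddLip fun (_ : ℝ) (x : G × G') => x.1 := by
  refine ⟨by fun_prop, fun R => ⟨max R 1, by positivity, fun t x y hx hy => ⟨?_, ?_⟩⟩⟩
  · exact (norm_fst_le x).trans (hx.trans (le_max_left _ _))
  · exact (norm_fst_le (x - y)).trans (le_mul_of_one_le_left (norm_nonneg _) (le_max_right _ _))

lemma bddLip_snd : BddLip fun (_ : ℝ) (x : G × G') => x.2 := by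
  refine ⟨by fun_prop, fun R => ⟨max R 1, by positivity, fun t x y hx hy => ⟨?_, ?_⟩⟩⟩
  · exact (norm_snd_le x).trans (hx.trans (le_max_left _ _))
  · exact (norm_snd_le (x - y)).trans (le_mul_of_one_le_left (norm_nonneg _) (le_max_right _ _))

/-- Isometry keeps the constants uniform in time. In the time variable only strong continuity of
translations is available, and the definition of `BddLip` asks for no more. -/
lemma BddLip.shift {A : ℝ → E → H1} (hA : BddLip A) (c : ℝ) :
    BddLip fun t x => H1.shift (c * t) (A t x) := by
  refine ⟨H1.continuous_shift_comp (by fun_prop) hA.1, fun R => ?_⟩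
  obtain ⟨K, hK, h⟩ := hA.2 R
  refine ⟨K, hK, fun t x y hx hy => ⟨?_, ?_⟩⟩
  · rw [H1.norm_shift]; exact (h t x y hx hy).1
  · rw [← map_sub, H1.norm_shift]; exact (h t x y hx hy).2

lemma BddLip.smul {A : ℝ → E → H1} (hA : BddLip A) (c : ℂ) :
    BddLip fun t x => c • A t x :=
  hA.clm (c • ContinuousLinearMap.id ℂ H1)

lemma BddLip.cubic {A B : ℝ → E → H1} (hA : BddLip A) (hB : BddLip B)
    (a : Fin 2 → Fin 3 → ℂ) : BddLip fun t x => H1.cubic a (A t x) (B t x) := by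
  have hA' := hA.clm H1.conjL
  have hB' := hB.clm H1.conjL
  exact (((((hA.smul _).add (hA'.smul _)).bilin (hB.bilin hB' H1.mulL) H1.mulL).add
    (((hA.smul _).add (hA'.smul _)).bilin (hB.bilin hB H1.mulL) H1.mulL)).add
    (((hA.smul _).add (hA'.smul _)).bilin (hB'.bilin hB' H1.mulL) H1.mulL))

end BddLip

/-- The vector field of the system in characteristic coordinates. -/
def field (a b : Fin 2 → Fin 3 → ℂ) (m : ℝ) (t : ℝ) (F : H1 × H1) : H1 × H1 :=
  -- The characteristic of `v` through the point `(t, x+t)` carries the label `x + 2t`. This is the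
  -- origin of the shift by `2t`, and symmetrically of the shift by `-2t` in the second component.
  (-Complex.I • (-(m : ℂ) • H1.shift (2 * t) F.2 + H1.cubic a F.1 (H1.shift (2 * t) F.2)),
    -Complex.I • (-(m : ℂ) • H1.shift (-2 * t) F.1 + H1.cubic b F.2 (H1.shift (-2 * t) F.1)))

lemma bddLip_field (a b : Fin 2 → Fin 3 → ℂ) (m : ℝ) : BddLip (field a b m) :=
  ((((bddLip_snd.shift 2).smul _).add (bddLip_fst.cubic (bddLip_snd.shift 2) a)).smul _).prodMk
    ((((bddLip_fst.shift (-2)).smul _).add (bddLip_snd.cubic (bddLip_fst.shift (-2)) b)).smul _)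

/-! ### Elementary estimates -/

/-- The sum of the moduli of the coefficients. -/
def coeffSum (a : Fin 2 → Fin 3 → ℂ) : ℝ := ∑ j, (‖a 0 j‖ + ‖a 1 j‖)

lemma coeffSum_nonneg (a : Fin 2 → Fin 3 → ℂ) : 0 ≤ coeffSum a :=
  Finset.sum_nonneg fun _ _ => by positivity

lemma norm_cubic_combination_le (a : Fin 2 → Fin 3 → ℂ) (z : ℂ) (q : Fin 3 → ℂ) {B : ℝ}
    (hq : ∀ j, ‖q j‖ ≤ B) :
    ‖(a 0 0 * z + a 1 0 * conj z) * q 0 + (a 0 1 * z + a 1 1 * conj z) * q 1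
      + (a 0 2 * z + a 1 2 * conj z) * q 2‖ ≤ coeffSum a * (‖z‖ * B) := by
  have h : ∀ j, ‖(a 0 j * z + a 1 j * conj z) * q j‖ ≤ (‖a 0 j‖ + ‖a 1 j‖) * (‖z‖ * B) := by
    intro j
    rw [norm_mul, ← mul_assoc]
    gcongr
    · refine (norm_add_le _ _).trans ?_
      rw [norm_mul, norm_mul, Complex.norm_conj, add_mul]
    · exact hq j
  simp only [coeffSum, Fin.sum_univ_three]
  refine (norm_add₃_le).trans ?_
  have h0 := h 0; have h1 := h 1; have h2 := h 2
  linarith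

lemma norm_cubic_le (a : Fin 2 → Fin 3 → ℂ) (z w : ℂ) :
    ‖cubic a z w‖ ≤ coeffSum a * (‖z‖ * ‖w‖ ^ 2) := by
  apply norm_cubic_combination_le a z ![((‖w‖ ^ 2 : ℝ) : ℂ), w ^ 2, conj w ^ 2]
  intro j
  fin_cases j <;> simp

/-- The two parts play different roles later: the factor of `‖z - z'‖` is a Gronwall coefficient,
while the part with `‖w - w'‖` is a source term. -/
lemma norm_cubic_sub_le (a : Fin 2 → Fin 3 → ℂ) (z w z' w' : ℂ) :
    ‖cubic a z w - cubic a z' w'‖ ≤ coeffSum a * (‖z - z'‖ * (‖w‖ ^ 2 + ‖w'‖ ^ 2)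
      + ‖w - w'‖ * (‖z‖ + ‖z'‖) * (‖w‖ + ‖w'‖)) := by
  have e : cubic a z w - cubic a z' w' = cubic a (z - z') w +
      ((a 0 0 * z' + a 1 0 * conj z') * (((‖w‖ ^ 2 : ℝ) : ℂ) - ((‖w'‖ ^ 2 : ℝ) : ℂ))
        + (a 0 1 * z' + a 1 1 * conj z') * (w ^ 2 - w' ^ 2)
        + (a 0 2 * z' + a 1 2 * conj z') * (conj w ^ 2 - conj w' ^ 2)) := by
    simp only [cubic, map_sub]; ring
  have h1 : ‖w ^ 2 - w' ^ 2‖ ≤ ‖w - w'‖ * (‖w‖ + ‖w'‖) := by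
    rw [sq_sub_sq, norm_mul, mul_comm]
    gcongr
    exact norm_add_le _ _
  have h2 := norm_cubic_combination_le a z' ![((‖w‖ ^ 2 : ℝ) : ℂ) - ((‖w'‖ ^ 2 : ℝ) : ℂ),
    w ^ 2 - w' ^ 2, conj w ^ 2 - conj w' ^ 2] (B := ‖w - w'‖ * (‖w‖ + ‖w'‖)) (by
      intro j
      fin_cases j
      · change ‖((‖w‖ ^ 2 : ℝ) : ℂ) - ((‖w'‖ ^ 2 : ℝ) : ℂ)‖ ≤ _
        rw [← Complex.ofReal_sub, Complex.norm_real, sq_sub_sq, norm_mul, mul_comm]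
        gcongr
        · exact abs_norm_sub_norm_le _ _
        · rw [Real.norm_of_nonneg (by positivity)]
      · exact h1
      · change ‖conj w ^ 2 - conj w' ^ 2‖ ≤ _
        rwa [← map_pow, ← map_pow, ← map_sub, Complex.norm_conj])
  rw [e]
  refine (norm_add_le _ _).trans ((add_le_add (norm_cubic_le a _ w) h2).trans ?_)
  rw [← mul_add]
  refine mul_le_mul_of_nonneg_left ?_ (coeffSum_nonneg a)
  have : 0 ≤ ‖z - z'‖ * ‖w'‖ ^ 2 + ‖w - w'‖ * ‖z‖ * (‖w‖ + ‖w'‖) := by positivity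
  linarith

lemma continuous_cubic_comp {X : Type*} [TopologicalSpace X] (a : Fin 2 → Fin 3 → ℂ)
    {z w : X → ℂ} (hz : Continuous z) (hw : Continuous w) :
    Continuous fun x => cubic a (z x) (w x) := by
  have hz' : Continuous fun x => conj (z x) := Complex.continuous_conj.comp hz
  have hw' : Continuous fun x => conj (w x) := Complex.continuous_conj.comp hw
  have hl : ∀ c d : ℂ, Continuous fun x => c * z x + d * conj (z x) := fun c d =>
    (continuous_const.mul hz).add (continuous_const.mul hz')
  exact (((hl _ _).mul (Complex.continuous_ofReal.comp (hw.norm.pow 2))).add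
    ((hl _ _).mul (hw.pow 2))).add ((hl _ _).mul (hw'.pow 2))

lemma ennreal_add_sq_le (a b : ℝ≥0∞) : (a + b) ^ 2 ≤ 2 * (a ^ 2 + b ^ 2) := by
  induction a with
  | top => simp
  | coe a =>
    induction b with
    | top => simp
    | coe b =>
      norm_cast
      rw [← NNReal.coe_le_coe]
      push_cast
      exact add_sq_le

lemma ennreal_add_sq_le₃ (a b c : ℝ≥0∞) : (a + b + c) ^ 2 ≤ 3 * (a ^ 2 + b ^ 2 + c ^ 2) := by
  induction a with
  | top => simp
  | coe a =>
    induction b with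
    | top => simp
    | coe b =>
      induction c with
      | top => simp
      | coe c =>
        norm_cast
        rw [← NNReal.coe_le_coe]
        push_cast
        nlinarith [sq_nonneg ((a : ℝ) - b), sq_nonneg ((b : ℝ) - c), sq_nonneg ((a : ℝ) - c)]

/-- This is the absorption step that closes the stability estimate. Finiteness is essential, since
`⊤` satisfies the inequality trivially. -/
lemma ennreal_le_two_mul_of_le_add_half {S c : ℝ≥0∞} (hS : S ≠ ⊤) (h : S ≤ c + S / 2) :
    S ≤ 2 * c := by
  have h2 : S / 2 ≤ c := by
    have h3 : S / 2 + S / 2 ≤ c + S / 2 := by rwa [ENNReal.add_halves]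
    exact (ENNReal.add_le_add_iff_right (ENNReal.div_ne_top hS two_ne_zero)).1 h3
  calc S = 2 * (S / 2) := (ENNReal.mul_div_cancel two_ne_zero (by simp)).symm
    _ ≤ 2 * c := by gcongr

/-- The Cauchy–Schwarz inequality for lower Lebesgue integrals. -/
lemma lintegral_mul_sq_le {X : Type*} [MeasurableSpace X] {μ : Measure X} {f g : X → ℝ≥0∞}
    (hf : AEMeasurable f μ) (hg : AEMeasurable g μ) :
    (∫⁻ x, f x * g x ∂μ) ^ 2 ≤ (∫⁻ x, f x ^ 2 ∂μ) * ∫⁻ x, g x ^ 2 ∂μ := by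
  have h := ENNReal.lintegral_mul_le_Lp_mul_Lq μ Real.HolderConjugate.two_two hf hg
  have e : ∀ y : ℝ≥0∞, (y ^ (1 / 2 : ℝ)) ^ 2 = y := fun y => by
    rw [← ENNReal.rpow_natCast, ← ENNReal.rpow_mul]; simp
  calc (∫⁻ x, f x * g x ∂μ) ^ 2 ≤ _ := pow_le_pow_left' h 2
    _ = _ := by
      rw [mul_pow, e, e]
      simp only [ENNReal.rpow_ofNat]

lemma setLIntegral_sq_le {T : ℝ} {f : ℝ → ℝ≥0∞} (hf : Measurable f) :
    (∫⁻ s in Ioc 0 T, f s) ^ 2 ≤ ENNReal.ofReal T * ∫⁻ s in Ioc 0 T, f s ^ 2 := by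
  have := lintegral_mul_sq_le (μ := volume.restrict (Ioc 0 T)) (f := fun _ => 1) (g := f)
    aemeasurable_const hf.aemeasurable
  simpa using this

lemma lintegral_comp_add_mul {F : ℝ → ℝ≥0∞} (hF : Measurable F) (x : ℝ) {c : ℝ} (hc : c ≠ 0) :
    ∫⁻ r, F (x + c * r) = ENNReal.ofReal |c⁻¹| * ∫⁻ y, F y := by
  have h1 : ∫⁻ r, F (x + c * r) = ∫⁻ r, F (x + r) ∂(Measure.map (c * ·) volume) := by
    rw [lintegral_map (by fun_prop) (by fun_prop)]
  rw [h1, Real.map_volume_mul_left hc, lintegral_smul_measure,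
    lintegral_add_left_eq_self F x, smul_eq_mul]

lemma setLIntegral_comp_add_two_mul_le {F : ℝ → ℝ≥0∞} (hF : Measurable F) (x T : ℝ) :
    ∫⁻ r in Ioc 0 T, F (x + 2 * r) ≤ 2⁻¹ * ∫⁻ y, F y := by
  refine (setLIntegral_le_lintegral _ _).trans ?_
  rw [lintegral_comp_add_mul hF x two_ne_zero, abs_of_pos (by norm_num),
    ENNReal.ofReal_inv_of_pos two_pos, ENNReal.ofReal_ofNat]

lemma setLIntegral_comp_sub_two_mul_le {F : ℝ → ℝ≥0∞} (hF : Measurable F) (x T : ℝ) :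
    ∫⁻ r in Ioc 0 T, F (x - 2 * r) ≤ 2⁻¹ * ∫⁻ y, F y := by
  refine (setLIntegral_le_lintegral _ _).trans ?_
  have := lintegral_comp_add_mul hF x (c := -2) (by norm_num)
  simp only [neg_mul, ← sub_eq_add_neg] at this
  rw [this, inv_neg, abs_neg, abs_of_pos (by norm_num),
    ENNReal.ofReal_inv_of_pos two_pos, ENNReal.ofReal_ofNat]

/-- Fubini on the triangle `0 < r < s < T`. -/
lemma integral_triangle_swap {h : ℝ → ℝ → ℝ} (hh : Continuous (Function.uncurry h)) {T : ℝ}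
    (hT : 0 ≤ T) :
    ∫ r in (0 : ℝ)..T, ∫ s in r..T, h r s = ∫ s in (0 : ℝ)..T, ∫ r in (0 : ℝ)..s, h r s := by
  have hint : Integrable (Function.uncurry fun r s => (Ioi r).indicator (h r) s)
      ((volume.restrict (Ioc 0 T)).prod (volume.restrict (Ioc 0 T))) := by
    have h1 : Integrable (Function.uncurry h)
        ((volume.restrict (Ioc 0 T)).prod (volume.restrict (Ioc 0 T))) := by
      rw [Measure.prod_restrict]
      exact (hh.continuousOn.integrableOn_compact (isCompact_Icc.prod isCompact_Icc)).mono_set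
        (prod_mono Ioc_subset_Icc_self Ioc_subset_Icc_self)
    have h2 := h1.indicator (s := {z : ℝ × ℝ | z.1 < z.2})
      (measurableSet_lt measurable_fst measurable_snd)
    refine h2.congr (Eventually.of_forall fun z => ?_)
    simp only [Function.uncurry, indicator, mem_Ioi]
    rfl
  have hsw := integral_integral_swap hint
  rw [intervalIntegral.integral_of_le hT, intervalIntegral.integral_of_le hT]
  calc _ = ∫ r in Ioc 0 T, ∫ s in Ioc 0 T, (Ioi r).indicator (h r) s := by
        refine setIntegral_congr_fun measurableSet_Ioc fun r hr => ?_
        rw [setIntegral_indicator measurableSet_Ioi, intervalIntegral.integral_of_le hr.2]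
        congr 2
        ext s; simp only [mem_inter_iff, mem_Ioc, mem_Ioi]
        exact ⟨fun h => ⟨⟨hr.1.trans h.1, h.2⟩, h.1⟩, fun h => ⟨h.2, h.1.2⟩⟩
    _ = _ := hsw
    _ = _ := by
        refine setIntegral_congr_fun measurableSet_Ioc fun s hs => ?_
        have e : ∀ r, (Ioi r).indicator (h r) s = (Iio s).indicator (fun r => h r s) r := by
          intro r; simp only [indicator, mem_Ioi, mem_Iio]
        simp only [e]
        rw [setIntegral_indicator measurableSet_Iio, intervalIntegral.integral_of_le hs.1.le,
          integral_Ioc_eq_integral_Ioo]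
        congr 2
        ext r; simp only [mem_inter_iff, mem_Ioc, mem_Ioo, mem_Iio]
        exact ⟨fun h => ⟨h.1.1, h.2⟩, fun h => ⟨⟨h.1, h.2.le.trans hs.2⟩, h.2⟩⟩

lemma ofReal_intervalIntegral {α : ℝ → ℝ} (hα : Continuous α) (h0 : ∀ t, 0 ≤ α t) {T : ℝ}
    (hT : 0 ≤ T) :
    ENNReal.ofReal (∫ t in (0 : ℝ)..T, α t) = ∫⁻ t in Ioc 0 T, ENNReal.ofReal (α t) := by
  rw [intervalIntegral.integral_of_le hT]
  exact ofReal_integral_eq_lintegral_ofReal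
    ((hα.integrableOn_Icc (a := 0) (b := T)).mono_set Ioc_subset_Icc_self)
    (Eventually.of_forall h0)

/-- A linear differential inequality whose coefficient has small integral. -/
lemma enorm_le_of_deriv_le {φ φ' : ℝ → ℂ} {α β : ℝ → ℝ} {T : ℝ} (hφ : Continuous φ)
    (hd : ∀ t ∈ Ioo 0 T, HasDerivAt φ (φ' t) t) (hφ' : Continuous φ')
    (hα : Continuous α) (hβ : Continuous β) (hα0 : ∀ t, 0 ≤ α t) (hβ0 : ∀ t, 0 ≤ β t)
    (hb : ∀ t ∈ Icc 0 T, ‖φ' t‖ ≤ α t + β t * ‖φ t‖)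
    (hβT : ∫⁻ t in Ioc 0 T, ENNReal.ofReal (β t) ≤ 2⁻¹) {t : ℝ} (ht : t ∈ Icc 0 T) :
    ‖φ t‖ₑ ≤ 2 * (‖φ 0‖ₑ + ∫⁻ t in Ioc 0 T, ENNReal.ofReal (α t)) := by
  have hT : 0 ≤ T := ht.1.trans ht.2
  have hβT' : ∫ t in (0 : ℝ)..T, β t ≤ 1 / 2 := by
    rw [← ofReal_intervalIntegral hβ hβ0 hT] at hβT
    rw [show (2 : ℝ≥0∞)⁻¹ = ENNReal.ofReal (1 / 2) by
      rw [one_div, ENNReal.ofReal_inv_of_pos two_pos, ENNReal.ofReal_ofNat]] at hβT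
    exact (ENNReal.ofReal_le_ofReal_iff (by norm_num)).1 hβT
  -- At a point where `‖φ‖` is maximal, the integral of `β‖φ‖` is at most half the maximum and moves
  -- to the left-hand side. This gives the factor 2 without an exponential.
  obtain ⟨s, hs, hmax⟩ := isCompact_Icc.exists_isMaxOn (nonempty_Icc.2 hT)
    (hφ.norm.continuousOn (s := Icc 0 T))
  have hM : ∀ r ∈ Icc 0 T, ‖φ r‖ ≤ ‖φ s‖ := fun r hr => hmax hr
  have hftc : ∫ r in (0 : ℝ)..s, φ' r = φ s - φ 0 :=
    intervalIntegral.integral_eq_sub_of_hasDerivAt_of_le hs.1 hφ.continuousOn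
      (fun r hr => hd r ⟨hr.1, hr.2.trans_le hs.2⟩) (hφ'.intervalIntegrable _ _)
  have hcont : Continuous fun r => α r + β r * ‖φ s‖ := by fun_prop
  have h1 : ‖φ s - φ 0‖ ≤ ∫ r in (0 : ℝ)..T, (α r + β r * ‖φ s‖) := by
    rw [← hftc]
    refine (intervalIntegral.norm_integral_le_of_norm_le hs.1 (g := fun r => α r + β r * ‖φ s‖)
      ?_ (hcont.intervalIntegrable _ _)).trans ?_
    · refine Eventually.of_forall fun r hr => ?_
      have hr' : r ∈ Icc 0 T := ⟨hr.1.le, hr.2.trans hs.2⟩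
      refine (hb r hr').trans ?_
      gcongr
      · exact hβ0 r
      · exact hM r hr'
    · refine intervalIntegral.integral_mono_interval le_rfl hs.1 hs.2 ?_
        (hcont.intervalIntegrable _ _)
      exact Eventually.of_forall fun r => add_nonneg (hα0 r) (mul_nonneg (hβ0 r) (norm_nonneg _))
  rw [intervalIntegral.integral_add (hα.intervalIntegrable _ _)
    ((by fun_prop : Continuous fun r => β r * ‖φ s‖).intervalIntegrable _ _), intervalIntegral.integral_mul_const] at h1
  have h2 : ‖φ s‖ ≤ ‖φ 0‖ + ‖φ s - φ 0‖ := by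
    have := norm_add_le (φ 0) (φ s - φ 0)
    rwa [add_sub_cancel] at this
  have h3 : (∫ r in (0 : ℝ)..T, β r) * ‖φ s‖ ≤ 1 / 2 * ‖φ s‖ :=
    mul_le_mul_of_nonneg_right hβT' (norm_nonneg _)
  have hI : 0 ≤ ∫ r in (0 : ℝ)..T, α r := intervalIntegral.integral_nonneg hT fun r _ => hα0 r
  have h4 : ‖φ t‖ ≤ 2 * (‖φ 0‖ + ∫ r in (0 : ℝ)..T, α r) := by
    have := hM t ht
    linarith
  rw [← ofReal_intervalIntegral hα hα0 hT, ← ofReal_norm, ← ofReal_norm,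
    ← ENNReal.ofReal_add (norm_nonneg _) hI, ← ENNReal.ofReal_ofNat 2,
    ← ENNReal.ofReal_mul (by norm_num)]
  exact ENNReal.ofReal_le_ofReal h4

/-! ### The system in characteristic coordinates -/

/-- The square of the `L²` norm. -/
def nsq (h : ℝ → ℂ) : ℝ≥0∞ := ∫⁻ x, ‖h x‖ₑ ^ 2

/-- The right-hand side of the equation along a characteristic. -/
def rhs (a : Fin 2 → Fin 3 → ℂ) (m : ℝ) (z w : ℂ) : ℂ :=
  -Complex.I * (-(m : ℂ) * w + cubic a z w)

lemma continuous_rhs_comp {X : Type*} [TopologicalSpace X] (a : Fin 2 → Fin 3 → ℂ) (m : ℝ)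
    {z w : X → ℂ} (hz : Continuous z) (hw : Continuous w) :
    Continuous fun x => rhs a m (z x) (w x) :=
  continuous_const.mul ((continuous_const.mul hw).add (continuous_cubic_comp a hz hw))

lemma ChargeCondition.symm {a b : Fin 2 → Fin 3 → ℂ} (hab : ChargeCondition a b) :
    ChargeCondition b a := fun u v => by
  rw [add_comm]; exact hab v u

/-- The mass terms cancel because `w z̄ + z w̄` is real. The cubic terms cancel by the charge
condition. -/
lemma ChargeCondition.rhs_re {a b : Fin 2 → Fin 3 → ℂ} (hab : ChargeCondition a b) (m : ℝ)
    (z w : ℂ) : (rhs a m z w * conj z).re + (rhs b m w z * conj w).re = 0 := by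
  have h := hab z w
  simp only [N1, N2] at h
  simp only [rhs]
  generalize cubic a z w = p at *
  generalize cubic b w z = q at *
  simp only [Complex.add_re, Complex.mul_re, Complex.mul_im, Complex.I_re, Complex.I_im,
    Complex.conj_re, Complex.conj_im, Complex.neg_re, Complex.neg_im, Complex.ofReal_re,
    Complex.ofReal_im, Complex.add_im] at *
  linarith

/-- `(f, g)` solves the system along characteristics, `f(t,x) = u(t,x+t)`, `g(t,x) = v(t,x-t)`,
with the right-hand side damped by a factor `χ(t) ∈ [0,1]`, and its charge is at most `C`. -/
structure CharSol (a b : Fin 2 → Fin 3 → ℂ) (m T C : ℝ) (χ : ℝ → ℝ) (f g : ℝ → ℝ → ℂ) :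
    Prop where
  cont_f : Continuous fun z : ℝ × ℝ => f z.1 z.2
  cont_g : Continuous fun z : ℝ × ℝ => g z.1 z.2
  cont_χ : Continuous χ
  χ_mem : ∀ t, χ t ∈ Icc (0 : ℝ) 1
  deriv_f : ∀ t ∈ Ioo 0 T, ∀ x, HasDerivAt (fun t => f t x)
    ((χ t : ℂ) * rhs a m (f t x) (g t (x + 2 * t))) t
  deriv_g : ∀ t ∈ Ioo 0 T, ∀ x, HasDerivAt (fun t => g t x)
    ((χ t : ℂ) * rhs b m (g t x) (f t (x - 2 * t))) t
  charge : ∀ t ∈ Icc 0 T, nsq (f t) + nsq (g t) ≤ ENNReal.ofReal C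

lemma continuous_comp₂ {X : Type*} [TopologicalSpace X] {f : ℝ → ℝ → ℂ}
    (hf : Continuous fun z : ℝ × ℝ => f z.1 z.2) {p q : X → ℝ} (hp : Continuous p)
    (hq : Continuous q) : Continuous fun x => f (p x) (q x) :=
  hf.comp (hp.prodMk hq)

lemma nsq_comp_neg (h : ℝ → ℂ) : nsq (fun x => h (-x)) = nsq h :=
  lintegral_neg_eq_self (fun x => ‖h x‖ₑ ^ 2) (μ := volume)

lemma nsq_comp_add (h : ℝ → ℂ) (c : ℝ) : nsq (fun x => h (x + c)) = nsq h :=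
  lintegral_add_right_eq_self (fun x => ‖h x‖ₑ ^ 2) c

lemma nsq_sub_le {h k : ℝ → ℂ} (hh : Continuous h) :
    nsq (fun x => h x - k x) ≤ 2 * (nsq h + nsq k) := by
  unfold nsq
  rw [← lintegral_add_left (by fun_prop), ← lintegral_const_mul' _ _ (by simp)]
  refine lintegral_mono fun x => ?_
  exact (pow_le_pow_left' (enorm_sub_le) 2).trans (ennreal_add_sq_le _ _)

namespace CharSol

variable {a b : Fin 2 → Fin 3 → ℂ} {m T C : ℝ} {χ : ℝ → ℝ} {f g f' g' : ℝ → ℝ → ℂ}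

/-- Spatial reflection exchanges the two components. -/
lemma reflect (S : CharSol a b m T C χ f g) :
    CharSol b a m T C χ (fun t x => g t (-x)) (fun t x => f t (-x)) where
  cont_f := continuous_comp₂ S.cont_g (by fun_prop) (by fun_prop)
  cont_g := continuous_comp₂ S.cont_f (by fun_prop) (by fun_prop)
  cont_χ := S.cont_χ
  χ_mem := S.χ_mem
  deriv_f t ht x := by
    have := S.deriv_g t ht (-x)
    rwa [show -x - 2 * t = -(x + 2 * t) by ring] at this
  deriv_g t ht x := by
    have := S.deriv_f t ht (-x)
    rwa [show -x + 2 * t = -(x - 2 * t) by ring] at this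
  charge t ht := by
    rw [nsq_comp_neg, nsq_comp_neg, add_comm]; exact S.charge t ht

/-- The damping depends on time only, so a solution and its translate obey the same damped system.
The stability estimate can then be applied to this pair. -/
lemma translate (S : CharSol a b m T C χ f g) (h : ℝ) :
    CharSol a b m T C χ (fun t x => f t (x + h)) (fun t x => g t (x + h)) where
  cont_f := continuous_comp₂ S.cont_f (by fun_prop) (by fun_prop)
  cont_g := continuous_comp₂ S.cont_g (by fun_prop) (by fun_prop)
  cont_χ := S.cont_χ
  χ_mem := S.χ_mem
  deriv_f t ht x := by
    have := S.deriv_f t ht (x + h)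
    rwa [show x + h + 2 * t = x + 2 * t + h by ring] at this
  deriv_g t ht x := by
    have := S.deriv_g t ht (x + h)
    rwa [show x + h - 2 * t = x - 2 * t + h by ring] at this
  charge t ht := by
    rw [nsq_comp_add, nsq_comp_add]; exact S.charge t ht

lemma mono {T' : ℝ} (S : CharSol a b m T C χ f g) (h : T' ≤ T) : CharSol a b m T' C χ f g where
  cont_f := S.cont_f
  cont_g := S.cont_g
  cont_χ := S.cont_χ
  χ_mem := S.χ_mem
  deriv_f t ht := S.deriv_f t ⟨ht.1, ht.2.trans_le h⟩
  deriv_g t ht := S.deriv_g t ⟨ht.1, ht.2.trans_le h⟩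
  charge t ht := S.charge t ⟨ht.1, ht.2.trans h⟩

/-- Characteristics must be relabelled by their position at the new initial time. Keeping the labels
of `f` forces those of `g` to move by `2s`. -/
lemma restart {s : ℝ} (hs : 0 ≤ s) (S : CharSol a b m (s + T) C χ f g) :
    CharSol a b m T C (fun t => χ (s + t)) (fun t x => f (s + t) x)
      (fun t x => g (s + t) (x + 2 * s)) where
  cont_f := continuous_comp₂ S.cont_f (by fun_prop) (by fun_prop)
  cont_g := continuous_comp₂ S.cont_g (by fun_prop) (by fun_prop)
  cont_χ := S.cont_χ.comp (by fun_prop)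
  χ_mem t := S.χ_mem _
  deriv_f t ht x := by
    have := (S.deriv_f (s + t) ⟨by linarith [ht.1], by linarith [ht.2]⟩ x).comp_const_add s t
    rwa [show x + 2 * (s + t) = x + 2 * t + 2 * s by ring] at this
  deriv_g t ht x := by
    have := (S.deriv_g (s + t) ⟨by linarith [ht.1], by linarith [ht.2]⟩
      (x + 2 * s)).comp_const_add s t
    rwa [show x + 2 * s - 2 * (s + t) = x - 2 * t by ring] at this
  charge t ht := by
    rw [nsq_comp_add (g (s + t))]
    exact S.charge _ ⟨by linarith [ht.1], by linarith [ht.2]⟩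

/-- The charge that crosses the two sides of a backward light cone is bounded by the charge. -/
lemma flux (hab : ChargeCondition a b) (hT : 0 ≤ T) (S : CharSol a b m T C χ f g) (x : ℝ) :
    ∫⁻ r in Ioc 0 T, (‖f r (x - 2 * r)‖ₑ ^ 2 + ‖g r (x + 2 * r)‖ₑ ^ 2)
      ≤ 2⁻¹ * ENNReal.ofReal C := by
  -- `ρ` is the rate at which `|f|²` gains charge along its characteristic; the second component
  -- loses the same amount at the same space-time point.
  set ρ : ℝ → ℝ → ℝ := fun t y =>
    2 * (((χ t : ℂ) * rhs a m (f t y) (g t (y + 2 * t))) * conj (f t y)).re with hρ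
  have hρc : Continuous (Function.uncurry ρ) := by
    have h1 : Continuous fun z : ℝ × ℝ => f z.1 z.2 := S.cont_f
    have h2 : Continuous fun z : ℝ × ℝ => g z.1 (z.2 + 2 * z.1) :=
      continuous_comp₂ S.cont_g (by fun_prop) (by fun_prop)
    exact continuous_const.mul (Complex.continuous_re.comp
      ((((Complex.continuous_ofReal.comp (S.cont_χ.comp continuous_fst)).mul
        (continuous_rhs_comp a m h1 h2))).mul (Complex.continuous_conj.comp h1)))
  have hP : ∀ t ∈ Ioo 0 T, ∀ y, HasDerivAt (fun t => ‖f t y‖ ^ 2) (ρ t y) t := by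
    intro t ht y
    have := (S.deriv_f t ht y).norm_sq
    rwa [Complex.inner] at this
  have hQ : ∀ t ∈ Ioo 0 T, ∀ y, HasDerivAt (fun t => ‖g t y‖ ^ 2) (-ρ t (y - 2 * t)) t := by
    intro t ht y
    have := (S.deriv_g t ht y).norm_sq
    rw [Complex.inner] at this
    convert! this using 1
    have e := hab.rhs_re m (f t (y - 2 * t)) (g t y)
    simp only [hρ, sub_add_cancel, mul_assoc, Complex.re_ofReal_mul]
    linear_combination -2 * χ t * e
  have cP : ∀ y, Continuous fun t => ‖f t y‖ ^ 2 := fun y =>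
    (continuous_comp₂ S.cont_f continuous_id continuous_const).norm.pow 2
  have cQ : ∀ y, Continuous fun t => ‖g t y‖ ^ 2 := fun y =>
    (continuous_comp₂ S.cont_g continuous_id continuous_const).norm.pow 2
  have cρ : ∀ {p q : ℝ → ℝ}, Continuous p → Continuous q → Continuous fun s => ρ (p s) (q s) :=
    fun hp hq => hρc.comp (hp.prodMk hq)
  have i1 : ∀ r ∈ Icc 0 T, ∫ s in r..T, ρ s (x - 2 * r) =
      ‖f T (x - 2 * r)‖ ^ 2 - ‖f r (x - 2 * r)‖ ^ 2 := fun r hr =>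
    intervalIntegral.integral_eq_sub_of_hasDerivAt_of_le hr.2 (cP _).continuousOn
      (fun s hs => hP s ⟨hr.1.trans_lt hs.1, hs.2⟩ _)
      ((cρ continuous_id continuous_const).intervalIntegrable _ _)
  have i2 : ∀ r ∈ Icc 0 T, ∫ s in r..T, -ρ s (x + 2 * r - 2 * s) =
      ‖g T (x + 2 * r)‖ ^ 2 - ‖g r (x + 2 * r)‖ ^ 2 := fun r hr =>
    intervalIntegral.integral_eq_sub_of_hasDerivAt_of_le hr.2 (cQ _).continuousOn
      (fun s hs => hQ s ⟨hr.1.trans_lt hs.1, hs.2⟩ _)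
      ((cρ continuous_id (by fun_prop)).neg.intervalIntegrable _ _)
  have sw1 := integral_triangle_swap (h := fun r s => ρ s (x - 2 * r))
    (hρc.comp (by fun_prop : Continuous fun z : ℝ × ℝ => (z.2, x - 2 * z.1))) hT
  have sw2 := integral_triangle_swap (h := fun r s => -ρ s (x + 2 * r - 2 * s))
    ((hρc.comp (by fun_prop : Continuous fun z : ℝ × ℝ => (z.2, x + 2 * z.1 - 2 * z.2))).neg) hT
  -- At a fixed time `s` the two exchange terms run over the same horizontal section of the triangle
  -- in opposite directions. The substitution `r ↦ s - r` matches them.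
  have cancel : ∀ s, ∫ r in (0 : ℝ)..s, -ρ s (x + 2 * r - 2 * s) =
      -∫ r in (0 : ℝ)..s, ρ s (x - 2 * r) := by
    intro s
    rw [intervalIntegral.integral_neg]
    congr 1
    have := intervalIntegral.integral_comp_sub_left (a := 0) (b := s)
      (fun r => ρ s (x - 2 * r)) s
    rw [sub_self, sub_zero] at this
    rw [← this]
    congr 1; ext r; congr 1; ring
  have c1 : Continuous fun r => ‖f T (x - 2 * r)‖ ^ 2 :=
    (continuous_comp₂ S.cont_f continuous_const (by fun_prop)).norm.pow 2
  have c2 : Continuous fun r => ‖g T (x + 2 * r)‖ ^ 2 :=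
    (continuous_comp₂ S.cont_g continuous_const (by fun_prop)).norm.pow 2
  have c3 : Continuous fun r => ‖f r (x - 2 * r)‖ ^ 2 :=
    (continuous_comp₂ S.cont_f continuous_id (by fun_prop)).norm.pow 2
  have c4 : Continuous fun r => ‖g r (x + 2 * r)‖ ^ 2 :=
    (continuous_comp₂ S.cont_g continuous_id (by fun_prop)).norm.pow 2
  -- Charge balance in the triangle with apex `(0,x)` and base at time `T`: what enters through the
  -- two sides equals what is present on the base. The base is then bounded by the total charge, and
  -- the factor 1/2 in the result is the Jacobian of `r ↦ x ± 2r`.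
  have key : ∫ r in (0 : ℝ)..T, (‖f r (x - 2 * r)‖ ^ 2 + ‖g r (x + 2 * r)‖ ^ 2) =
      ∫ r in (0 : ℝ)..T, (‖f T (x - 2 * r)‖ ^ 2 + ‖g T (x + 2 * r)‖ ^ 2) := by
    have j1 : ∫ r in (0 : ℝ)..T, ∫ s in r..T, ρ s (x - 2 * r) =
        ∫ r in (0 : ℝ)..T, (‖f T (x - 2 * r)‖ ^ 2 - ‖f r (x - 2 * r)‖ ^ 2) :=
      intervalIntegral.integral_congr fun r hr => i1 r (by rwa [uIcc_of_le hT] at hr)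
    have j2 : ∫ r in (0 : ℝ)..T, ∫ s in r..T, -ρ s (x + 2 * r - 2 * s) =
        ∫ r in (0 : ℝ)..T, (‖g T (x + 2 * r)‖ ^ 2 - ‖g r (x + 2 * r)‖ ^ 2) :=
      intervalIntegral.integral_congr fun r hr => i2 r (by rwa [uIcc_of_le hT] at hr)
    have j3 : ∫ s in (0 : ℝ)..T, ∫ r in (0 : ℝ)..s, -ρ s (x + 2 * r - 2 * s) =
        -∫ s in (0 : ℝ)..T, ∫ r in (0 : ℝ)..s, ρ s (x - 2 * r) := by
      simp only [cancel, intervalIntegral.integral_neg]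
    have j4 := sw2.symm.trans j2
    rw [j3, ← sw1, j1, intervalIntegral.integral_sub (c1.intervalIntegrable _ _)
      (c3.intervalIntegrable _ _), intervalIntegral.integral_sub (c2.intervalIntegrable _ _)
      (c4.intervalIntegrable _ _)] at j4
    rw [intervalIntegral.integral_add (c3.intervalIntegrable _ _) (c4.intervalIntegrable _ _),
      intervalIntegral.integral_add (c1.intervalIntegrable _ _) (c2.intervalIntegrable _ _)]
    linarith
  have conv : ∀ z w : ℂ, ENNReal.ofReal (‖z‖ ^ 2 + ‖w‖ ^ 2) = ‖z‖ₑ ^ 2 + ‖w‖ₑ ^ 2 := by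
    intro z w
    rw [ENNReal.ofReal_add (by positivity) (by positivity), ENNReal.ofReal_pow (norm_nonneg _),
      ENNReal.ofReal_pow (norm_nonneg _), ofReal_norm, ofReal_norm]
  have key' := congrArg ENNReal.ofReal key
  have c12 : Continuous fun r => ‖f T (x - 2 * r)‖ ^ 2 + ‖g T (x + 2 * r)‖ ^ 2 := c1.add c2
  have c34 : Continuous fun r => ‖f r (x - 2 * r)‖ ^ 2 + ‖g r (x + 2 * r)‖ ^ 2 := c3.add c4
  rw [ofReal_intervalIntegral c34 (fun r => by positivity) hT,
    ofReal_intervalIntegral c12 (fun r => by positivity) hT] at key'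
  simp only [conv] at key'
  rw [key']
  have mf : Measurable fun y => ‖f T y‖ₑ ^ 2 :=
    (continuous_comp₂ S.cont_f continuous_const continuous_id).measurable.enorm.pow_const 2
  have mg : Measurable fun y => ‖g T y‖ₑ ^ 2 :=
    (continuous_comp₂ S.cont_g continuous_const continuous_id).measurable.enorm.pow_const 2
  have mfx : Measurable fun r => ‖f T (x - 2 * r)‖ₑ ^ 2 :=
    mf.comp (by fun_prop : Measurable fun r : ℝ => x - 2 * r)
  rw [lintegral_add_left mfx]
  calc _ ≤ 2⁻¹ * nsq (f T) + 2⁻¹ * nsq (g T) :=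
        add_le_add (setLIntegral_comp_sub_two_mul_le mf x T)
          (setLIntegral_comp_add_two_mul_le mg x T)
    _ = 2⁻¹ * (nsq (f T) + nsq (g T)) := (mul_add _ _ _).symm
    _ ≤ _ := by gcongr; exact S.charge T ⟨hT, le_rfl⟩

/-- The path `x + 2r` in the labels of `g` is a single characteristic of `f`. This is the integral
bound for the coefficient in the equation for `f`, uniform over characteristics. -/
lemma flux_g (hab : ChargeCondition a b) (hT : 0 ≤ T) (S : CharSol a b m T C χ f g) (x : ℝ) :
    ∫⁻ r in Ioc 0 T, ‖g r (x + 2 * r)‖ₑ ^ 2 ≤ 2⁻¹ * ENNReal.ofReal C :=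
  (lintegral_mono fun _ => le_add_self).trans (S.flux hab hT x)

end CharSol

/-! ### Pointwise bounds along characteristics -/

lemma norm_rhs_le (a : Fin 2 → Fin 3 → ℂ) {m : ℝ} (hm : 0 ≤ m) (z w : ℂ) :
    ‖rhs a m z w‖ ≤ m * ‖w‖ + coeffSum a * ‖w‖ ^ 2 * ‖z‖ := by
  have h := norm_cubic_le a z w
  rw [rhs, norm_mul, norm_neg, Complex.norm_I, one_mul]
  refine (norm_add_le _ _).trans ?_
  rw [norm_mul, norm_neg, Complex.norm_real, Real.norm_of_nonneg hm]
  linarith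

lemma norm_rhs_sub_le (a : Fin 2 → Fin 3 → ℂ) {m : ℝ} (hm : 0 ≤ m) (z w z' w' : ℂ) :
    ‖rhs a m z w - rhs a m z' w'‖ ≤
      (m * ‖w - w'‖ + coeffSum a * (‖w - w'‖ * (‖z‖ + ‖z'‖) * (‖w‖ + ‖w'‖)))
        + coeffSum a * (‖w‖ ^ 2 + ‖w'‖ ^ 2) * ‖z - z'‖ := by
  have h := norm_cubic_sub_le a z w z' w'
  have e : rhs a m z w - rhs a m z' w' =
      -Complex.I * (-(m : ℂ) * (w - w') + (cubic a z w - cubic a z' w')) := by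
    simp only [rhs]; ring
  rw [e, norm_mul, norm_neg, Complex.norm_I, one_mul]
  refine (norm_add_le _ _).trans ?_
  rw [norm_mul, norm_neg, Complex.norm_real, Real.norm_of_nonneg hm]
  linarith

lemma norm_damped_le {c : ℝ} (hc : c ∈ Icc (0 : ℝ) 1) {z : ℂ} {B : ℝ} (h : ‖z‖ ≤ B) :
    ‖(c : ℂ) * z‖ ≤ B := by
  rw [norm_mul, Complex.norm_real, Real.norm_of_nonneg hc.1]
  exact (mul_le_of_le_one_left (norm_nonneg _) hc.2).trans h

/-- The `L²` mass of `h` on the characteristic `x + 2 s`, `0 < s < T`. -/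
def charMass (T : ℝ) (h : ℝ → ℝ → ℂ) (x : ℝ) : ℝ≥0∞ := ∫⁻ s in Ioc 0 T, ‖h s (x + 2 * s)‖ₑ ^ 2

lemma measurable_charMass (T : ℝ) {h : ℝ → ℝ → ℂ} (hh : Continuous fun z : ℝ × ℝ => h z.1 z.2) :
    Measurable (charMass T h) := by
  have : Measurable fun z : ℝ × ℝ => ‖h z.2 (z.1 + 2 * z.2)‖ₑ ^ 2 :=
    (continuous_comp₂ hh (by fun_prop) (by fun_prop)).measurable.enorm.pow_const 2
  exact this.lintegral_prod_right'

lemma lintegral_charMass (T : ℝ) {h : ℝ → ℝ → ℂ} (hh : Continuous fun z : ℝ × ℝ => h z.1 z.2) :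
    ∫⁻ x, charMass T h x = ∫⁻ s in Ioc 0 T, nsq (h s) := by
  have : Measurable fun z : ℝ × ℝ => ‖h z.2 (z.1 + 2 * z.2)‖ₑ ^ 2 :=
    (continuous_comp₂ hh (by fun_prop) (by fun_prop)).measurable.enorm.pow_const 2
  unfold charMass
  rw [lintegral_lintegral_swap this.aemeasurable]
  congr 1; ext s
  exact nsq_comp_add (h s) (2 * s)

lemma setLIntegral_le_mul {T : ℝ} {F : ℝ → ℝ≥0∞} {η : ℝ≥0∞} (h : ∀ s ∈ Icc 0 T, F s ≤ η) :
    ∫⁻ s in Ioc 0 T, F s ≤ ENNReal.ofReal T * η := by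
  calc _ ≤ ∫⁻ _ in Ioc 0 T, η :=
        setLIntegral_mono measurable_const fun s hs => h s (Ioc_subset_Icc_self hs)
    _ = _ := by simp [mul_comm]

lemma lintegral_charMass_le {T : ℝ} {h : ℝ → ℝ → ℂ} (hh : Continuous fun z : ℝ × ℝ => h z.1 z.2)
    {η : ℝ≥0∞} (hη : ∀ s ∈ Icc 0 T, nsq (h s) ≤ η) :
    ∫⁻ x, charMass T h x ≤ ENNReal.ofReal T * η := by
  rw [lintegral_charMass T hh]
  exact setLIntegral_le_mul hη

/-- A majorant of `|f(t,x)|²` over `0 ≤ t ≤ T`. -/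
def majorant (m T : ℝ) (f g : ℝ → ℝ → ℂ) (x : ℝ) : ℝ≥0∞ :=
  -- Here 8 is the square of the factor 2 from `enorm_le_of_deriv_le` times the 2 from squaring a
  -- sum of two terms.
  8 * (‖f 0 x‖ₑ ^ 2 + ENNReal.ofReal (m ^ 2 * T) * charMass T g x)

lemma ofReal_mul_norm_sq {c : ℝ} (hc : 0 ≤ c) (z : ℂ) :
    ENNReal.ofReal (c * ‖z‖ ^ 2) = ENNReal.ofReal c * ‖z‖ₑ ^ 2 := by
  rw [ENNReal.ofReal_mul hc, ENNReal.ofReal_pow (norm_nonneg _), ofReal_norm]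

lemma half_ofReal_mul_le {κ C : ℝ} (hκ : 0 ≤ κ) (h : κ * C ≤ 1) :
    ENNReal.ofReal κ * (2⁻¹ * ENNReal.ofReal C) ≤ 2⁻¹ := by
  rw [mul_left_comm, ← ENNReal.ofReal_mul hκ]
  calc _ ≤ 2⁻¹ * (1 : ℝ≥0∞) := by gcongr; rwa [ENNReal.ofReal_le_one]
    _ = _ := mul_one _

namespace CharSol

variable {a b : Fin 2 → Fin 3 → ℂ} {m T C : ℝ} {χ : ℝ → ℝ} {f g f' g' : ℝ → ℝ → ℂ}

lemma measurable_majorant (S : CharSol a b m T C χ f g) : Measurable (majorant m T f g) := by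
  have h1 : Measurable fun x => ‖f 0 x‖ₑ ^ 2 :=
    (continuous_comp₂ S.cont_f continuous_const continuous_id).measurable.enorm.pow_const 2
  exact (h1.add ((measurable_charMass T S.cont_g).const_mul _)).const_mul _

/-- The flux bound makes the integral of `κ|g|²` at most 1/2, so only the data and the mass term
remain. Cauchy–Schwarz in time turns the latter into the characteristic mass of `g`. -/
lemma enorm_sq_le_majorant (hab : ChargeCondition a b) (hm : 0 ≤ m) (hκ : coeffSum a * C ≤ 1)
    (S : CharSol a b m T C χ f g) {t : ℝ} (ht : t ∈ Icc 0 T) (x : ℝ) :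
    ‖f t x‖ₑ ^ 2 ≤ majorant m T f g x := by
  have hT : 0 ≤ T := ht.1.trans ht.2
  have cf : Continuous fun t => f t x := continuous_comp₂ S.cont_f continuous_id continuous_const
  have cg : Continuous fun t => g t (x + 2 * t) :=
    continuous_comp₂ S.cont_g continuous_id (by fun_prop)
  have hκ0 := coeffSum_nonneg a
  have h := enorm_le_of_deriv_le (φ := fun t => f t x) (α := fun t => m * ‖g t (x + 2 * t)‖)
    (β := fun t => coeffSum a * ‖g t (x + 2 * t)‖ ^ 2) cf (fun t ht => S.deriv_f t ht x)
    ((Complex.continuous_ofReal.comp S.cont_χ).mul (continuous_rhs_comp a m cf cg))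
    (continuous_const.mul cg.norm) (continuous_const.mul (cg.norm.pow 2))
    (fun t => by positivity) (fun t => by positivity)
    (fun t _ => norm_damped_le (S.χ_mem t) (norm_rhs_le a hm _ _))
    (by
      simp only [ofReal_mul_norm_sq hκ0]
      rw [lintegral_const_mul' _ _ (by simp)]
      exact (mul_le_mul_right (S.flux_g hab hT x) _).trans (half_ofReal_mul_le hκ0 hκ)) ht
  simp only [ENNReal.ofReal_mul hm, ofReal_norm] at h
  rw [lintegral_const_mul' _ _ (by simp)] at h
  have hY : (ENNReal.ofReal m * ∫⁻ s in Ioc 0 T, ‖g s (x + 2 * s)‖ₑ) ^ 2 ≤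
      ENNReal.ofReal (m ^ 2 * T) * charMass T g x := by
    rw [mul_pow, ENNReal.ofReal_mul (by positivity), ENNReal.ofReal_pow hm, mul_assoc]
    gcongr
    exact setLIntegral_sq_le cg.measurable.enorm
  calc ‖f t x‖ₑ ^ 2 ≤ _ := pow_le_pow_left' h 2
    _ ≤ 4 * (2 * (‖f 0 x‖ₑ ^ 2 + (ENNReal.ofReal m * ∫⁻ s in Ioc 0 T, ‖g s (x + 2 * s)‖ₑ) ^ 2)) := by
        rw [mul_pow]
        norm_num
        gcongr
        exact ennreal_add_sq_le _ _
    _ ≤ majorant m T f g x := by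
        rw [← mul_assoc, majorant]
        norm_num
        gcongr

lemma nsq_f_le (S : CharSol a b m T C χ f g) {t : ℝ} (ht : t ∈ Icc 0 T) :
    nsq (f t) ≤ ENNReal.ofReal C := le_self_add.trans (S.charge t ht)

lemma nsq_g_le (S : CharSol a b m T C χ f g) {t : ℝ} (ht : t ∈ Icc 0 T) :
    nsq (g t) ≤ ENNReal.ofReal C := le_add_self.trans (S.charge t ht)

/-- After integration in `x`, the characteristic mass becomes the time integral of the charge of
`g`, so the mass term contributes `(m T)²` times the charge. -/
lemma lintegral_majorant_le (hT : 0 ≤ T) (hm : 0 ≤ m) (hmT : m * T ≤ 1)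
    (S : CharSol a b m T C χ f g) : ∫⁻ x, majorant m T f g x ≤ 16 * ENNReal.ofReal C := by
  have h1 : Measurable fun x => ‖f 0 x‖ₑ ^ 2 :=
    (continuous_comp₂ S.cont_f continuous_const continuous_id).measurable.enorm.pow_const 2
  unfold majorant
  rw [lintegral_const_mul' _ _ (by simp), lintegral_add_left h1,
    lintegral_const_mul' _ _ (by simp)]
  have h2 : ENNReal.ofReal (m ^ 2 * T) * ∫⁻ x, charMass T g x ≤ ENNReal.ofReal C := by
    calc _ ≤ ENNReal.ofReal (m ^ 2 * T) * (ENNReal.ofReal T * ENNReal.ofReal C) := by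
          gcongr
          exact lintegral_charMass_le S.cont_g fun s hs => S.nsq_g_le hs
      _ = ENNReal.ofReal ((m * T) ^ 2) * ENNReal.ofReal C := by
          rw [← mul_assoc, ← ENNReal.ofReal_mul (by positivity)]; congr 2; ring
      _ ≤ 1 * ENNReal.ofReal C := by
          gcongr
          rw [ENNReal.ofReal_le_one]
          exact pow_le_one₀ (by positivity) hmT
      _ = _ := one_mul _
  calc _ ≤ 8 * (ENNReal.ofReal C + ENNReal.ofReal C) := by
        gcongr
        exact S.nsq_f_le ⟨le_rfl, hT⟩
    _ = _ := by ring

end CharSol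

/-- A majorant of `|f(t,x) - f'(t,x)|²` over `0 ≤ t ≤ T`. -/
def diffMajorant (κ C m T : ℝ) (f g f' g' : ℝ → ℝ → ℂ) (x : ℝ) : ℝ≥0∞ :=
  -- The factor 12 is 2² times the 3 from squaring a sum of three terms. The coefficient `2 κ² C` is
  -- `κ²` times the bound `2 C` for the mass of `|g| + |g'|` on a characteristic.
  12 * (‖f 0 x - f' 0 x‖ₑ ^ 2 +
    ENNReal.ofReal (m ^ 2 * T) * charMass T (fun s y => g s y - g' s y) x +
    ENNReal.ofReal (2 * κ ^ 2 * C) * ((2 * (majorant m T f g x + majorant m T f' g' x)) *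
      charMass T (fun s y => g s y - g' s y) x))

namespace CharSol

variable {a b : Fin 2 → Fin 3 → ℂ} {m T C : ℝ} {χ : ℝ → ℝ} {f g f' g' : ℝ → ℝ → ℂ}

lemma measurable_diffMajorant (κ : ℝ) (S : CharSol a b m T C χ f g)
    (S' : CharSol a b m T C χ f' g') : Measurable (diffMajorant κ C m T f g f' g') := by
  have h1 : Measurable fun x => ‖f 0 x - f' 0 x‖ₑ ^ 2 :=
    ((continuous_comp₂ S.cont_f continuous_const continuous_id).sub
      (continuous_comp₂ S'.cont_f continuous_const continuous_id)).measurable.enorm.pow_const 2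
  have h2 : Measurable (charMass T fun s y => g s y - g' s y) :=
    measurable_charMass T (S.cont_g.sub S'.cont_g)
  exact ((h1.add (h2.const_mul _)).add ((((S.measurable_majorant.add
    S'.measurable_majorant).const_mul _).mul h2).const_mul _)).const_mul _

lemma enorm_add_sq_le (hab : ChargeCondition a b) (hm : 0 ≤ m) (hκ : coeffSum a * C ≤ 1)
    (S : CharSol a b m T C χ f g) (S' : CharSol a b m T C χ f' g') {t : ℝ} (ht : t ∈ Icc 0 T)
    (x : ℝ) : (‖f t x‖ₑ + ‖f' t x‖ₑ) ^ 2 ≤ 2 * (majorant m T f g x + majorant m T f' g' x) :=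
  (ennreal_add_sq_le _ _).trans (by
    gcongr
    · exact S.enorm_sq_le_majorant hab hm hκ ht x
    · exact S'.enorm_sq_le_majorant hab hm hκ ht x)

lemma charMass_add_le (hab : ChargeCondition a b) (hT : 0 ≤ T) (S : CharSol a b m T C χ f g)
    (S' : CharSol a b m T C χ f' g') (x : ℝ) :
    ∫⁻ s in Ioc 0 T, (‖g s (x + 2 * s)‖ₑ + ‖g' s (x + 2 * s)‖ₑ) ^ 2 ≤ 2 * ENNReal.ofReal C := by
  have mg : Measurable fun s => ‖g s (x + 2 * s)‖ₑ ^ 2 :=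
    (continuous_comp₂ S.cont_g continuous_id (by fun_prop)).measurable.enorm.pow_const 2
  calc _ ≤ ∫⁻ s in Ioc 0 T, 2 * (‖g s (x + 2 * s)‖ₑ ^ 2 + ‖g' s (x + 2 * s)‖ₑ ^ 2) :=
        lintegral_mono fun s => ennreal_add_sq_le _ _
    _ ≤ 2 * (2⁻¹ * ENNReal.ofReal C + 2⁻¹ * ENNReal.ofReal C) := by
        rw [lintegral_const_mul' _ _ (by simp), lintegral_add_left mg]
        gcongr
        · exact S.flux_g hab hT x
        · exact S'.flux_g hab hT x
    _ = _ := by rw [← add_mul, ENNReal.inv_two_add_inv_two, one_mul]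

/-- The Gronwall coefficient now contains both `|g|²` and `|g'|²`, so absorption needs `2 κ C ≤ 1`.
The source is linear in `g - g'`, and its square is controlled by the mass of that difference on the
same characteristic. -/
lemma enorm_sub_sq_le_diffMajorant (hab : ChargeCondition a b) (hm : 0 ≤ m) (hC : 0 ≤ C)
    (hκ : coeffSum a * C ≤ 1 / 2) (S : CharSol a b m T C χ f g)
    (S' : CharSol a b m T C χ f' g') {t : ℝ} (ht : t ∈ Icc 0 T) (x : ℝ) :
    ‖f t x - f' t x‖ₑ ^ 2 ≤ diffMajorant (coeffSum a) C m T f g f' g' x := by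
  have hT : 0 ≤ T := ht.1.trans ht.2
  have hκ1 : coeffSum a * C ≤ 1 := by linarith
  have hκ0 := coeffSum_nonneg a
  set κ := coeffSum a
  have cf : Continuous fun t => f t x := continuous_comp₂ S.cont_f continuous_id continuous_const
  have cg : Continuous fun t => g t (x + 2 * t) :=
    continuous_comp₂ S.cont_g continuous_id (by fun_prop)
  have cf' : Continuous fun t => f' t x :=
    continuous_comp₂ S'.cont_f continuous_id continuous_const
  have cg' : Continuous fun t => g' t (x + 2 * t) :=
    continuous_comp₂ S'.cont_g continuous_id (by fun_prop)
  have ce : Continuous fun t => g t (x + 2 * t) - g' t (x + 2 * t) := cg.sub cg'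
  have h := enorm_le_of_deriv_le (φ := fun t => f t x - f' t x)
    (φ' := fun t => (χ t : ℂ) * (rhs a m (f t x) (g t (x + 2 * t)) -
      rhs a m (f' t x) (g' t (x + 2 * t))))
    (α := fun t => m * ‖g t (x + 2 * t) - g' t (x + 2 * t)‖ +
      κ * (‖g t (x + 2 * t) - g' t (x + 2 * t)‖ * (‖f t x‖ + ‖f' t x‖) *
        (‖g t (x + 2 * t)‖ + ‖g' t (x + 2 * t)‖)))
    (β := fun t => κ * (‖g t (x + 2 * t)‖ ^ 2 + ‖g' t (x + 2 * t)‖ ^ 2))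
    (cf.sub cf') (fun t ht => by
      have := (S.deriv_f t ht x).sub (S'.deriv_f t ht x)
      rwa [← mul_sub] at this)
    ((Complex.continuous_ofReal.comp S.cont_χ).mul
      ((continuous_rhs_comp a m cf cg).sub (continuous_rhs_comp a m cf' cg')))
    ((continuous_const.mul ce.norm).add (continuous_const.mul
      ((ce.norm.mul (cf.norm.add cf'.norm)).mul (cg.norm.add cg'.norm))))
    (continuous_const.mul ((cg.norm.pow 2).add (cg'.norm.pow 2)))
    (fun t => by positivity) (fun t => by positivity)
    (fun t _ => norm_damped_le (S.χ_mem t) (norm_rhs_sub_le a hm _ _ _ _))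
    (by
      have mg : Measurable fun s => ‖g s (x + 2 * s)‖ₑ ^ 2 := cg.measurable.enorm.pow_const 2
      have e : ∀ t, ENNReal.ofReal (κ * (‖g t (x + 2 * t)‖ ^ 2 + ‖g' t (x + 2 * t)‖ ^ 2)) =
          ENNReal.ofReal κ * (‖g t (x + 2 * t)‖ₑ ^ 2 + ‖g' t (x + 2 * t)‖ₑ ^ 2) := fun t => by
        rw [ENNReal.ofReal_mul hκ0, ENNReal.ofReal_add (by positivity) (by positivity),
          ENNReal.ofReal_pow (norm_nonneg _), ENNReal.ofReal_pow (norm_nonneg _), ofReal_norm,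
          ofReal_norm]
      simp only [e]
      rw [lintegral_const_mul' _ _ (by simp), lintegral_add_left mg]
      calc _ ≤ ENNReal.ofReal κ * (2⁻¹ * ENNReal.ofReal C + 2⁻¹ * ENNReal.ofReal C) := by
            gcongr
            · exact S.flux_g hab hT x
            · exact S'.flux_g hab hT x
        _ = ENNReal.ofReal κ * (2⁻¹ * ENNReal.ofReal (2 * C)) := by
            rw [← mul_add, ← ENNReal.ofReal_add hC hC, two_mul]
        _ ≤ 2⁻¹ := half_ofReal_mul_le hκ0 (by linarith)) ht
  have eα : ∀ t, ENNReal.ofReal (m * ‖g t (x + 2 * t) - g' t (x + 2 * t)‖ +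
      κ * (‖g t (x + 2 * t) - g' t (x + 2 * t)‖ * (‖f t x‖ + ‖f' t x‖) *
        (‖g t (x + 2 * t)‖ + ‖g' t (x + 2 * t)‖))) =
      ENNReal.ofReal m * ‖g t (x + 2 * t) - g' t (x + 2 * t)‖ₑ +
      ENNReal.ofReal κ * ((‖g t (x + 2 * t) - g' t (x + 2 * t)‖ₑ * (‖f t x‖ₑ + ‖f' t x‖ₑ)) *
        (‖g t (x + 2 * t)‖ₑ + ‖g' t (x + 2 * t)‖ₑ)) := fun t => by
    rw [ENNReal.ofReal_add (by positivity) (by positivity), ENNReal.ofReal_mul hm,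
      ENNReal.ofReal_mul hκ0, ENNReal.ofReal_mul (by positivity),
      ENNReal.ofReal_mul (by positivity), ENNReal.ofReal_add (by positivity) (by positivity),
      ENNReal.ofReal_add (by positivity) (by positivity)]
    simp only [ofReal_norm]
  simp only [eα] at h
  rw [lintegral_add_left (ce.measurable.enorm.const_mul _), lintegral_const_mul' _ _ (by simp),
    lintegral_const_mul' _ _ (by simp)] at h
  set Y := ∫⁻ s in Ioc 0 T, ‖g s (x + 2 * s) - g' s (x + 2 * s)‖ₑ
  set Z := ∫⁻ s in Ioc 0 T, (‖g s (x + 2 * s) - g' s (x + 2 * s)‖ₑ * (‖f s x‖ₑ + ‖f' s x‖ₑ)) *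
        (‖g s (x + 2 * s)‖ₑ + ‖g' s (x + 2 * s)‖ₑ)
  have hY : (ENNReal.ofReal m * Y) ^ 2 ≤
      ENNReal.ofReal (m ^ 2 * T) * charMass T (fun s y => g s y - g' s y) x := by
    rw [mul_pow, ENNReal.ofReal_mul (by positivity), ENNReal.ofReal_pow hm, mul_assoc]
    gcongr
    exact setLIntegral_sq_le ce.measurable.enorm
  have hZ : (ENNReal.ofReal κ * Z) ^ 2 ≤ ENNReal.ofReal (2 * κ ^ 2 * C) *
      ((2 * (majorant m T f g x + majorant m T f' g' x)) *
        charMass T (fun s y => g s y - g' s y) x) := by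
    -- The factors are split so that `|f| + |f'|` stays with `|g - g'|`: its supremum in time is
    -- bounded by the majorants, while `|g| + |g'|` is handled by the flux.
    have hcs := lintegral_mul_sq_le (μ := volume.restrict (Ioc 0 T))
      (f := fun s => ‖g s (x + 2 * s) - g' s (x + 2 * s)‖ₑ * (‖f s x‖ₑ + ‖f' s x‖ₑ))
      (g := fun s => ‖g s (x + 2 * s)‖ₑ + ‖g' s (x + 2 * s)‖ₑ)
      (ce.measurable.enorm.mul (cf.measurable.enorm.add cf'.measurable.enorm)).aemeasurable
      (cg.measurable.enorm.add cg'.measurable.enorm).aemeasurable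
    have h1 : ∫⁻ s in Ioc 0 T,
        (‖g s (x + 2 * s) - g' s (x + 2 * s)‖ₑ * (‖f s x‖ₑ + ‖f' s x‖ₑ)) ^ 2 ≤
        (2 * (majorant m T f g x + majorant m T f' g' x)) *
          charMass T (fun s y => g s y - g' s y) x := by
      rw [charMass, ← lintegral_const_mul _ (ce.measurable.enorm.pow_const 2)]
      refine setLIntegral_mono ((ce.measurable.enorm.pow_const 2).const_mul _) fun s hs => ?_
      rw [mul_pow, mul_comm]
      gcongr
      exact S.enorm_add_sq_le hab hm hκ1 S' (Ioc_subset_Icc_self hs) x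
    calc (ENNReal.ofReal κ * Z) ^ 2 = ENNReal.ofReal κ ^ 2 * Z ^ 2 := mul_pow _ _ _
      _ ≤ ENNReal.ofReal κ ^ 2 * (((2 * (majorant m T f g x + majorant m T f' g' x)) *
          charMass T (fun s y => g s y - g' s y) x) * (2 * ENNReal.ofReal C)) := by
          gcongr
          exact hcs.trans (mul_le_mul' h1 (S.charMass_add_le hab hT S' x))
      _ = _ := by
          rw [ENNReal.ofReal_mul (by positivity), ENNReal.ofReal_mul (by positivity),
            ENNReal.ofReal_pow hκ0, ENNReal.ofReal_ofNat]
          ring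
  calc ‖f t x - f' t x‖ₑ ^ 2 ≤ _ := pow_le_pow_left' h 2
    _ ≤ 4 * (3 * (‖f 0 x - f' 0 x‖ₑ ^ 2 + (ENNReal.ofReal m * Y) ^ 2 +
        (ENNReal.ofReal κ * Z) ^ 2)) := by
        rw [mul_pow, ← add_assoc]
        norm_num
        gcongr
        exact ennreal_add_sq_le₃ _ _ _
    _ ≤ _ := by
        rw [← mul_assoc, diffMajorant]
        norm_num
        gcongr

end CharSol

/-! ### Stability in `L²` -/

/-- The `L¹((0,T) × ℝ)` distance of the nonlinear terms. -/
def cubicDist (a : Fin 2 → Fin 3 → ℂ) (T : ℝ) (f g f' g' : ℝ → ℝ → ℂ) : ℝ≥0∞ :=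
  ∫⁻ t in Ioc 0 T, ∫⁻ x,
    ‖cubic a (f t x) (g t (x + 2 * t)) - cubic a (f' t x) (g' t (x + 2 * t))‖ₑ

namespace CharSol

variable {a b : Fin 2 → Fin 3 → ℂ} {m T C : ℝ} {χ : ℝ → ℝ} {f g f' g' : ℝ → ℝ → ℂ}

lemma lintegral_majorants_le (hT : 0 ≤ T) (hm : 0 ≤ m) (hmT : m * T ≤ 1 / 10)
    (S : CharSol a b m T C χ f g) (S' : CharSol a b m T C χ f' g') :
    ∫⁻ x, 2 * (majorant m T f g x + majorant m T f' g' x) ≤ 64 * ENNReal.ofReal C := by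
  rw [lintegral_const_mul' _ _ (by simp), lintegral_add_left S.measurable_majorant]
  calc _ ≤ 2 * (16 * ENNReal.ofReal C + 16 * ENNReal.ofReal C) := by
        gcongr
        · exact S.lintegral_majorant_le hT hm (by linarith)
        · exact S'.lintegral_majorant_le hT hm (by linarith)
    _ = _ := by ring

/-- In the product term the majorants are integrable in `x` and the mass of `g - g'` is bounded
uniformly in `x`. Smallness appears as `(κ C)²`: one power of `C` comes from the flux and the other
from the integrated majorants. -/
lemma lintegral_diffMajorant_le (hT : 0 ≤ T) (hm : 0 ≤ m) (hC : 0 ≤ C) (hmT : m * T ≤ 1 / 10)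
    {κ : ℝ} (hκ0 : 0 ≤ κ) (hκ : κ * C ≤ 1 / 100)
    (S : CharSol a b m T C χ f g) (S' : CharSol a b m T C χ f' g') {η : ℝ≥0∞}
    (h1 : ∀ s ∈ Icc 0 T, nsq (fun x => g s x - g' s x) ≤ η)
    (h2 : ∀ x, charMass T (fun s y => g s y - g' s y) x ≤ η) :
    ∫⁻ x, diffMajorant κ C m T f g f' g' x ≤ 12 * nsq (fun x => f 0 x - f' 0 x) + η / 2 := by
  have m1 : Measurable fun x => ‖f 0 x - f' 0 x‖ₑ ^ 2 :=
    ((continuous_comp₂ S.cont_f continuous_const continuous_id).sub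
      (continuous_comp₂ S'.cont_f continuous_const continuous_id)).measurable.enorm.pow_const 2
  have m2 : Measurable (charMass T fun s y => g s y - g' s y) :=
    measurable_charMass T (S.cont_g.sub S'.cont_g)
  have m3 : Measurable fun x => ‖f 0 x - f' 0 x‖ₑ ^ 2 +
      ENNReal.ofReal (m ^ 2 * T) * charMass T (fun s y => g s y - g' s y) x :=
    m1.add (m2.const_mul _)
  unfold diffMajorant
  rw [lintegral_const_mul' _ _ (by simp), lintegral_add_left m3,
    lintegral_add_left m1, lintegral_const_mul' _ _ (by simp), lintegral_const_mul' _ _ (by simp)]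
  have i1 : ENNReal.ofReal (m ^ 2 * T) * ∫⁻ x, charMass T (fun s y => g s y - g' s y) x ≤
      ENNReal.ofReal ((m * T) ^ 2) * η := by
    calc _ ≤ ENNReal.ofReal (m ^ 2 * T) * (ENNReal.ofReal T * η) := by
          gcongr
          exact lintegral_charMass_le (S.cont_g.sub S'.cont_g) h1
      _ = _ := by
          rw [← mul_assoc, ← ENNReal.ofReal_mul (by positivity)]; congr 2; ring
  have i2 : ∫⁻ x, 2 * (majorant m T f g x + majorant m T f' g' x) *
      charMass T (fun s y => g s y - g' s y) x ≤ 64 * ENNReal.ofReal C * η := by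
    calc _ ≤ ∫⁻ x, 2 * (majorant m T f g x + majorant m T f' g' x) * η :=
          lintegral_mono fun x => by gcongr; exact h2 x
      _ = (∫⁻ x, 2 * (majorant m T f g x + majorant m T f' g' x)) * η :=
          lintegral_mul_const _ ((S.measurable_majorant.add S'.measurable_majorant).const_mul _)
      _ ≤ _ := by gcongr; exact S.lintegral_majorants_le hT hm hmT S'
  calc _ ≤ 12 * (nsq (fun x => f 0 x - f' 0 x) + ENNReal.ofReal ((m * T) ^ 2) * η +
        ENNReal.ofReal (2 * κ ^ 2 * C) * (64 * ENNReal.ofReal C * η)) := by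
        gcongr
        exact le_rfl
    _ = 12 * nsq (fun x => f 0 x - f' 0 x) +
        ENNReal.ofReal (12 * ((m * T) ^ 2 + 128 * (κ * C) ^ 2)) * η := by
        rw [show (12 * ((m * T) ^ 2 + 128 * (κ * C) ^ 2)) =
          12 * (m * T) ^ 2 + 12 * ((2 * κ ^ 2 * C) * (64 * C)) by ring,
          ENNReal.ofReal_add (by positivity) (by positivity),
          ENNReal.ofReal_mul (p := 12) (q := (m * T) ^ 2) (by norm_num),
          ENNReal.ofReal_mul (p := 12) (by norm_num),
          ENNReal.ofReal_mul (p := 2 * κ ^ 2 * C) (by positivity),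
          ENNReal.ofReal_mul (p := 64) (by norm_num), ENNReal.ofReal_ofNat, ENNReal.ofReal_ofNat]
        ring
    -- With the assumed bounds the coefficient is at most 12(1/100 + 128/10000), which is below 1/2.
    _ ≤ 12 * nsq (fun x => f 0 x - f' 0 x) + ENNReal.ofReal (1 / 2) * η := by
        gcongr
        have e1 : (m * T) ^ 2 ≤ (1 / 10) ^ 2 := pow_le_pow_left₀ (by positivity) hmT 2
        have e2 : (κ * C) ^ 2 ≤ (1 / 100) ^ 2 := pow_le_pow_left₀ (by positivity) hκ 2
        norm_num at *
        linarith
    _ = _ := by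
        rw [one_div, ENNReal.ofReal_inv_of_pos two_pos, ENNReal.ofReal_ofNat, mul_comm,
          ENNReal.div_eq_inv_mul, mul_comm]

/-- One half of the stability estimate: the second component controls the first. -/
lemma stability_half (hab : ChargeCondition a b) (hT : 0 ≤ T) (hm : 0 ≤ m) (hC : 0 ≤ C)
    (hmT : m * T ≤ 1 / 10) (hκ : coeffSum a * C ≤ 1 / 100)
    (S : CharSol a b m T C χ f g) (S' : CharSol a b m T C χ f' g') {η : ℝ≥0∞}
    (h1 : ∀ s ∈ Icc 0 T, nsq (fun x => g s x - g' s x) ≤ η)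
    (h2 : ∀ x, charMass T (fun s y => g s y - g' s y) x ≤ η) :
    (∀ s ∈ Icc 0 T, nsq (fun x => f s x - f' s x) ≤
      12 * nsq (fun x => f 0 x - f' 0 x) + η / 2) ∧
    ∀ x, charMass T (fun s y => f s (-y) - f' s (-y)) x ≤
      12 * nsq (fun x => f 0 x - f' 0 x) + η / 2 := by
  have hI := lintegral_diffMajorant_le hT hm hC hmT (coeffSum_nonneg a) hκ S S' h1 h2
  have hp : ∀ t ∈ Icc 0 T, ∀ x, ‖f t x - f' t x‖ₑ ^ 2 ≤
      diffMajorant (coeffSum a) C m T f g f' g' x := fun t ht x =>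
    enorm_sub_sq_le_diffMajorant hab hm hC (by linarith) S S' ht x
  have hM := measurable_diffMajorant (coeffSum a) S S'
  refine ⟨fun s hs => (lintegral_mono fun x => hp s hs x).trans hI, fun x => ?_⟩
  -- The majorant does not depend on time, so evaluating it on the transverse line `-x - 2s` and
  -- integrating in `s` costs at most half of its integral over the whole line.
  calc charMass T (fun s y => f s (-y) - f' s (-y)) x
      ≤ ∫⁻ s in Ioc 0 T, diffMajorant (coeffSum a) C m T f g f' g' (-x - 2 * s) := by
        refine setLIntegral_mono (hM.comp (by fun_prop)) fun s hs => ?_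
        have := hp s (Ioc_subset_Icc_self hs) (-x - 2 * s)
        rwa [show -x - 2 * s = -(x + 2 * s) by ring] at this ⊢
    _ ≤ 2⁻¹ * ∫⁻ x, diffMajorant (coeffSum a) C m T f g f' g' x :=
        setLIntegral_comp_sub_two_mul_le hM _ _
    _ ≤ 1 * ∫⁻ x, diffMajorant (coeffSum a) C m T f g f' g' x := by
        gcongr; simp
    _ ≤ _ := by rw [one_mul]; exact hI

lemma nsq_sub_le_charge (S : CharSol a b m T C χ f g) (S' : CharSol a b m T C χ f' g') {s : ℝ}
    (hs : s ∈ Icc 0 T) : nsq (fun x => f s x - f' s x) ≤ 4 * ENNReal.ofReal C :=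
  (nsq_sub_le (continuous_comp₂ S.cont_f continuous_const continuous_id)).trans (by
    calc _ ≤ 2 * (ENNReal.ofReal C + ENNReal.ofReal C) := by
          gcongr
          exacts [S.nsq_f_le hs, S'.nsq_f_le hs]
      _ = _ := by ring)

lemma charMass_sub_le_charge (hab : ChargeCondition a b) (hT : 0 ≤ T)
    (S : CharSol a b m T C χ f g) (S' : CharSol a b m T C χ f' g') (x : ℝ) :
    charMass T (fun s y => g s y - g' s y) x ≤ 4 * ENNReal.ofReal C := by
  calc _ ≤ ∫⁻ s in Ioc 0 T, (‖g s (x + 2 * s)‖ₑ + ‖g' s (x + 2 * s)‖ₑ) ^ 2 :=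
        lintegral_mono fun s => pow_le_pow_left' enorm_sub_le 2
    _ ≤ 2 * ENNReal.ofReal C := S.charMass_add_le hab hT S' x
    _ ≤ _ := by gcongr; norm_num

/-- Short-time stability. -/
lemma stability (hab : ChargeCondition a b) (hT : 0 ≤ T) (hm : 0 ≤ m) (hC : 0 ≤ C)
    (hmT : m * T ≤ 1 / 10) (hκa : coeffSum a * C ≤ 1 / 100) (hκb : coeffSum b * C ≤ 1 / 100)
    (S : CharSol a b m T C χ f g) (S' : CharSol a b m T C χ f' g') :
    (∀ s ∈ Icc 0 T, nsq (fun x => f s x - f' s x) ≤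
      24 * (nsq (fun x => f 0 x - f' 0 x) + nsq (fun x => g 0 x - g' 0 x))) ∧
    (∀ s ∈ Icc 0 T, nsq (fun x => g s x - g' s x) ≤
      24 * (nsq (fun x => f 0 x - f' 0 x) + nsq (fun x => g 0 x - g' 0 x))) ∧
    ∀ x, charMass T (fun s y => g s y - g' s y) x ≤
      24 * (nsq (fun x => f 0 x - f' 0 x) + nsq (fun x => g 0 x - g' 0 x)) := by
  set δ := nsq (fun x => f 0 x - f' 0 x) + nsq (fun x => g 0 x - g' 0 x)
  set A := ⨆ s ∈ Icc 0 T, nsq (fun x => f s x - f' s x)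
  set B := ⨆ s ∈ Icc 0 T, nsq (fun x => g s x - g' s x)
  set A' := ⨆ x, charMass T (fun s y => f s (-y) - f' s (-y)) x
  set B' := ⨆ x, charMass T (fun s y => g s y - g' s y) x
  -- One maximum over both components, combining the norms at fixed times with the masses on
  -- characteristics, since each half of the estimate feeds the other.
  set η := max (max A B) (max A' B')
  have hA : ∀ s ∈ Icc 0 T, nsq (fun x => f s x - f' s x) ≤ η := fun s hs =>
    (le_iSup₂ (f := fun s (_ : s ∈ Icc 0 T) => nsq (fun x => f s x - f' s x)) s hs).trans
      ((le_max_left _ _).trans (le_max_left _ _))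
  have hB : ∀ s ∈ Icc 0 T, nsq (fun x => g s x - g' s x) ≤ η := fun s hs =>
    (le_iSup₂ (f := fun s (_ : s ∈ Icc 0 T) => nsq (fun x => g s x - g' s x)) s hs).trans
      ((le_max_right _ _).trans (le_max_left _ _))
  have hA' : ∀ x, charMass T (fun s y => f s (-y) - f' s (-y)) x ≤ η := fun x =>
    (le_iSup (fun x => charMass T (fun s y => f s (-y) - f' s (-y)) x) x).trans
      ((le_max_left _ _).trans (le_max_right _ _))
  have hB' : ∀ x, charMass T (fun s y => g s y - g' s y) x ≤ η := fun x =>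
    (le_iSup (fun x => charMass T (fun s y => g s y - g' s y) x) x).trans
      ((le_max_right _ _).trans (le_max_right _ _))
  -- The a priori charge bounds make `η` finite, so that `η / 2` may be subtracted.
  have hfin : η ≤ 4 * ENNReal.ofReal C := by
    refine max_le (max_le (iSup₂_le fun s hs => ?_) (iSup₂_le fun s hs => ?_))
      (max_le (iSup_le fun x => ?_) (iSup_le fun x => ?_))
    · exact S.nsq_sub_le_charge S' hs
    · have := S.reflect.nsq_sub_le_charge S'.reflect hs
      rwa [nsq_comp_neg (fun x => g s x - g' s x)] at this
    · exact S.reflect.charMass_sub_le_charge hab.symm hT S'.reflect x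
    · exact S.charMass_sub_le_charge hab hT S' x
  obtain ⟨p1, p2⟩ := stability_half hab hT hm hC hmT hκa S S' hB hB'
  obtain ⟨q1, q2⟩ := stability_half hab.symm hT hm hC hmT hκb S.reflect S'.reflect
    (η := η) (fun s hs => by
      rw [nsq_comp_neg (fun x => f s x - f' s x)]; exact hA s hs) hA'
  simp only [neg_neg] at q2
  have hδ1 : 12 * nsq (fun x => f 0 x - f' 0 x) + η / 2 ≤ 12 * δ + η / 2 := by
    gcongr; exact le_self_add
  have hδ2 : 12 * nsq (fun x => g 0 (-x) - g' 0 (-x)) + η / 2 ≤ 12 * δ + η / 2 := by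
    rw [nsq_comp_neg (fun x => g 0 x - g' 0 x)]
    gcongr; exact le_add_self
  have hη : η ≤ 12 * δ + η / 2 := by
    refine max_le (max_le (iSup₂_le fun s hs => ?_) (iSup₂_le fun s hs => ?_))
      (max_le (iSup_le fun x => ?_) (iSup_le fun x => ?_))
    · exact (p1 s hs).trans hδ1
    · have := (q1 s hs).trans hδ2
      rwa [nsq_comp_neg (fun x => g s x - g' s x)] at this
    · exact (p2 x).trans hδ1
    · exact (q2 x).trans hδ2
  have hη' : η ≤ 24 * δ := by
    have := ennreal_le_two_mul_of_le_add_half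
      (hfin.trans_lt (ENNReal.mul_lt_top (by simp) (by simp))).ne hη
    rwa [← mul_assoc, show (2 : ℝ≥0∞) * 12 = 24 by norm_num] at this
  exact ⟨fun s hs => (hA s hs).trans hη', fun s hs => (hB s hs).trans hη',
    fun x => (hB' x).trans hη'⟩

/-- The cubic difference is bounded by a product in which one factor carries the differences and the
other is `|g| + |g'|`. Cauchy–Schwarz over space-time then uses the stability bound on the first
factor and the charge on the second. -/
lemma cubicDist_sq_le (hab : ChargeCondition a b) (hT : 0 ≤ T) (hT1 : T ≤ 1) (hm : 0 ≤ m)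
    (hC : 0 ≤ C) (hmT : m * T ≤ 1 / 10) (hκa : coeffSum a * C ≤ 1 / 100)
    (hκb : coeffSum b * C ≤ 1 / 100)
    (S : CharSol a b m T C χ f g) (S' : CharSol a b m T C χ f' g') :
    cubicDist a T f g f' g' ^ 2 ≤
      24 * (nsq (fun x => f 0 x - f' 0 x) + nsq (fun x => g 0 x - g' 0 x)) := by
  obtain ⟨-, hB, hB'⟩ := stability hab hT hm hC hmT hκa hκb S S'
  set δ := nsq (fun x => f 0 x - f' 0 x) + nsq (fun x => g 0 x - g' 0 x)
  have hκ0 := coeffSum_nonneg a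
  set κ := coeffSum a
  have hI : ∫⁻ x, diffMajorant κ C m T f g f' g' x ≤ 24 * δ := by
    refine (lintegral_diffMajorant_le hT hm hC hmT hκ0 hκa S S' hB hB').trans ?_
    calc _ ≤ 12 * δ + 12 * δ := by
          gcongr
          · exact le_self_add
          · rw [show (24 : ℝ≥0∞) * δ = 2 * (12 * δ) by rw [← mul_assoc]; norm_num,
              mul_comm, ENNReal.mul_div_cancel_right two_ne_zero (by simp)]
      _ = _ := by rw [← add_mul]; norm_num
  set μ := (volume.restrict (Ioc 0 T)).prod (volume : Measure ℝ)
  have c1 : Continuous fun z : ℝ × ℝ => f z.1 z.2 := S.cont_f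
  have c2 : Continuous fun z : ℝ × ℝ => f' z.1 z.2 := S'.cont_f
  have c3 : Continuous fun z : ℝ × ℝ => g z.1 (z.2 + 2 * z.1) :=
    continuous_comp₂ S.cont_g (by fun_prop) (by fun_prop)
  have c4 : Continuous fun z : ℝ × ℝ => g' z.1 (z.2 + 2 * z.1) :=
    continuous_comp₂ S'.cont_g (by fun_prop) (by fun_prop)
  set B : ℝ × ℝ → ℝ≥0∞ := fun z => ‖g z.1 (z.2 + 2 * z.1)‖ₑ + ‖g' z.1 (z.2 + 2 * z.1)‖ₑ
  set A : ℝ × ℝ → ℝ≥0∞ := fun z => ‖f z.1 z.2 - f' z.1 z.2‖ₑ * B z +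
    ‖g z.1 (z.2 + 2 * z.1) - g' z.1 (z.2 + 2 * z.1)‖ₑ * (‖f z.1 z.2‖ₑ + ‖f' z.1 z.2‖ₑ)
  have mB : Measurable B := c3.measurable.enorm.add c4.measurable.enorm
  have mA : Measurable A := ((c1.sub c2).measurable.enorm.mul mB).add
    ((c3.sub c4).measurable.enorm.mul (c1.measurable.enorm.add c2.measurable.enorm))
  have mN : Measurable fun z : ℝ × ℝ => ‖cubic a (f z.1 z.2) (g z.1 (z.2 + 2 * z.1)) -
      cubic a (f' z.1 z.2) (g' z.1 (z.2 + 2 * z.1))‖ₑ :=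
    ((continuous_cubic_comp a c1 c3).sub (continuous_cubic_comp a c2 c4)).measurable.enorm
  have h1 : cubicDist a T f g f' g' ≤ ENNReal.ofReal κ * ∫⁻ z, A z * B z ∂μ := by
    rw [← lintegral_const_mul' _ _ (by simp), cubicDist, lintegral_lintegral mN.aemeasurable]
    refine lintegral_mono fun z => ?_
    rw [← ofReal_norm]
    refine (ENNReal.ofReal_le_ofReal (norm_cubic_sub_le a _ _ _ _)).trans ?_
    rw [ENNReal.ofReal_mul hκ0]
    gcongr
    calc _ ≤ ENNReal.ofReal ((‖f z.1 z.2 - f' z.1 z.2‖ * (‖g z.1 (z.2 + 2 * z.1)‖ +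
          ‖g' z.1 (z.2 + 2 * z.1)‖) + ‖g z.1 (z.2 + 2 * z.1) - g' z.1 (z.2 + 2 * z.1)‖ *
          (‖f z.1 z.2‖ + ‖f' z.1 z.2‖)) * (‖g z.1 (z.2 + 2 * z.1)‖ +
          ‖g' z.1 (z.2 + 2 * z.1)‖)) := by
          apply ENNReal.ofReal_le_ofReal
          have gen : ∀ d x y : ℝ, 0 ≤ d → 0 ≤ x → 0 ≤ y →
              d * (x ^ 2 + y ^ 2) ≤ d * (x + y) * (x + y) := fun d x y hd hx hy => by
            nlinarith [mul_nonneg hd (mul_nonneg hx hy)]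
          rw [add_mul]
          exact add_le_add (gen _ _ _ (norm_nonneg _) (norm_nonneg _) (norm_nonneg _)) le_rfl
      _ = A z * B z := by
          rw [ENNReal.ofReal_mul (by positivity), ENNReal.ofReal_add (by positivity)
            (by positivity), ENNReal.ofReal_mul (by positivity),
            ENNReal.ofReal_mul (by positivity), ENNReal.ofReal_add (by positivity)
            (by positivity), ENNReal.ofReal_add (by positivity) (by positivity)]
          simp only [ofReal_norm, A, B]
  have h2 : ∫⁻ z, B z ^ 2 ∂μ ≤ 4 * ENNReal.ofReal C := by
    rw [lintegral_prod _ (mB.pow_const 2).aemeasurable]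
    calc _ ≤ ENNReal.ofReal T * (4 * ENNReal.ofReal C) := by
          refine setLIntegral_le_mul fun s hs => ?_
          have mg : Measurable fun x => ‖g s (x + 2 * s)‖ₑ ^ 2 :=
            (continuous_comp₂ S.cont_g continuous_const (by fun_prop)).measurable.enorm.pow_const 2
          calc _ ≤ ∫⁻ x, 2 * (‖g s (x + 2 * s)‖ₑ ^ 2 + ‖g' s (x + 2 * s)‖ₑ ^ 2) :=
                lintegral_mono fun x => ennreal_add_sq_le _ _
            _ = 2 * (nsq (g s) + nsq (g' s)) := by
                rw [lintegral_const_mul' _ _ (by simp), lintegral_add_left mg]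
                congr 2
                · exact nsq_comp_add (g s) (2 * s)
                · exact nsq_comp_add (g' s) (2 * s)
            _ ≤ 2 * (ENNReal.ofReal C + ENNReal.ofReal C) := by
                gcongr
                exacts [S.nsq_g_le hs, S'.nsq_g_le hs]
            _ = _ := by ring
      _ ≤ 1 * (4 * ENNReal.ofReal C) := by
          gcongr
          rwa [ENNReal.ofReal_le_one]
      _ = _ := one_mul _
  -- Integrating in `t` first, at fixed characteristic label `x`, leaves two products: the majorant
  -- of `|f - f'|²` times the flux of `|g| + |g'|`, and the majorants of `f`, `f'` times the mass of
  -- `g - g'`. The constant is 132 = 2(2 + 64).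
  have h3 : ∫⁻ z, A z ^ 2 ∂μ ≤ 132 * ENNReal.ofReal C * (24 * δ) := by
    have mM := measurable_diffMajorant κ S S'
    have mm : Measurable fun x => 2 * (majorant m T f g x + majorant m T f' g' x) :=
      (S.measurable_majorant.add S'.measurable_majorant).const_mul _
    rw [lintegral_prod_symm _ (mA.pow_const 2).aemeasurable]
    have hx : ∀ x, ∫⁻ t in Ioc 0 T, A (t, x) ^ 2 ≤
        2 * (diffMajorant κ C m T f g f' g' x * (2 * ENNReal.ofReal C) +
          (2 * (majorant m T f g x + majorant m T f' g' x)) * (24 * δ)) := by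
      intro x
      have mBx : Measurable fun t => B (t, x) ^ 2 :=
        (mB.comp (by fun_prop : Measurable fun t : ℝ => (t, x))).pow_const 2
      have mex : Measurable fun t => ‖g t (x + 2 * t) - g' t (x + 2 * t)‖ₑ ^ 2 :=
        ((c3.sub c4).measurable.enorm.comp
          (by fun_prop : Measurable fun t : ℝ => (t, x))).pow_const 2
      calc _ ≤ ∫⁻ t in Ioc 0 T, 2 * (diffMajorant κ C m T f g f' g' x * B (t, x) ^ 2 +
            (2 * (majorant m T f g x + majorant m T f' g' x)) *
              ‖g t (x + 2 * t) - g' t (x + 2 * t)‖ₑ ^ 2) := by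
            refine setLIntegral_mono (((mBx.const_mul _).add (mex.const_mul _)).const_mul _)
              fun t ht => ?_
            have ht' := Ioc_subset_Icc_self ht
            refine (ennreal_add_sq_le _ _).trans ?_
            rw [mul_pow, mul_pow, mul_comm (‖g t (x + 2 * t) - g' t (x + 2 * t)‖ₑ ^ 2)]
            gcongr
            · exact enorm_sub_sq_le_diffMajorant hab hm hC (by linarith) S S' ht' x
            · exact S.enorm_add_sq_le hab hm (by linarith) S' ht' x
        _ = 2 * (diffMajorant κ C m T f g f' g' x * (∫⁻ t in Ioc 0 T, B (t, x) ^ 2) +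
            (2 * (majorant m T f g x + majorant m T f' g' x)) *
              charMass T (fun s y => g s y - g' s y) x) := by
            rw [lintegral_const_mul' _ _ (by simp), lintegral_add_left (mBx.const_mul _),
              lintegral_const_mul _ mBx, lintegral_const_mul _ mex]
            rfl
        _ ≤ _ := by
            gcongr
            · exact S.charMass_add_le hab hT S' x
            · exact hB' x
    refine (lintegral_mono hx).trans ?_
    rw [lintegral_const_mul' _ _ (by simp), lintegral_add_left (mM.mul_const _),
      lintegral_mul_const _ mM, lintegral_mul_const _ mm]
    calc _ ≤ 2 * (24 * δ * (2 * ENNReal.ofReal C) + 64 * ENNReal.ofReal C * (24 * δ)) := by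
          gcongr
          exact S.lintegral_majorants_le hT hm hmT S'
      _ = _ := by ring
  calc cubicDist a T f g f' g' ^ 2 ≤ (ENNReal.ofReal κ * ∫⁻ z, A z * B z ∂μ) ^ 2 :=
        pow_le_pow_left' h1 2
    _ ≤ ENNReal.ofReal κ ^ 2 * ((132 * ENNReal.ofReal C * (24 * δ)) * (4 * ENNReal.ofReal C)) := by
        rw [mul_pow]
        gcongr
        exact (lintegral_mul_sq_le mA.aemeasurable mB.aemeasurable).trans (mul_le_mul' h3 h2)
    _ = ENNReal.ofReal (528 * (κ * C) ^ 2) * (24 * δ) := by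
        rw [ENNReal.ofReal_mul (by norm_num), ENNReal.ofReal_pow (by positivity),
          ENNReal.ofReal_mul hκ0, ENNReal.ofReal_ofNat]
        ring
    _ ≤ 1 * (24 * δ) := by
        gcongr
        rw [ENNReal.ofReal_le_one]
        have e2 : (κ * C) ^ 2 ≤ (1 / 100) ^ 2 := pow_le_pow_left₀ (by positivity) hκa 2
        norm_num at *
        linarith
    _ = _ := one_mul _

end CharSol

/-! ### Stability on long time intervals -/

lemma setLIntegral_Ioc_add (F : ℝ → ℝ≥0∞) (s T : ℝ) :
    ∫⁻ t in Ioc s (s + T), F t = ∫⁻ t in Ioc 0 T, F (s + t) := by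
  rw [← lintegral_indicator measurableSet_Ioc, ← lintegral_indicator measurableSet_Ioc,
    ← lintegral_add_left_eq_self _ s]
  congr 1; ext t
  by_cases ht : t ∈ Ioc 0 T
  · rw [indicator_of_mem ht, indicator_of_mem]
    exact ⟨by linarith [ht.1], by linarith [ht.2]⟩
  · rw [indicator_of_notMem ht, indicator_of_notMem]
    exact fun h => ht ⟨by linarith [h.1], by linarith [h.2]⟩

lemma cubicDist_add (a : Fin 2 → Fin 3 → ℂ) {s T : ℝ} (hs : 0 ≤ s) (hT : 0 ≤ T)
    (f g f' g' : ℝ → ℝ → ℂ) :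
    cubicDist a (s + T) f g f' g' = cubicDist a s f g f' g' +
      cubicDist a T (fun t x => f (s + t) x) (fun t x => g (s + t) (x + 2 * s))
        (fun t x => f' (s + t) x) (fun t x => g' (s + t) (x + 2 * s)) := by
  unfold cubicDist
  rw [← Ioc_union_Ioc_eq_Ioc hs (le_add_of_nonneg_right hT),
    lintegral_union measurableSet_Ioc (Ioc_disjoint_Ioc_of_le le_rfl), setLIntegral_Ioc_add]
  congr 2; ext t
  congr 1; ext x
  rw [show x + 2 * (s + t) = x + 2 * t + 2 * s by ring]

namespace CharSol

variable {a b : Fin 2 → Fin 3 → ℂ} {m C : ℝ}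

/-- Every short interval can be treated with the same `T₀`, because the charge bound `C` is retained
at each restart. Only the distance of the data is amplified. -/
lemma stability_long (hab : ChargeCondition a b) (hm : 0 ≤ m) (hC : 0 ≤ C)
    (hκa : coeffSum a * C ≤ 1 / 100) (hκb : coeffSum b * C ≤ 1 / 100)
    {T₀ : ℝ} (hT₀ : 0 ≤ T₀) (hT₀1 : T₀ ≤ 1) (hmT : m * T₀ ≤ 1 / 10) (n : ℕ) :
    ∀ {T : ℝ} {χ : ℝ → ℝ} {f g f' g' : ℝ → ℝ → ℂ}, 0 ≤ T → T ≤ n * T₀ →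
      CharSol a b m T C χ f g → CharSol a b m T C χ f' g' →
      (∀ t ∈ Icc 0 T, nsq (fun x => f t x - f' t x) + nsq (fun x => g t x - g' t x) ≤
        192 ^ n * (nsq (fun x => f 0 x - f' 0 x) + nsq (fun x => g 0 x - g' 0 x))) ∧
      cubicDist a T f g f' g' ^ 2 ≤
        192 ^ n * (nsq (fun x => f 0 x - f' 0 x) + nsq (fun x => g 0 x - g' 0 x)) := by
  have short : ∀ {T : ℝ} {χ : ℝ → ℝ} {f g f' g' : ℝ → ℝ → ℂ}, 0 ≤ T → T ≤ T₀ →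
      CharSol a b m T C χ f g → CharSol a b m T C χ f' g' →
      (∀ t ∈ Icc 0 T, nsq (fun x => f t x - f' t x) + nsq (fun x => g t x - g' t x) ≤
        48 * (nsq (fun x => f 0 x - f' 0 x) + nsq (fun x => g 0 x - g' 0 x))) ∧
      cubicDist a T f g f' g' ^ 2 ≤
        48 * (nsq (fun x => f 0 x - f' 0 x) + nsq (fun x => g 0 x - g' 0 x)) := by
    intro T χ f g f' g' hT hTT S S'
    have hmT' : m * T ≤ 1 / 10 := (mul_le_mul_of_nonneg_left hTT hm).trans hmT
    refine ⟨fun t ht => ?_, ?_⟩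
    · obtain ⟨h1, h2, -⟩ := stability hab hT hm hC hmT' hκa hκb S S'
      refine (add_le_add (h1 t ht) (h2 t ht)).trans (le_of_eq ?_)
      rw [← add_mul]; norm_num
    · refine (cubicDist_sq_le hab hT (hTT.trans hT₀1) hm hC hmT' hκa hκb S S').trans ?_
      gcongr; norm_num
  induction n with
  | zero =>
    intro T χ f g f' g' hT hTn S S'
    have hT0 : T = 0 := le_antisymm (by simpa using hTn) hT
    subst hT0
    refine ⟨fun t ht => ?_, ?_⟩
    · have : t = 0 := le_antisymm ht.2 ht.1
      subst this; simp
    · simp [cubicDist]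
  | succ n ih =>
    intro T χ f g f' g' hT hTn S S'
    set δ := nsq (fun x => f 0 x - f' 0 x) + nsq (fun x => g 0 x - g' 0 x)
    have one_le : (1 : ℝ≥0∞) ≤ 192 ^ n := one_le_pow₀ (by norm_num)
    have h48 : 48 * δ ≤ 192 ^ (n + 1) * δ := by
      gcongr
      rw [pow_succ]
      calc (48 : ℝ≥0∞) ≤ 1 * 192 := by norm_num
        _ ≤ 192 ^ n * 192 := by gcongr
    rcases le_total T T₀ with h | h
    · obtain ⟨h1, h2⟩ := short hT h S S'
      exact ⟨fun t ht => (h1 t ht).trans h48, h2.trans h48⟩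
    · obtain ⟨T', rfl⟩ : ∃ T', T = T₀ + T' := ⟨T - T₀, by ring⟩
      have hT' : 0 ≤ T' := by linarith
      obtain ⟨h1, h2⟩ := short hT₀ le_rfl (S.mono h) (S'.mono h)
      obtain ⟨k1, k2⟩ := ih hT' (by push_cast at hTn; linarith) (S.restart hT₀) (S'.restart hT₀)
      simp only [add_zero] at k1 k2
      rw [nsq_comp_add (fun x => g T₀ x - g' T₀ x)] at k1 k2
      have hδ := h1 T₀ ⟨hT₀, le_rfl⟩
      have hmul : 192 ^ n * (nsq (fun x => f T₀ x - f' T₀ x) + nsq (fun x => g T₀ x - g' T₀ x)) ≤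
          192 ^ n * (48 * δ) := by gcongr
      refine ⟨fun t ht => ?_, ?_⟩
      · rcases le_total t T₀ with h' | h'
        · exact (h1 t ⟨ht.1, h'⟩).trans h48
        · have := k1 (t - T₀) ⟨by linarith, by linarith [ht.2]⟩
          simp only [add_sub_cancel] at this
          rw [nsq_comp_add (fun x => g t x - g' t x)] at this
          refine (this.trans hmul).trans ?_
          rw [← mul_assoc, pow_succ]
          gcongr
          norm_num
      · rw [cubicDist_add a hT₀ hT']
        refine (ennreal_add_sq_le _ _).trans ?_
        -- The base 192 = 4 · 48 is dictated by the nonlinear distances: both the first interval and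
        -- the remainder contribute, and squaring their sum costs another factor 2.
        calc _ ≤ 2 * (48 * δ + 192 ^ n * (48 * δ)) := by
              gcongr
              exact k2.trans hmul
          _ ≤ 2 * (192 ^ n * (48 * δ) + 192 ^ n * (48 * δ)) := by
              exact mul_le_mul' le_rfl (add_le_add (le_mul_of_one_le_left' one_le) le_rfl)
          _ = 192 ^ (n + 1) * δ := by
              ring

end CharSol

/-! ### From curves in `H¹` to solutions along characteristics -/

lemma enorm_sq_eq_lintegral (f : L2) : ENNReal.ofReal (‖f‖ ^ 2) = ∫⁻ x, ‖f x‖ₑ ^ 2 := by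
  rw [ENNReal.ofReal_pow (norm_nonneg _), ofReal_norm, Lp.enorm_def,
    eLpNorm_eq_lintegral_rpow_enorm_toReal two_ne_zero (by simp)]
  rw [← ENNReal.rpow_natCast, ← ENNReal.rpow_mul]
  simp

lemma nsq_congr_ae {f h : ℝ → ℂ} (e : f =ᵐ[volume] h) : nsq f = nsq h :=
  lintegral_congr_ae (e.mono fun x hx => by simp only [hx])

lemma nsq_ev (p : H1) : nsq (fun x => H1.ev x p) = ENNReal.ofReal (‖p.toL2‖ ^ 2) := by
  rw [enorm_sq_eq_lintegral]
  exact (nsq_congr_ae p.coeFn_ae_eq).symm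

lemma nsq_ev_sub (p q : H1) : nsq (fun x => H1.ev x p - H1.ev x q) =
    ENNReal.ofReal (‖p.toL2 - q.toL2‖ ^ 2) := by
  rw [← map_sub, ← nsq_ev]
  simp

lemma ev_field_fst (a b : Fin 2 → Fin 3 → ℂ) (m t : ℝ) (F : H1 × H1) (x : ℝ) :
    H1.ev x (field a b m t F).1 = rhs a m (H1.ev x F.1) (H1.ev (x + 2 * t) F.2) := by
  simp [field, rhs, H1.ev_shift]
  ring

lemma ev_field_snd (a b : Fin 2 → Fin 3 → ℂ) (m t : ℝ) (F : H1 × H1) (x : ℝ) :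
    H1.ev x (field a b m t F).2 = rhs b m (H1.ev x F.2) (H1.ev (x - 2 * t) F.1) := by
  simp [field, rhs, H1.ev_shift, sub_eq_add_neg]
  ring

/-- The field does not change the charge. -/
lemma inner_field (a b : Fin 2 → Fin 3 → ℂ) (hab : ChargeCondition a b) (m t : ℝ)
    (F : H1 × H1) : inner ℝ F.1.toL2 (field a b m t F).1.toL2 +
      inner ℝ F.2.toL2 (field a b m t F).2.toL2 = 0 := by
  have h1 : inner ℝ F.1.toL2 (field a b m t F).1.toL2 =
      ∫ x, (rhs a m (H1.ev x F.1) (H1.ev (x + 2 * t) F.2) * conj (H1.ev x F.1)).re := by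
    rw [L2.inner_def]
    apply integral_congr_ae
    filter_upwards [F.1.coeFn_ae_eq, (field a b m t F).1.coeFn_ae_eq] with x e1 e2
    rw [e1, e2, Complex.inner, ev_field_fst]
  -- The translation by `2t` evaluates both integrands at the same physical point, where the
  -- pointwise charge identity applies.
  have h2 : inner ℝ F.2.toL2 (field a b m t F).2.toL2 =
      ∫ x, (rhs b m (H1.ev (x + 2 * t) F.2) (H1.ev x F.1) * conj (H1.ev (x + 2 * t) F.2)).re := by
    rw [L2.inner_def, ← integral_add_right_eq_self _ (2 * t)]
    apply integral_congr_ae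
    filter_upwards [ae_comp_add_right F.2.coeFn_ae_eq (2 * t),
      ae_comp_add_right (field a b m t F).2.coeFn_ae_eq (2 * t)] with x e1 e2
    rw [e1, e2, Complex.inner, ev_field_snd, add_sub_cancel_right]
  rw [h1, h2, ← sub_neg_eq_add, sub_eq_zero, ← integral_neg]
  congr 1; ext x
  have := hab.rhs_re m (H1.ev x F.1) (H1.ev (x + 2 * t) F.2)
  linarith

/-- A curve in `H¹ × H¹` solves the damped system on `(0,T)`. -/
def IsCurve (a b : Fin 2 → Fin 3 → ℂ) (m T : ℝ) (χ : ℝ → ℝ) (F : ℝ → H1 × H1) : Prop :=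
  Continuous F ∧ ∀ t ∈ Ioo 0 T, HasDerivAt F (χ t • field a b m t (F t)) t

/-- The charge. -/
def charge (F : H1 × H1) : ℝ := ‖F.1.toL2‖ ^ 2 + ‖F.2.toL2‖ ^ 2

lemma ofReal_charge (F : H1 × H1) : nsq (fun x => H1.ev x F.1) + nsq (fun x => H1.ev x F.2) =
    ENNReal.ofReal (charge F) := by
  rw [nsq_ev, nsq_ev, charge, ENNReal.ofReal_add (by positivity) (by positivity)]

/-- Damping multiplies a rate that already vanishes, so the truncated evolution conserves the charge
exactly as the original one does. -/
lemma IsCurve.charge_eq {a b : Fin 2 → Fin 3 → ℂ} (hab : ChargeCondition a b) {m T : ℝ}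
    {χ : ℝ → ℝ} {F : ℝ → H1 × H1} (h : IsCurve a b m T χ F) {t : ℝ} (ht : t ∈ Icc 0 T) :
    charge (F t) = charge (F 0) := by
  have hd : ∀ s ∈ Ioo 0 t, HasDerivAt (fun s => charge (F s)) 0 s := by
    intro s hs
    have hF := h.2 s ⟨hs.1, hs.2.trans_le ht.2⟩
    have h1 := (((H1.toL2.comp (ContinuousLinearMap.fst ℂ H1 H1)).restrictScalars
      ℝ).hasFDerivAt.comp_hasDerivAt s hF).norm_sq
    have h2 := (((H1.toL2.comp (ContinuousLinearMap.snd ℂ H1 H1)).restrictScalars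
      ℝ).hasFDerivAt.comp_hasDerivAt s hF).norm_sq
    have h3 := h1.add h2
    convert! h3 using 1
    have := inner_field a b hab m s (F s)
    rw [map_smul, map_smul, real_inner_smul_right, real_inner_smul_right]
    change 0 = 2 * (χ s * inner ℝ (F s).1.toL2 (field a b m s (F s)).1.toL2) +
      2 * (χ s * inner ℝ (F s).2.toL2 (field a b m s (F s)).2.toL2)
    linear_combination -2 * χ s * this
  have hc : Continuous fun s => charge (F s) :=
    ((H1.toL2.continuous.comp (continuous_fst.comp h.1)).norm.pow 2).add
      ((H1.toL2.continuous.comp (continuous_snd.comp h.1)).norm.pow 2)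
  have := intervalIntegral.integral_eq_sub_of_hasDerivAt_of_le ht.1 hc.continuousOn hd
    (by simp)
  simp only [intervalIntegral.integral_zero] at this
  linarith

lemma IsCurve.charSol {a b : Fin 2 → Fin 3 → ℂ} (hab : ChargeCondition a b) {m T C : ℝ}
    {χ : ℝ → ℝ} {F : ℝ → H1 × H1} (h : IsCurve a b m T χ F) (hχ : Continuous χ)
    (hχ' : ∀ t, χ t ∈ Icc (0 : ℝ) 1) (hC : charge (F 0) ≤ C) :
    CharSol a b m T C χ (fun t x => H1.ev x (F t).1) (fun t x => H1.ev x (F t).2) where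
  cont_f := H1.continuous_ev_comp continuous_snd (continuous_fst.comp (h.1.comp continuous_fst))
  cont_g := H1.continuous_ev_comp continuous_snd (continuous_snd.comp (h.1.comp continuous_fst))
  cont_χ := hχ
  χ_mem := hχ'
  deriv_f t ht x := by
    have h1 := ((H1.evL x).comp (ContinuousLinearMap.fst ℂ H1 H1)).restrictScalars
      ℝ |>.hasFDerivAt.comp_hasDerivAt t (h.2 t ht)
    rw [map_smul] at h1
    convert! h1 using 1
    rw [Complex.real_smul]
    congr 1
    exact (ev_field_fst a b m t (F t) x).symm
  deriv_g t ht x := by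
    have h1 := ((H1.evL x).comp (ContinuousLinearMap.snd ℂ H1 H1)).restrictScalars
      ℝ |>.hasFDerivAt.comp_hasDerivAt t (h.2 t ht)
    rw [map_smul] at h1
    convert! h1 using 1
    rw [Complex.real_smul]
    congr 1
    exact (ev_field_snd a b m t (F t) x).symm
  charge t ht := by
    rw [ofReal_charge, h.charge_eq hab ht]
    exact ENNReal.ofReal_le_ofReal hC

/-! ### Global existence and uniqueness in `H¹` -/

/-- A cutoff function, equal to `1` on the ball of radius `B` and to `0` off that of radius
`B + 1`. -/
def cutoff (B r : ℝ) : ℝ := max 0 (min 1 (B + 1 - r))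

lemma continuous_cutoff (B : ℝ) : Continuous (cutoff B) := by
  unfold cutoff; fun_prop

lemma cutoff_mem (B r : ℝ) : cutoff B r ∈ Icc (0 : ℝ) 1 :=
  ⟨le_max_left _ _, max_le zero_le_one (min_le_left _ _)⟩

lemma cutoff_eq_one {B r : ℝ} (h : r ≤ B) : cutoff B r = 1 := by
  rw [cutoff, min_eq_left (by linarith), max_eq_right zero_le_one]

lemma cutoff_eq_zero {B r : ℝ} (h : B + 1 ≤ r) : cutoff B r = 0 := by
  rw [cutoff, max_eq_left ((min_le_right _ _).trans (by linarith))]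

lemma abs_cutoff_sub_le (B r s : ℝ) : |cutoff B r - cutoff B s| ≤ |r - s| := by
  unfold cutoff
  refine (abs_max_sub_max_le_max _ _ _ _).trans ?_
  refine max_le (by simp) ((abs_min_sub_min_le_max _ _ _ _).trans (max_le (by simp) ?_))
  rw [sub_sub_sub_cancel_left, abs_sub_comm]

/-! ### Truncated differential equations in a Banach space -/

section Ode

variable {E : Type*} [NormedAddCommGroup E] [NormedSpace ℝ E]

lemma BddLip.exists_cutoff_lipschitz {Ψ : ℝ → E → E} (h : BddLip Ψ) (B : ℝ) :
    ∃ K : ℝ, 0 ≤ K ∧ ∀ t x y, ‖cutoff B ‖x‖ • Ψ t x‖ ≤ K ∧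
      ‖cutoff B ‖x‖ • Ψ t x - cutoff B ‖y‖ • Ψ t y‖ ≤ 2 * K * ‖x - y‖ := by
  obtain ⟨K, hK, hh⟩ := h.2 (B + 1)
  have bound : ∀ t x, ‖cutoff B ‖x‖ • Ψ t x‖ ≤ K := by
    intro t x
    rcases le_total ‖x‖ (B + 1) with hx | hx
    · rw [norm_smul, Real.norm_of_nonneg (cutoff_mem B _).1]
      exact (mul_le_of_le_one_left (norm_nonneg _) (cutoff_mem B _).2).trans (hh t x x hx hx).1
    · rw [cutoff_eq_zero hx, zero_smul, norm_zero]; exact hK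
  -- Only `x` is assumed to lie in the large ball: the variation of the cutoff is paired with `Ψ t
  -- x`, and the other term vanishes if `y` lies outside. The remaining case follows by symmetry.
  have diff : ∀ t x y, ‖x‖ ≤ B + 1 →
      ‖cutoff B ‖x‖ • Ψ t x - cutoff B ‖y‖ • Ψ t y‖ ≤ 2 * K * ‖x - y‖ := by
    intro t x y hx
    have hc : |cutoff B ‖x‖ - cutoff B ‖y‖| ≤ ‖x - y‖ :=
      (abs_cutoff_sub_le B _ _).trans (abs_norm_sub_norm_le x y)
    have h1 : ‖(cutoff B ‖x‖ - cutoff B ‖y‖) • Ψ t x‖ ≤ ‖x - y‖ * K := by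
      rw [norm_smul, Real.norm_eq_abs]
      exact mul_le_mul hc (hh t x x hx hx).1 (norm_nonneg _) (norm_nonneg _)
    have h2 : ‖cutoff B ‖y‖ • (Ψ t x - Ψ t y)‖ ≤ K * ‖x - y‖ := by
      rcases le_total ‖y‖ (B + 1) with hy | hy
      · rw [norm_smul, Real.norm_of_nonneg (cutoff_mem B _).1]
        exact (mul_le_of_le_one_left (norm_nonneg _) (cutoff_mem B _).2).trans (hh t x y hx hy).2
      · rw [cutoff_eq_zero hy, zero_smul, norm_zero]; positivity
    have e : cutoff B ‖x‖ • Ψ t x - cutoff B ‖y‖ • Ψ t y =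
        (cutoff B ‖x‖ - cutoff B ‖y‖) • Ψ t x + cutoff B ‖y‖ • (Ψ t x - Ψ t y) := by
      rw [sub_smul, smul_sub]; abel
    rw [e]
    refine (norm_add_le _ _).trans ?_
    linarith
  refine ⟨K, hK, fun t x y => ⟨bound t x, ?_⟩⟩
  rcases le_total ‖x‖ (B + 1) with hx | hx
  · exact diff t x y hx
  · rcases le_total ‖y‖ (B + 1) with hy | hy
    · rw [norm_sub_rev, norm_sub_rev x]; exact diff t y x hy
    · rw [cutoff_eq_zero hx, cutoff_eq_zero hy]; simp; positivity

/-- The truncated equation has solutions on every interval. -/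
lemma BddLip.exists_truncated_solution [CompleteSpace E] {Ψ : ℝ → E → E} (h : BddLip Ψ)
    (B : ℝ) {T : ℝ} (hT : 0 ≤ T) (x₀ : E) :
    ∃ F : ℝ → E, F 0 = x₀ ∧ Continuous F ∧
      ∀ t ∈ Ioo 0 T, HasDerivAt F (cutoff B ‖F t‖ • Ψ t (F t)) t := by
  obtain ⟨K, hK, hh⟩ := h.exists_cutoff_lipschitz B
  -- The truncated field is bounded everywhere by `K`, so a ball of radius `K T` suffices and
  -- Picard–Lindelöf covers `[0,T]` in a single step.
  have hPL : IsPicardLindelof (fun t x => cutoff B ‖x‖ • Ψ t x)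
      (⟨0, left_mem_Icc.2 hT⟩ : Icc 0 T) x₀ (K * T).toNNReal 0 K.toNNReal (2 * K).toNNReal :=
    { lipschitzOnWith := fun t _ => by
        refine LipschitzOnWith.of_dist_le_mul fun x _ y _ => ?_
        rw [dist_eq_norm, dist_eq_norm, Real.coe_toNNReal _ (by positivity)]
        exact (hh t x y).2
      continuousOn := fun x _ => by
        refine Continuous.continuousOn ?_
        exact continuous_const.smul (h.1.comp (by fun_prop : Continuous fun t : ℝ => (t, x)))
      norm_le := fun t _ x _ => by
        rw [Real.coe_toNNReal _ hK]
        exact (hh t x x).1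
      mul_max_le := by
        rw [Real.coe_toNNReal _ hK, Real.coe_toNNReal _ (by positivity)]
        simp [hT] }
  obtain ⟨α, hα0, hα⟩ := hPL.exists_eq_forall_mem_Icc_hasDerivWithinAt
    (x := x₀) (Metric.mem_closedBall_self (by simp))
  have hαc : ContinuousOn α (Icc 0 T) := fun t ht => (hα t ht).continuousWithinAt
  refine ⟨fun t => α (projIcc 0 T hT t), by simpa using hα0, ?_, fun t ht => ?_⟩
  · exact (continuousOn_iff_continuous_domRestrict.1 hαc).comp continuous_projIcc
  · have e : (fun t => α (projIcc 0 T hT t)) =ᶠ[𝓝 t] α := by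
      filter_upwards [Ioo_mem_nhds ht.1 ht.2] with s hs
      rw [projIcc_of_mem hT (Ioo_subset_Icc_self hs)]
    have e' := e.eq_of_nhds
    simp only at e' ⊢
    rw [e']
    exact ((hα t (Ioo_subset_Icc_self ht)).hasDerivAt (Icc_mem_nhds ht.1
      ht.2)).congr_of_eventuallyEq e

/-- The equation is assumed only at interior times. Its derivative has a limit at 0 by continuity of
the field, which supplies the one-sided derivative there. -/
lemma BddLip.hasDerivWithinAt_Ici {Ψ : ℝ → E → E} (h : BddLip Ψ) {F : ℝ → E} {T : ℝ}
    (hF : Continuous F) (hd : ∀ t ∈ Ioo 0 T, HasDerivAt F (Ψ t (F t)) t) {t : ℝ}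
    (ht : t ∈ Ico 0 T) : HasDerivWithinAt F (Ψ t (F t)) (Ici t) t := by
  rcases eq_or_lt_of_le ht.1 with rfl | h0
  · refine hasDerivWithinAt_Ici_of_tendsto_deriv (s := Ioo 0 T)
      (fun s hs => (hd s hs).differentiableAt.differentiableWithinAt) hF.continuousWithinAt
      (Ioo_mem_nhdsGT ht.2) ?_
    have hc : Continuous fun s => Ψ s (F s) := h.1.comp (continuous_id.prodMk hF)
    refine ((hc.tendsto 0).mono_left nhdsWithin_le_nhds).congr' ?_
    filter_upwards [Ioo_mem_nhdsGT ht.2] with s hs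
    exact (hd s hs).deriv.symm
  · exact (hd t ⟨h0, ht.2⟩).hasDerivWithinAt

lemma BddLip.unique {Ψ : ℝ → E → E} (h : BddLip Ψ) {F G : ℝ → E} {T : ℝ}
    (hF : Continuous F) (hd : ∀ t ∈ Ioo 0 T, HasDerivAt F (Ψ t (F t)) t)
    (hG : Continuous G) (hd' : ∀ t ∈ Ioo 0 T, HasDerivAt G (Ψ t (G t)) t)
    (h0 : F 0 = G 0) : EqOn F G (Icc 0 T) := by
  obtain ⟨R₁, h₁⟩ := (isCompact_Icc (a := 0) (b := T)).exists_bound_of_continuousOn hF.continuousOn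
  obtain ⟨R₂, h₂⟩ := (isCompact_Icc (a := 0) (b := T)).exists_bound_of_continuousOn hG.continuousOn
  obtain ⟨K, hK, hh⟩ := h.2 (max R₁ R₂)
  refine ODE_solution_unique_of_mem_Icc_right (v := Ψ)
    (s := fun _ => Metric.closedBall 0 (max R₁ R₂)) (K := K.toNNReal)
    (fun t _ => LipschitzOnWith.of_dist_le_mul fun x hx y hy => ?_) hF.continuousOn
    (fun t ht => h.hasDerivWithinAt_Ici hF hd ht) (fun t ht => ?_) hG.continuousOn
    (fun t ht => h.hasDerivWithinAt_Ici hG hd' ht) (fun t ht => ?_) h0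
  · rw [dist_eq_norm, dist_eq_norm, Real.coe_toNNReal _ hK]
    exact (hh t x y (by simpa using hx) (by simpa using hy)).2
  · rw [mem_closedBall_zero_iff]
    exact (h₁ t (Ico_subset_Icc_self ht)).trans (le_max_left _ _)
  · rw [mem_closedBall_zero_iff]
    exact (h₂ t (Ico_subset_Icc_self ht)).trans (le_max_right _ _)

end Ode

lemma tendsto_slope_shift_sq (p : H1) :
    Tendsto (fun h : ℝ => (h⁻¹) ^ 2 * ‖shift h p.toL2 - p.toL2‖ ^ 2) (𝓝[≠] 0)
      (𝓝 (‖p.deriv‖ ^ 2)) := by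
  have hp := hasDerivAt_iff_tendsto_slope_zero.1 (p.hasDerivAt_shift 0)
  simp only [zero_add, shift_zero] at hp
  refine (hp.norm.pow 2).congr fun h => ?_
  rw [norm_smul, mul_pow, Real.norm_eq_abs, sq_abs]

/-! ### The `H¹` bound and removal of the cutoff -/

section Apriori

variable {a b : Fin 2 → Fin 3 → ℂ} {m C : ℝ}

lemma ofReal_sq_add_sq {E : Type*} [NormedAddCommGroup E] (x y : E) :
    ENNReal.ofReal (‖x‖ ^ 2) + ENNReal.ofReal (‖y‖ ^ 2) = ENNReal.ofReal (‖x‖ ^ 2 + ‖y‖ ^ 2) :=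
  (ENNReal.ofReal_add (by positivity) (by positivity)).symm

/-- The derivative is controlled by that of the data, through differences of translates. -/
lemma IsCurve.deriv_sq_le (hab : ChargeCondition a b) (hm : 0 ≤ m)
    (hκa : coeffSum a * C ≤ 1 / 100) (hκb : coeffSum b * C ≤ 1 / 100)
    {T₀ : ℝ} (hT₀ : 0 ≤ T₀) (hT₀1 : T₀ ≤ 1) (hmT : m * T₀ ≤ 1 / 10) {n : ℕ} {T : ℝ}
    (hT : 0 ≤ T) (hTn : T ≤ n * T₀) {χ : ℝ → ℝ} (hχ : Continuous χ)
    (hχ' : ∀ t, χ t ∈ Icc (0 : ℝ) 1) {F : ℝ → H1 × H1} (hF : IsCurve a b m T χ F)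
    (hC : charge (F 0) ≤ C) {t : ℝ} (ht : t ∈ Icc 0 T) :
    ‖(F t).1.deriv‖ ^ 2 + ‖(F t).2.deriv‖ ^ 2 ≤
      192 ^ n * (‖(F 0).1.deriv‖ ^ 2 + ‖(F 0).2.deriv‖ ^ 2) := by
  have hC0 : 0 ≤ C := le_trans (by unfold charge; positivity) hC
  have S := hF.charSol hab hχ hχ' hC
  -- Long-time stability for the solution and its translate by `h`; the constant is independent of
  -- `h`, so dividing by `h²` loses nothing.
  have key : ∀ h : ℝ, ‖shift h (F t).1.toL2 - (F t).1.toL2‖ ^ 2 +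
      ‖shift h (F t).2.toL2 - (F t).2.toL2‖ ^ 2 ≤
      192 ^ n * (‖shift h (F 0).1.toL2 - (F 0).1.toL2‖ ^ 2 +
        ‖shift h (F 0).2.toL2 - (F 0).2.toL2‖ ^ 2) := by
    intro h
    have := (CharSol.stability_long hab hm hC0 hκa hκb hT₀ hT₀1 hmT n hT hTn
      (S.translate h) S).1 t ht
    simp only [← H1.ev_shift, nsq_ev_sub, ofReal_sq_add_sq, H1.toL2_shift] at this
    rw [show (192 : ℝ≥0∞) ^ n = ENNReal.ofReal (192 ^ n) by
        rw [ENNReal.ofReal_pow (by norm_num), ENNReal.ofReal_ofNat],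
      ← ENNReal.ofReal_mul (by positivity)] at this
    exact (ENNReal.ofReal_le_ofReal_iff (by positivity)).1 this
  refine le_of_tendsto_of_tendsto'
    ((tendsto_slope_shift_sq (F t).1).add (tendsto_slope_shift_sq (F t).2))
    (((tendsto_slope_shift_sq (F 0).1).add (tendsto_slope_shift_sq (F 0).2)).const_mul
      (192 ^ n)) fun h => ?_
  have := mul_le_mul_of_nonneg_left (key h) (sq_nonneg h⁻¹)
  linarith

lemma IsCurve.norm_sq_le (hab : ChargeCondition a b) (hm : 0 ≤ m)
    (hκa : coeffSum a * C ≤ 1 / 100) (hκb : coeffSum b * C ≤ 1 / 100)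
    {T₀ : ℝ} (hT₀ : 0 ≤ T₀) (hT₀1 : T₀ ≤ 1) (hmT : m * T₀ ≤ 1 / 10) {n : ℕ} {T : ℝ}
    (hT : 0 ≤ T) (hTn : T ≤ n * T₀) {χ : ℝ → ℝ} (hχ : Continuous χ)
    (hχ' : ∀ t, χ t ∈ Icc (0 : ℝ) 1) {F : ℝ → H1 × H1} (hF : IsCurve a b m T χ F)
    (hC : charge (F 0) ≤ C) {t : ℝ} (ht : t ∈ Icc 0 T) :
    ‖F t‖ ^ 2 ≤ C + 192 ^ n * (2 * ‖F 0‖ ^ 2) := by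
  have h1 := hF.deriv_sq_le hab hm hκa hκb hT₀ hT₀1 hmT hT hTn hχ hχ' hC ht
  have h2 : charge (F t) ≤ C := (hF.charge_eq hab ht).le.trans hC
  unfold charge at h2
  have h3 : ‖(F 0).1.deriv‖ ^ 2 + ‖(F 0).2.deriv‖ ^ 2 ≤ 2 * ‖F 0‖ ^ 2 := by
    have e1 := pow_le_pow_left₀ (norm_nonneg _)
      (((F 0).1.norm_deriv_le).trans (norm_fst_le (F 0))) 2
    have e2 := pow_le_pow_left₀ (norm_nonneg _)
      (((F 0).2.norm_deriv_le).trans (norm_snd_le (F 0))) 2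
    linarith
  have h4 : (192 : ℝ) ^ n * (‖(F 0).1.deriv‖ ^ 2 + ‖(F 0).2.deriv‖ ^ 2) ≤
      192 ^ n * (2 * ‖F 0‖ ^ 2) := mul_le_mul_of_nonneg_left h3 (by positivity)
  have hn : ‖F t‖ ^ 2 ≤ ‖(F t).1.toL2‖ ^ 2 + ‖(F t).2.toL2‖ ^ 2 +
      (‖(F t).1.deriv‖ ^ 2 + ‖(F t).2.deriv‖ ^ 2) := by
    have p1 := sq_nonneg ‖(F t).1.toL2‖
    have p2 := sq_nonneg ‖(F t).2.toL2‖
    have p3 := sq_nonneg ‖(F t).1.deriv‖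
    have p4 := sq_nonneg ‖(F t).2.deriv‖
    rw [Prod.norm_def, H1.norm_eq, H1.norm_eq]
    rcases max_choice (max ‖(F t).1.toL2‖ ‖(F t).1.deriv‖)
      (max ‖(F t).2.toL2‖ ‖(F t).2.deriv‖) with e | e <;> rw [e]
    · rcases max_choice ‖(F t).1.toL2‖ ‖(F t).1.deriv‖ with e | e <;> rw [e] <;> linarith
    · rcases max_choice ‖(F t).2.toL2‖ ‖(F t).2.deriv‖ with e | e <;> rw [e] <;> linarith
  linarith

/-- Existence on a bounded interval: the cutoff is never active. -/
lemma exists_curve (hab : ChargeCondition a b) (hm : 0 ≤ m)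
    (hκa : coeffSum a * C ≤ 1 / 100) (hκb : coeffSum b * C ≤ 1 / 100) {T : ℝ} (hT : 0 ≤ T)
    {x₀ : H1 × H1} (hC : charge x₀ ≤ C) :
    ∃ F : ℝ → H1 × H1, F 0 = x₀ ∧ IsCurve a b m T (fun _ => 1) F := by
  have hT₀ : (0 : ℝ) < 1 / (10 * (m + 1)) := by positivity
  obtain ⟨n, hn⟩ := exists_nat_ge (T / (1 / (10 * (m + 1))))
  rw [div_le_iff₀ hT₀] at hn
  -- The a priori bound controls `‖F t‖²` independently of the truncation radius. Adding 1 yields a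
  -- radius via `y ≤ 1 + y²`.
  set B := 1 + (C + 192 ^ n * (2 * ‖x₀‖ ^ 2))
  obtain ⟨F, hF0, hFc, hFd⟩ := (bddLip_field a b m).exists_truncated_solution B hT x₀
  -- Evaluated along the solution, the cutoff is a continuous function of time with values in
  -- `[0,1]`, hence an admissible damping.
  have hF : IsCurve a b m T (fun t => cutoff B ‖F t‖) F := ⟨hFc, hFd⟩
  refine ⟨F, hF0, hFc, fun t ht => ?_⟩
  have := hF.norm_sq_le hab hm hκa hκb hT₀.le (by
      rw [div_le_one (by positivity)]; linarith) (by
      rw [mul_one_div, div_le_div_iff₀ (by positivity) (by norm_num)]; linarith) hT hn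
    ((continuous_cutoff B).comp hFc.norm) (fun t => cutoff_mem B _) (by rwa [hF0])
    (Ioo_subset_Icc_self ht)
  rw [hF0] at this
  have hB : ‖F t‖ ≤ B := by nlinarith [sq_nonneg (‖F t‖ - 1)]
  have h := hFd t ht
  rwa [cutoff_eq_one hB] at h

/-- A global solution curve. -/
def IsGlobalCurve (a b : Fin 2 → Fin 3 → ℂ) (m : ℝ) (F : ℝ → H1 × H1) : Prop :=
  Continuous F ∧ ∀ t, 0 < t → HasDerivAt F (field a b m t (F t)) t

lemma IsGlobalCurve.isCurve {F : ℝ → H1 × H1} (h : IsGlobalCurve a b m F) (T : ℝ) :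
    IsCurve a b m T (fun _ => 1) F :=
  ⟨h.1, fun t ht => by rw [one_smul]; exact h.2 t ht.1⟩

lemma IsGlobalCurve.unique {F G : ℝ → H1 × H1} (h : IsGlobalCurve a b m F)
    (h' : IsGlobalCurve a b m G) (h0 : F 0 = G 0) {t : ℝ} (ht : 0 ≤ t) : F t = G t :=
  (bddLip_field a b m).unique h.1 (fun t ht => h.2 t ht.1) h'.1 (fun t ht => h'.2 t ht.1) h0
    ⟨ht, le_rfl⟩

lemma exists_globalCurve (hab : ChargeCondition a b) (hm : 0 ≤ m)
    (hκa : coeffSum a * C ≤ 1 / 100) (hκb : coeffSum b * C ≤ 1 / 100)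
    {x₀ : H1 × H1} (hC : charge x₀ ≤ C) :
    ∃ F : ℝ → H1 × H1, F 0 = x₀ ∧ IsGlobalCurve a b m F := by
  have hex : ∀ n : ℕ, ∃ F : ℝ → H1 × H1, F 0 = x₀ ∧ IsCurve a b m (n + 1) (fun _ => 1) F :=
    fun n => exists_curve hab hm hκa hκb (by positivity) hC
  choose G hG0 hG using hex
  have hGd : ∀ n : ℕ, ∀ t ∈ Ioo (0 : ℝ) (n + 1), HasDerivAt (G n) (field a b m t (G n t)) t :=
    fun n t ht => by simpa only [one_smul] using (hG n).2 t ht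
  -- The solution on `[0, n+1]` is used for `t` in `[n, n+1)`, so the chosen time is always strictly
  -- below the right endpoint. Uniqueness makes the pieces agree, and `max t 0` freezes the curve at
  -- negative times.
  set F : ℝ → H1 × H1 := fun t => G ⌊t⌋₊ (max t 0)
  have hFG : ∀ (n : ℕ) (t : ℝ), t < n + 1 → F t = G n (max t 0) := by
    intro n t ht
    rcases le_total t 0 with h | h
    · simp only [F, max_eq_right h, hG0]
    · have hle : ⌊t⌋₊ ≤ n := Nat.lt_succ_iff.1 ((Nat.floor_lt h).2 (by exact_mod_cast ht))
      have hle' : ((⌊t⌋₊ : ℕ) : ℝ) + 1 ≤ n + 1 := by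
        have : ((⌊t⌋₊ : ℕ) : ℝ) ≤ n := by exact_mod_cast hle
        linarith
      have := (bddLip_field a b m).unique (T := (⌊t⌋₊ : ℕ) + 1) (hG ⌊t⌋₊).1 (hGd _) (hG n).1
        (fun s hs => hGd n s ⟨hs.1, hs.2.trans_le hle'⟩) (by rw [hG0, hG0])
      simp only [F, max_eq_left h]
      exact this ⟨h, (Nat.lt_floor_add_one t).le⟩
  have hev : ∀ t : ℝ, F =ᶠ[𝓝 t] fun s => G ⌊t⌋₊ (max s 0) := by
    intro t
    filter_upwards [Iio_mem_nhds (Nat.lt_floor_add_one t)] with s hs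
    exact hFG _ s hs
  refine ⟨F, by simp [F, hG0], ?_, fun t ht => ?_⟩
  · rw [continuous_iff_continuousAt]
    intro t
    refine ContinuousAt.congr ?_ (hev t).symm
    exact ((hG _).1.comp (continuous_id.max continuous_const)).continuousAt
  · have e : F =ᶠ[𝓝 t] G ⌊t⌋₊ := by
      filter_upwards [hev t, Ioi_mem_nhds ht] with s hs hs0
      rw [hs, max_eq_left (le_of_lt hs0)]
    rw [e.eq_of_nhds]
    exact (hGd _ t ⟨ht, Nat.lt_floor_add_one t⟩).congr_of_eventuallyEq e

end Apriori

/-! ### Classical solutions and solution curves -/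

lemma shift_real_smul (h r : ℝ) (f : L2) : shift h (r • f) = r • shift h f :=
  (shift h).toLinearMap.map_smul_of_tower r f

/-- Translations are not continuous in operator norm. Isometry reduces the moving function to its
limit, and strong continuity handles the moving shift. -/
lemma tendsto_shift {α : Type*} {l : Filter α} {h : α → ℝ} {f : α → L2} {h₀ : ℝ} {f₀ : L2}
    (hh : Tendsto h l (𝓝 h₀)) (hf : Tendsto f l (𝓝 f₀)) :
    Tendsto (fun x => shift (h x) (f x)) l (𝓝 (shift h₀ f₀)) := by
  have hc : Continuous fun r => shift r f₀ := continuous_shift_comp continuous_id continuous_const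
  have h1 : Tendsto (fun x => ‖f x - f₀‖ + ‖shift (h x) f₀ - shift h₀ f₀‖) l (𝓝 (0 + 0)) :=
    (tendsto_iff_norm_sub_tendsto_zero.1 hf).add
      (tendsto_iff_norm_sub_tendsto_zero.1 ((hc.tendsto h₀).comp hh))
  rw [add_zero] at h1
  refine tendsto_iff_norm_sub_tendsto_zero.2
    (squeeze_zero (fun _ => norm_nonneg _) (fun x => ?_) h1)
  rw [← (shift (h x)).norm_map (f x - f₀), map_sub]
  exact norm_sub_le_norm_sub_add_norm_sub _ _ _

/-- A product rule for passing between physical and characteristic coordinates. The slope splits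
into a shifted slope of `f` and the slope of the translation acting on the fixed function `f t`. -/
lemma hasDerivWithinAt_shift_comp (c : ℝ) {f : ℝ → L2} {f' fx : L2} {s : Set ℝ} {t : ℝ}
    (hf : HasDerivWithinAt f f' s t) (hw : IsWeakDeriv (f t) fx) :
    HasDerivWithinAt (fun τ => shift (c * τ) (f τ))
      (shift (c * t) f' + c • shift (c * t) fx) s t := by
  have h1 : HasDerivWithinAt (fun τ => shift (c * τ) (f t)) (c • shift (c * t) fx) s t := by
    have h := (hw.hasDerivAt_shift (c * t)).scomp t ((hasDerivAt_id t).const_mul c)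
    rw [mul_one] at h
    exact h.hasDerivWithinAt
  rw [hasDerivWithinAt_iff_tendsto_slope] at h1 hf ⊢
  have h2 : Tendsto (fun τ => shift (c * τ) (slope f t τ)) (𝓝[s \ {t}] t)
      (𝓝 (shift (c * t) f')) := by
    have hc : Tendsto (fun τ => c * τ) (𝓝[s \ {t}] t) (𝓝 (c * t)) :=
      ((continuous_const.mul continuous_id).tendsto t).mono_left nhdsWithin_le_nhds
    exact tendsto_shift hc hf
  refine (h2.add h1).congr fun τ => ?_
  rw [slope_def_module, slope_def_module, slope_def_module, shift_real_smul, map_sub, ← smul_add,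
    sub_add_sub_cancel]

/-- A derivative known in the weaker space is upgraded to the stronger one: the integrated equation
holds after `A`, hence before it by injectivity, and can then be differentiated. For classical
solutions, the `L²` derivative thereby becomes an `H¹` derivative in characteristic coordinates. -/
lemma hasDerivAt_of_injective {E G : Type*} [NormedAddCommGroup E] [NormedSpace ℝ E]
    [CompleteSpace E] [NormedAddCommGroup G] [NormedSpace ℝ G] [CompleteSpace G]
    (A : E →L[ℝ] G) (hA : Function.Injective A) {P Φ : ℝ → E} (hP : Continuous P)
    (hΦ : Continuous Φ) (h : ∀ t, 0 < t → HasDerivAt (fun t => A (P t)) (A (Φ t)) t) {t : ℝ}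
    (ht : 0 < t) : HasDerivAt P (Φ t) t := by
  have key : ∀ s, 0 ≤ s → P s = P 0 + ∫ r in (0 : ℝ)..s, Φ r := by
    intro s hs
    apply hA
    rw [map_add, ← A.intervalIntegral_comp_comm (hΦ.intervalIntegrable _ _),
      intervalIntegral.integral_eq_sub_of_hasDerivAt_of_le hs
        (f := fun r => A (P r)) (A.continuous.comp hP).continuousOn
        (fun r hr => h r hr.1) ((A.continuous.comp hΦ).intervalIntegrable _ _), add_sub_cancel]
  have hd : HasDerivAt (fun s => P 0 + ∫ r in (0 : ℝ)..s, Φ r) (Φ t) t :=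
    (intervalIntegral.integral_hasDerivAt_right (hΦ.intervalIntegrable 0 t)
      (hΦ.stronglyMeasurableAtFilter _ _) hΦ.continuousAt).const_add (P 0)
  refine hd.congr_of_eventuallyEq ?_
  filter_upwards [Ioi_mem_nhds ht] with s hs
  exact key s (le_of_lt hs)

lemma BddLip.continuous_comp {E G : Type*} [NormedAddCommGroup E] [NormedAddCommGroup G]
    {A : ℝ → E → G} (h : BddLip A) {F : ℝ → E} (hF : Continuous F) :
    Continuous fun t => A t (F t) :=
  h.1.comp (continuous_id.prodMk hF)

section

variable {a b : Fin 2 → Fin 3 → ℂ} {m : ℝ}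

lemma IsGlobalCurve.hasDerivWithinAt {F : ℝ → H1 × H1} (h : IsGlobalCurve a b m F) {t : ℝ}
    (ht : 0 ≤ t) : HasDerivWithinAt F (field a b m t (F t)) (Ici 0) t := by
  rcases ht.eq_or_lt with rfl | h0
  · exact (bddLip_field a b m).hasDerivWithinAt_Ici (T := 1) h.1 (fun t ht => h.2 t ht.1) (by simp)
  · exact (h.2 t h0).hasDerivWithinAt

/-- The first component in the original coordinates. -/
def IsGlobalCurve.fst (F : ℝ → H1 × H1) (t : ℝ) : L2 := shift (-t) (F t).1.toL2

/-- The second component in the original coordinates. -/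
def IsGlobalCurve.snd (F : ℝ → H1 × H1) (t : ℝ) : L2 := shift t (F t).2.toL2

lemma coeFn_shift_toL2 (h : ℝ) (p : H1) :
    shift h p.toL2 =ᵐ[volume] fun x => H1.ev (x + h) p := by
  filter_upwards [coeFn_shift h p.toL2, ae_comp_add_right p.coeFn_ae_eq h] with x h1 h2
  rw [h1, h2]

lemma IsGlobalCurve.continuous_fst {F : ℝ → H1 × H1} (h : Continuous F) :
    Continuous (IsGlobalCurve.fst F) :=
  continuous_shift_comp continuous_neg (H1.toL2.continuous.comp (_root_.continuous_fst.comp h))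

lemma IsGlobalCurve.continuous_snd {F : ℝ → H1 × H1} (h : Continuous F) :
    Continuous (IsGlobalCurve.snd F) :=
  continuous_shift_comp continuous_id (H1.toL2.continuous.comp (_root_.continuous_snd.comp h))

lemma IsGlobalCurve.isClassicalSolution {F : ℝ → H1 × H1} (h : IsGlobalCurve a b m F) :
    IsClassicalSolution a b m (F 0).1.toL2 (F 0).2.toL2 (fst F) (snd F) := by
  have c1 : Continuous fun t => (F t).1 := _root_.continuous_fst.comp h.1
  have c2 : Continuous fun t => (F t).2 := _root_.continuous_snd.comp h.1
  have cf : Continuous fun t => field a b m t (F t) :=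
    (bddLip_field a b m).continuous_comp h.1
  have cux : Continuous fun t => shift (-t) (F t).1.deriv :=
    continuous_shift_comp continuous_neg (H1.deriv.continuous.comp c1)
  have cvx : Continuous fun t => shift t (F t).2.deriv :=
    continuous_shift_comp continuous_id (H1.deriv.continuous.comp c2)
  have cut : Continuous fun t => shift (-t) (field a b m t (F t)).1.toL2 :=
    continuous_shift_comp continuous_neg
      (H1.toL2.continuous.comp (_root_.continuous_fst.comp cf))
  have cvt : Continuous fun t => shift t (field a b m t (F t)).2.toL2 :=
    continuous_shift_comp continuous_id
      (H1.toL2.continuous.comp (_root_.continuous_snd.comp cf))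
  refine ⟨by simp [fst], by simp [snd], (continuous_fst h.1).continuousOn,
    (continuous_snd h.1).continuousOn, fun t => shift (-t) (F t).1.deriv,
    fun t => shift t (F t).2.deriv,
    fun t => shift (-t) (field a b m t (F t)).1.toL2 - shift (-t) (F t).1.deriv,
    fun t => shift t (field a b m t (F t)).2.toL2 + shift t (F t).2.deriv,
    cux.continuousOn, cvx.continuousOn, (cut.sub cux).continuousOn, (cvt.add cvx).continuousOn,
    fun t ht => ⟨?_, ?_, ?_, ?_, ?_, ?_⟩⟩
  · exact IsWeakDeriv.shift (f := (F t).1.toL2) (g := (F t).1.deriv) (F t).1.isWeakDeriv (-t)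
  · exact IsWeakDeriv.shift (f := (F t).2.toL2) (g := (F t).2.deriv) (F t).2.isWeakDeriv t
  · have h1 := ((H1.toL2.comp (ContinuousLinearMap.fst ℂ H1 H1)).restrictScalars
      ℝ).hasFDerivAt.comp_hasDerivWithinAt t (h.hasDerivWithinAt ht)
    have h2 := hasDerivWithinAt_shift_comp (-1) h1 (F t).1.isWeakDeriv
    simp only [neg_one_mul, neg_one_smul, ← sub_eq_add_neg] at h2
    exact h2
  · have h1 := ((H1.toL2.comp (ContinuousLinearMap.snd ℂ H1 H1)).restrictScalars
      ℝ).hasFDerivAt.comp_hasDerivWithinAt t (h.hasDerivWithinAt ht)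
    have h2 := hasDerivWithinAt_shift_comp 1 h1 (F t).2.isWeakDeriv
    simp only [one_mul, one_smul] at h2
    exact h2
  · filter_upwards [coeFn_shift_toL2 (-t) (field a b m t (F t)).1, coeFn_shift_toL2 (-t) (F t).1,
      coeFn_shift_toL2 t (F t).2,
      Lp.coeFn_sub (shift (-t) (field a b m t (F t)).1.toL2) (shift (-t) (F t).1.deriv)]
      with x h1 h2 h3 h4
    simp only [h4, Pi.sub_apply, sub_add_cancel, h1, fst, snd, h2, h3, ev_field_fst, rhs, N1]
    rw [show x + -t + 2 * t = x + t by ring, ← mul_assoc, mul_neg, Complex.I_mul_I, neg_neg,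
      one_mul]
  · filter_upwards [coeFn_shift_toL2 t (field a b m t (F t)).2, coeFn_shift_toL2 (-t) (F t).1,
      coeFn_shift_toL2 t (F t).2,
      Lp.coeFn_add (shift t (field a b m t (F t)).2.toL2) (shift t (F t).2.deriv)]
      with x h1 h2 h3 h4
    simp only [h4, Pi.add_apply, add_sub_cancel_right, h1, fst, snd, h2, h3, ev_field_snd, rhs, N2]
    rw [show x + t - 2 * t = x + -t by ring, ← mul_assoc, mul_neg, Complex.I_mul_I, neg_neg,
      one_mul]

/-- Undoing the transport removes the derivative terms. The equation in `L²` then has a right-hand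
side continuous in `H¹`, and uniqueness in the original coordinates reduces to uniqueness for the
differential equation. -/
lemma IsClassicalSolution.exists_globalCurve {u₀ v₀ : L2} {u v : ℝ → L2}
    (h : IsClassicalSolution a b m u₀ v₀ u v) :
    ∃ F : ℝ → H1 × H1, IsGlobalCurve a b m F ∧ (F 0).1.toL2 = u₀ ∧ (F 0).2.toL2 = v₀ ∧
      EqOn u (IsGlobalCurve.fst F) (Ici 0) ∧ EqOn v (IsGlobalCurve.snd F) (Ici 0) := by
  obtain ⟨hu0, hv0, cu, cv, ux, vx, ut, vt, cux, cvx, cut, cvt, hh⟩ := h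
  have hpos : ∀ t : ℝ, max t 0 ∈ Ici (0 : ℝ) := fun t => mem_Ici.2 (le_max_right _ _)
  have cm : Continuous fun t : ℝ => max t 0 := continuous_id.max continuous_const
  -- Nothing is known at negative times, so the curve is extended there by its initial value.
  let p : ℝ → H1 := fun t => ⟨(u (max t 0), ux (max t 0)), mem_H1.2 (hh _ (hpos t)).1⟩
  let q : ℝ → H1 := fun t => ⟨(v (max t 0), vx (max t 0)), mem_H1.2 (hh _ (hpos t)).2.1⟩
  have cp : Continuous p := Continuous.subtype_mk
    ((cu.comp_continuous cm hpos).prodMk (cux.comp_continuous cm hpos)) _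
  have cq : Continuous q := Continuous.subtype_mk
    ((cv.comp_continuous cm hpos).prodMk (cvx.comp_continuous cm hpos)) _
  let F : ℝ → H1 × H1 := fun t => (H1.shift t (p t), H1.shift (-t) (q t))
  have cF : Continuous F := (H1.continuous_shift_comp continuous_id cp).prodMk
    (H1.continuous_shift_comp continuous_neg cq)
  have ep : ∀ t, 0 ≤ t → (p t).toL2 = u t ∧ (p t).deriv = ux t := fun t ht => by
    simp only [p, max_eq_left ht]; exact ⟨rfl, rfl⟩
  have eq : ∀ t, 0 ≤ t → (q t).toL2 = v t ∧ (q t).deriv = vx t := fun t ht => by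
    simp only [q, max_eq_left ht]; exact ⟨rfl, rfl⟩
  have eF1 : ∀ t, 0 ≤ t → (F t).1.toL2 = shift t (u t) := fun t ht => by
    rw [← (ep t ht).1]; rfl
  have eF2 : ∀ t, 0 ≤ t → (F t).2.toL2 = shift (-t) (v t) := fun t ht => by
    rw [← (eq t ht).1]; rfl
  have aeu : ∀ t, 0 ≤ t → ∀ x, H1.ev x (F t).1 = H1.ev (x + t) (p t) := fun t _ x =>
    H1.ev_shift x t _
  have aev : ∀ t, 0 ≤ t → ∀ x, H1.ev x (F t).2 = H1.ev (x + -t) (q t) := fun t _ x =>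
    H1.ev_shift x (-t) _
  refine ⟨F, ⟨cF, fun t ht => ?_⟩, ?_, ?_, ?_, ?_⟩
  · let A : H1 × H1 →L[ℝ] L2 × L2 := (H1.toL2.prodMap H1.toL2).restrictScalars ℝ
    have hA : Function.Injective A := Function.Injective.prodMap H1.toL2_injective H1.toL2_injective
    refine hasDerivAt_of_injective A hA cF
      ((bddLip_field a b m).continuous_comp cF) (fun t ht => ?_) ht
    obtain ⟨wu, wv, du, dv, eu, ev⟩ := hh t ht.le
    have d1 := (hasDerivWithinAt_shift_comp 1 du wu).hasDerivAt (Ici_mem_nhds ht)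
    have d2 := (hasDerivWithinAt_shift_comp (-1) dv wv).hasDerivAt (Ici_mem_nhds ht)
    have d := d1.prodMk d2
    have e : (fun t => A (F t)) =ᶠ[𝓝 t] fun t => (shift (1 * t) (u t), shift (-1 * t) (v t)) := by
      filter_upwards [Ioi_mem_nhds ht] with s hs
      rw [one_mul, neg_one_mul, ← eF1 s (le_of_lt hs), ← eF2 s (le_of_lt hs)]
      rfl
    refine HasDerivAt.congr_of_eventuallyEq ?_ e
    refine d.congr_deriv (Prod.ext (Eq.symm ?_) (Eq.symm ?_))
    · change (field a b m t (F t)).1.toL2 = shift (1 * t) (ut t) + (1 : ℝ) • shift (1 * t) (ux t)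
      rw [one_smul, one_mul, ← map_add]
      apply Lp.ext
      filter_upwards [(field a b m t (F t)).1.coeFn_ae_eq, coeFn_shift t (ut t + ux t),
        ae_comp_add_right (Lp.coeFn_add (ut t) (ux t)) t, ae_comp_add_right eu t,
        ae_comp_add_right (p t).coeFn_ae_eq t, ae_comp_add_right (q t).coeFn_ae_eq t]
        with x h1 h2 h3 h4 h5 h6
      rw [h1, h2, h3, Pi.add_apply, ev_field_fst, aeu t ht.le, aev t ht.le, rhs,
        show x + 2 * t + -t = x + t by ring, ← h5, ← h6, (ep t ht.le).1, (eq t ht.le).1]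
      change _ = _ + cubic a _ _ at h4
      rw [← h4, ← mul_assoc, neg_mul, Complex.I_mul_I, neg_neg, one_mul]
    · change (field a b m t (F t)).2.toL2 = shift (-1 * t) (vt t) + (-1 : ℝ) • shift (-1 * t) (vx t)
      rw [neg_one_smul, neg_one_mul, ← sub_eq_add_neg, ← map_sub]
      apply Lp.ext
      filter_upwards [(field a b m t (F t)).2.coeFn_ae_eq, coeFn_shift (-t) (vt t - vx t),
        ae_comp_add_right (Lp.coeFn_sub (vt t) (vx t)) (-t), ae_comp_add_right ev (-t),
        ae_comp_add_right (p t).coeFn_ae_eq (-t), ae_comp_add_right (q t).coeFn_ae_eq (-t)]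
        with x h1 h2 h3 h4 h5 h6
      rw [h1, h2, h3, Pi.sub_apply, ev_field_snd, aeu t ht.le, aev t ht.le, rhs,
        show x - 2 * t + t = x + -t by ring, ← h5, ← h6, (ep t ht.le).1, (eq t ht.le).1]
      change _ = _ + cubic b _ _ at h4
      rw [← h4, ← mul_assoc, neg_mul, Complex.I_mul_I, neg_neg, one_mul]
  · rw [eF1 0 le_rfl, hu0, shift_zero]
  · rw [eF2 0 le_rfl, hv0, neg_zero, shift_zero]
  · intro t ht
    rw [IsGlobalCurve.fst, eF1 t ht, shift_shift, neg_add_cancel, shift_zero]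
  · intro t ht
    rw [IsGlobalCurve.snd, eF2 t ht, shift_shift, add_neg_cancel, shift_zero]

lemma IsClassicalSolution.eqOn {F : ℝ → H1 × H1} (hF : IsGlobalCurve a b m F) {u v : ℝ → L2}
    (h : IsClassicalSolution a b m (F 0).1.toL2 (F 0).2.toL2 u v) :
    EqOn u (IsGlobalCurve.fst F) (Ici 0) ∧ EqOn v (IsGlobalCurve.snd F) (Ici 0) := by
  obtain ⟨G, hG, e1, e2, e3, e4⟩ := h.exists_globalCurve
  have e0 : G 0 = F 0 := Prod.ext (H1.toL2_injective e1) (H1.toL2_injective e2)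
  have hFG : ∀ t, 0 ≤ t → G t = F t := fun t ht => hG.unique hF e0 ht
  exact ⟨fun t ht => (e3 ht).trans (by rw [IsGlobalCurve.fst, IsGlobalCurve.fst, hFG t ht]),
    fun t ht => (e4 ht).trans (by rw [IsGlobalCurve.snd, IsGlobalCurve.snd, hFG t ht])⟩

end

/-! ### Slices of test functions -/

section TestFunctions

variable {ψ : ℝ × ℝ → ℂ}

lemma exists_support_bound (hs : HasCompactSupport ψ) :
    ∃ R : ℝ, 0 ≤ R ∧ ∀ t x, (R < |t| ∨ R < |x|) → ψ (t, x) = 0 := by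
  obtain ⟨R, hR⟩ := hs.isCompact.isBounded.subset_closedBall (0 : ℝ × ℝ)
  refine ⟨max R 0, le_max_right _ _, fun t x h => ?_⟩
  by_contra hne
  have := hR (subset_tsupport _ hne)
  rw [mem_closedBall_zero_iff, Prod.norm_def, max_le_iff, Real.norm_eq_abs,
    Real.norm_eq_abs] at this
  rcases h with h | h
  · exact absurd ((le_max_left R 0).trans_lt h) (not_lt.2 this.1)
  · exact absurd ((le_max_left R 0).trans_lt h) (not_lt.2 this.2)

lemma hasCompactSupport_slice (hs : HasCompactSupport ψ) (t : ℝ) :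
    HasCompactSupport fun x => ψ (t, x) := by
  obtain ⟨R, -, hR⟩ := exists_support_bound hs
  refine HasCompactSupport.of_support_subset_isCompact (isCompact_closedBall (0 : ℝ) R)
    fun x hx => ?_
  rw [mem_closedBall_zero_iff, Real.norm_eq_abs]
  by_contra h
  exact hx (hR t x (Or.inr (not_le.1 h)))

lemma memLp_slice (p : ℝ≥0∞) (hc : Continuous ψ) (hs : HasCompactSupport ψ) (t : ℝ) :
    MemLp (fun x => ψ (t, x)) p :=
  (hc.comp (continuous_const.prodMk continuous_id)).memLp_of_hasCompactSupport
    (hasCompactSupport_slice hs t)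

/-- The slice `ψ(t, ·)` as an element of `Lᵖ`. -/
def slice (p : ℝ≥0∞) (hc : Continuous ψ) (hs : HasCompactSupport ψ) (t : ℝ) :
    Lp ℂ p (volume : Measure ℝ) :=
  (memLp_slice p hc hs t).toLp _

lemma coeFn_slice (p : ℝ≥0∞) (hc : Continuous ψ) (hs : HasCompactSupport ψ) (t : ℝ) :
    slice p hc hs t =ᵐ[volume] fun x => ψ (t, x) := (memLp_slice p hc hs t).coeFn_toLp

/-- Uniform continuity controls differences of slices in sup norm, and their common bounded support
converts this to every `Lᵖ`. The case `p = ⊤` is needed for pairing with the nonlinear term in `L¹`.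
-/
lemma continuous_slice (p : ℝ≥0∞) [Fact (1 ≤ p)] (hc : Continuous ψ) (hs : HasCompactSupport ψ) :
    Continuous (slice p hc hs) := by
  obtain ⟨R, hR0, hR⟩ := exists_support_bound hs
  set V : ℝ≥0∞ := volume (Icc (-R) R) ^ p.toReal⁻¹ with hV
  have hVtop : V ≠ ⊤ := ENNReal.rpow_ne_top_of_nonneg (by positivity) (by simp)
  have bound : ∀ t s ε : ℝ, (∀ x, ‖ψ (t, x) - ψ (s, x)‖ ≤ ε) →
      ‖slice p hc hs t - slice p hc hs s‖ₑ ≤ V * ENNReal.ofReal ε := by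
    intro t s ε h
    rw [slice, slice, ← MemLp.toLp_sub, Lp.enorm_toLp]
    have e : ((fun x => ψ (t, x)) - fun x => ψ (s, x)) =
        (Icc (-R) R).indicator ((fun x => ψ (t, x)) - fun x => ψ (s, x)) := by
      refine (indicator_eq_self.2 fun x hx => ?_).symm
      by_contra hxR
      have hx' : R < |x| := not_le.1 fun h => hxR (abs_le.1 h)
      exact hx (by simp [hR _ x (Or.inr hx')])
    rw [e, eLpNorm_indicator_eq_eLpNorm_restrict measurableSet_Icc]
    refine (eLpNorm_le_of_ae_bound (Eventually.of_forall h)).trans_eq ?_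
    rw [Measure.restrict_apply_univ]
  rw [continuous_iff_continuousAt]
  intro t
  rw [ContinuousAt, tendsto_iff_edist_tendsto_0]
  have hu := hs.uniformContinuous_of_continuous hc
  rw [Metric.uniformContinuous_iff] at hu
  rw [ENNReal.tendsto_nhds_zero]
  intro ε hε
  obtain ⟨δ, hδ, hδε⟩ : ∃ δ : ℝ, 0 < δ ∧ V * ENNReal.ofReal δ ≤ ε := by
    have : Tendsto (fun δ : ℝ => V * ENNReal.ofReal δ) (𝓝[>] 0) (𝓝 0) := by
      have h1 : Tendsto (fun δ : ℝ => V * ENNReal.ofReal δ) (𝓝 0) (𝓝 (V * ENNReal.ofReal 0)) :=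
        ENNReal.Tendsto.const_mul (ENNReal.continuous_ofReal.tendsto 0) (Or.inr hVtop)
      simpa using h1.mono_left nhdsWithin_le_nhds
    obtain ⟨δ, h1, h2⟩ := ((ENNReal.tendsto_nhds_zero.1 this ε hε).and
      (self_mem_nhdsWithin : Ioi (0 : ℝ) ∈ 𝓝[>] 0)).exists
    exact ⟨δ, h2, h1⟩
  obtain ⟨η, hη, hh⟩ := hu δ hδ
  filter_upwards [Metric.ball_mem_nhds t hη] with s hball
  rw [edist_eq_enorm_sub]
  refine (bound s t δ fun x => ?_).trans hδε
  rw [← dist_eq_norm]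
  exact (hh (by rw [Prod.dist_eq]; simpa [hη] using hball)).le

/-- The bilinear pairing of `Lᵖ` and `Lᵠ`. -/
def dual (p q : ℝ≥0∞) [Fact (1 ≤ p)] [Fact (1 ≤ q)] [p.HolderConjugate q] :
    Lp ℂ p (volume : Measure ℝ) →L[ℂ] Lp ℂ q (volume : Measure ℝ) →L[ℂ] ℂ :=
  ContinuousLinearMap.lpPairing volume p q (ContinuousLinearMap.mul ℂ ℂ)

lemma dual_slice {p q : ℝ≥0∞} [Fact (1 ≤ p)] [Fact (1 ≤ q)] [p.HolderConjugate q]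
    (hc : Continuous ψ) (hs : HasCompactSupport ψ) (f : Lp ℂ p (volume : Measure ℝ)) (t : ℝ) :
    dual p q f (slice q hc hs t) = ∫ x, f x * ψ (t, x) := by
  rw [dual, ContinuousLinearMap.lpPairing_eq_integral]
  apply integral_congr_ae
  filter_upwards [coeFn_slice q hc hs t] with x hx
  rw [hx, ContinuousLinearMap.mul_apply']

lemma integrable_mul_slice {p q : ℝ≥0∞} [Fact (1 ≤ p)] [Fact (1 ≤ q)] [p.HolderConjugate q]
    (hc : Continuous ψ) (hs : HasCompactSupport ψ) (f : Lp ℂ p (volume : Measure ℝ)) (t : ℝ) :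
    Integrable fun x => f x * ψ (t, x) :=
  (Lp.memLp f).integrable_mul (memLp_slice q hc hs t)

end TestFunctions

/-! ### The weak form of a transport equation -/

section Transport

variable {φ : ℝ × ℝ → ℂ}

lemma continuous_fderiv_apply (hφ : ContDiff ℝ ∞ φ) (w : ℝ × ℝ) :
    Continuous fun z => fderiv ℝ φ z w :=
  (hφ.continuous_fderiv (by simp)).clm_apply continuous_const

lemma hasCompactSupport_fderiv_apply (hs : HasCompactSupport φ) (w : ℝ × ℝ) :
    HasCompactSupport fun z => fderiv ℝ φ z w := hs.fderiv_apply ℝ w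

/-- In the coordinate `y = x - c t` the transport derivative of `φ` is a plain time derivative.
Fubini reduces the claim to the fundamental theorem of calculus on each line. -/
lemma transport_weak_form {f r : ℝ → ℝ → ℂ} (hf : Continuous (Function.uncurry f))
    (hr : Continuous (Function.uncurry r))
    (hd : ∀ t, 0 < t → ∀ y, HasDerivAt (fun t => f t y) (r t y) t) (c : ℝ)
    (hφ : ContDiff ℝ ∞ φ) (hs : HasCompactSupport φ) :
    -(∫ x, f 0 x * φ (0, x)) -
        ∫ t in Ioi (0 : ℝ), ∫ x, f t (x - c * t) * fderiv ℝ φ (t, x) (1, c) =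
      ∫ t in Ioi (0 : ℝ), ∫ x, r t (x - c * t) * φ (t, x) := by
  let e : ℝ × ℝ → ℝ × ℝ := fun z => (z.1, z.2 + c * z.1)
  have he : Continuous e := by fun_prop
  let eh : ℝ × ℝ ≃ₜ ℝ × ℝ :=
    { toFun := e, invFun := fun z => (z.1, z.2 - c * z.1)
      left_inv := fun z => by simp [e]
      right_inv := fun z => by simp [e] }
  set D1 : ℝ × ℝ → ℂ := fun z => f z.1 z.2 * fderiv ℝ φ (e z) (1, c)
  set D2 : ℝ × ℝ → ℂ := fun z => r z.1 z.2 * φ (e z)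
  have c1 : Continuous D1 := hf.mul ((continuous_fderiv_apply hφ _).comp he)
  have c2 : Continuous D2 := hr.mul (hφ.continuous.comp he)
  have s1 : HasCompactSupport D1 :=
    ((hasCompactSupport_fderiv_apply hs (1, c)).comp_homeomorph eh).mul_left
  have s2 : HasCompactSupport D2 := (hs.comp_homeomorph eh).mul_left
  have i1 : Integrable D1 ((volume.restrict (Ioi 0)).prod volume) :=
    c1.integrable_of_hasCompactSupport s1
  have i2 : Integrable D2 ((volume.restrict (Ioi 0)).prod volume) :=
    c2.integrable_of_hasCompactSupport s2
  have h1 : ∫ t in Ioi (0 : ℝ), ∫ x, f t (x - c * t) * fderiv ℝ φ (t, x) (1, c) =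
      ∫ t in Ioi (0 : ℝ), ∫ y, D1 (t, y) := by
    congr 1; ext t
    rw [← integral_add_right_eq_self _ (c * t)]
    simp [D1, e]
  have h2 : ∫ t in Ioi (0 : ℝ), ∫ x, r t (x - c * t) * φ (t, x) =
      ∫ t in Ioi (0 : ℝ), ∫ y, D2 (t, y) := by
    congr 1; ext t
    rw [← integral_add_right_eq_self _ (c * t)]
    simp [D2, e]
  rw [h1, h2, sub_eq_iff_eq_add, ← integral_add i2.integral_prod_left i1.integral_prod_left]
  have h3 : ∫ t in Ioi (0 : ℝ), ((∫ y, D2 (t, y)) + ∫ y, D1 (t, y)) =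
      ∫ t in Ioi (0 : ℝ), ∫ y, (D2 (t, y) + D1 (t, y)) := by
    congr 1; ext t
    rw [integral_add]
    · exact (c2.comp (continuous_const.prodMk continuous_id)).integrable_of_hasCompactSupport
        (hasCompactSupport_slice s2 t)
    · exact (c1.comp (continuous_const.prodMk continuous_id)).integrable_of_hasCompactSupport
        (hasCompactSupport_slice s1 t)
  rw [h3, integral_integral_swap (f := fun t y => D2 (t, y) + D1 (t, y)) (i2.add i1),
    ← integral_neg]
  congr 1; ext y
  obtain ⟨R, hR0, hR⟩ := exists_support_bound (hs.comp_homeomorph eh)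
  -- The two space-time integrands together are the time derivative of `f φ` at fixed `y`. Compact
  -- support removes the value at infinity and leaves the initial term.
  have hderiv : ∀ t ∈ Ioi (0 : ℝ), HasDerivAt (fun t => f t y * φ (e (t, y)))
      (D2 (t, y) + D1 (t, y)) t := by
    intro t ht
    have hφd : HasDerivAt (fun t => φ (e (t, y))) (fderiv ℝ φ (e (t, y)) (1, c)) t := by
      have h4 : HasDerivAt (fun t => e (t, y)) (1, c) t :=
        (hasDerivAt_id t).prodMk (by
          simpa using ((hasDerivAt_id t).const_mul c).const_add y)
      exact ((hφ.differentiable (by simp)).differentiableAt.hasFDerivAt).comp_hasDerivAt t h4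
    exact (hd t ht y).mul hφd
  have hcont : Continuous fun t => f t y * φ (e (t, y)) :=
    (hf.comp (continuous_id.prodMk continuous_const)).mul
      (hφ.continuous.comp (he.comp (continuous_id.prodMk continuous_const)))
  have hc' : Continuous fun t => D2 (t, y) + D1 (t, y) :=
    (c2.add c1).comp (continuous_id.prodMk continuous_const)
  have hzero : ∀ᶠ t in atTop, f t y * φ (e (t, y)) = 0 := by
    filter_upwards [Ioi_mem_atTop R] with t ht
    rw [show φ (e (t, y)) = 0 from hR t y (Or.inl (lt_of_lt_of_le ht (le_abs_self t))), mul_zero]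
  have hint : IntegrableOn (fun t => D2 (t, y) + D1 (t, y)) (Ioi 0) := by
    have hcs : HasCompactSupport fun t => D2 (t, y) + D1 (t, y) := by
      obtain ⟨R', -, hR'⟩ := exists_support_bound (s2.add s1)
      refine HasCompactSupport.of_support_subset_isCompact (isCompact_closedBall (0 : ℝ) R')
        fun t ht => ?_
      rw [mem_closedBall_zero_iff, Real.norm_eq_abs]
      by_contra h
      exact ht (hR' t y (Or.inl (not_le.1 h)))
    exact hc'.integrable_of_hasCompactSupport hcs
  have := integral_Ioi_of_hasDerivAt_of_tendsto hcont.continuousWithinAt hderiv hint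
    (tendsto_const_nhds.congr' (hzero.mono fun t h => h.symm))
  rw [this]
  simp [e]

end Transport

/-! ### Solution curves satisfy the weak equations -/

section

variable {a b : Fin 2 → Fin 3 → ℂ} {m : ℝ}

lemma hasDerivAt_ev {p : ℝ → H1} {p' : H1} {t : ℝ} (h : HasDerivAt p p' t) (y : ℝ) :
    HasDerivAt (fun t => H1.ev y (p t)) (H1.ev y p') t :=
  ((H1.evL y).restrictScalars ℝ).hasFDerivAt.comp_hasDerivAt t h

lemma hasDerivAt_prod_fst {E G : Type*} [NormedAddCommGroup E] [NormedSpace ℝ E]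
    [NormedAddCommGroup G] [NormedSpace ℝ G] {P : ℝ → E × G} {P' : E × G} {t : ℝ}
    (h : HasDerivAt P P' t) : HasDerivAt (fun t => (P t).1) P'.1 t :=
  (ContinuousLinearMap.fst ℝ E G).hasFDerivAt.comp_hasDerivAt t h

lemma hasDerivAt_prod_snd {E G : Type*} [NormedAddCommGroup E] [NormedSpace ℝ E]
    [NormedAddCommGroup G] [NormedSpace ℝ G] {P : ℝ → E × G} {P' : E × G} {t : ℝ}
    (h : HasDerivAt P P' t) : HasDerivAt (fun t => (P t).2) P'.2 t :=
  (ContinuousLinearMap.snd ℝ E G).hasFDerivAt.comp_hasDerivAt t h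

lemma IsGlobalCurve.weak_form {F : ℝ → H1 × H1} (h : IsGlobalCurve a b m F) {φ : ℝ × ℝ → ℂ}
    (hφ : ContDiff ℝ ∞ φ) (hs : HasCompactSupport φ) :
    (-Complex.I * (∫ x, (F 0).1.toL2 x * φ (0, x))
        - Complex.I * (∫ t in Ioi (0 : ℝ), ∫ x, fst F t x * fderiv ℝ φ (t, x) (1, 1))
      = ∫ t in Ioi (0 : ℝ), ∫ x,
        (-(m : ℂ) * snd F t x + N1 a (fst F t x) (snd F t x)) * φ (t, x)) ∧
    (-Complex.I * (∫ x, (F 0).2.toL2 x * φ (0, x))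
        - Complex.I * (∫ t in Ioi (0 : ℝ), ∫ x, snd F t x * fderiv ℝ φ (t, x) (1, -1))
      = ∫ t in Ioi (0 : ℝ), ∫ x,
        (-(m : ℂ) * fst F t x + N2 b (fst F t x) (snd F t x)) * φ (t, x)) := by
  have c1 : Continuous fun z : ℝ × ℝ => (F z.1).1 :=
    _root_.continuous_fst.comp (h.1.comp _root_.continuous_fst)
  have c2 : Continuous fun z : ℝ × ℝ => (F z.1).2 :=
    _root_.continuous_snd.comp (h.1.comp _root_.continuous_fst)
  have cf : Continuous fun t => field a b m t (F t) := (bddLip_field a b m).continuous_comp h.1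
  have aef : ∀ t, fst F t =ᵐ[volume] fun x => H1.ev (x - 1 * t) (F t).1 := fun t => by
    simpa only [one_mul, sub_eq_add_neg, fst] using coeFn_shift_toL2 (-t) (F t).1
  have aeg : ∀ t, snd F t =ᵐ[volume] fun x => H1.ev (x - -1 * t) (F t).2 := fun t => by
    simpa only [neg_one_mul, sub_neg_eq_add, snd] using coeFn_shift_toL2 t (F t).2
  constructor
  · have key := transport_weak_form (f := fun t y => H1.ev y (F t).1)
      (r := fun t y => H1.ev y (field a b m t (F t)).1)
      (H1.continuous_ev_comp _root_.continuous_snd c1)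
      (H1.continuous_ev_comp _root_.continuous_snd
        (_root_.continuous_fst.comp (cf.comp _root_.continuous_fst)))
      (fun t ht y => hasDerivAt_ev (hasDerivAt_prod_fst (h.2 t ht)) y) 1 hφ hs
    have e1 : ∫ x, (F 0).1.toL2 x * φ (0, x) = ∫ x, H1.ev x (F 0).1 * φ (0, x) :=
      integral_congr_ae ((F 0).1.coeFn_ae_eq.mono fun x hx => by simp only [hx])
    have e2 : ∫ t in Ioi (0 : ℝ), ∫ x, fst F t x * fderiv ℝ φ (t, x) (1, 1) =
        ∫ t in Ioi (0 : ℝ), ∫ x, H1.ev (x - 1 * t) (F t).1 * fderiv ℝ φ (t, x) (1, 1) := by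
      congr 1; ext t
      exact integral_congr_ae ((aef t).mono fun x hx => by simp only [hx])
    have e3 : ∫ t in Ioi (0 : ℝ), ∫ x,
        (-(m : ℂ) * snd F t x + N1 a (fst F t x) (snd F t x)) * φ (t, x) =
        Complex.I * ∫ t in Ioi (0 : ℝ), ∫ x,
          H1.ev (x - 1 * t) (field a b m t (F t)).1 * φ (t, x) := by
      rw [← integral_const_mul]
      congr 1; ext t
      rw [← integral_const_mul]
      apply integral_congr_ae
      filter_upwards [aef t, aeg t] with x h1 h2
      rw [h1, h2, ev_field_fst, rhs, N1, ← mul_assoc, ← mul_assoc, mul_neg, Complex.I_mul_I,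
        neg_neg, show x - 1 * t + 2 * t = x - -1 * t by ring, one_mul (_ + _)]
    rw [e1, e2, e3, ← key]
    ring
  · have key := transport_weak_form (f := fun t y => H1.ev y (F t).2)
      (r := fun t y => H1.ev y (field a b m t (F t)).2)
      (H1.continuous_ev_comp _root_.continuous_snd c2)
      (H1.continuous_ev_comp _root_.continuous_snd
        (_root_.continuous_snd.comp (cf.comp _root_.continuous_fst)))
      (fun t ht y => hasDerivAt_ev (hasDerivAt_prod_snd (h.2 t ht)) y) (-1) hφ hs
    have e1 : ∫ x, (F 0).2.toL2 x * φ (0, x) = ∫ x, H1.ev x (F 0).2 * φ (0, x) :=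
      integral_congr_ae ((F 0).2.coeFn_ae_eq.mono fun x hx => by simp only [hx])
    have e2 : ∫ t in Ioi (0 : ℝ), ∫ x, snd F t x * fderiv ℝ φ (t, x) (1, -1) =
        ∫ t in Ioi (0 : ℝ), ∫ x, H1.ev (x - -1 * t) (F t).2 * fderiv ℝ φ (t, x) (1, -1) := by
      congr 1; ext t
      exact integral_congr_ae ((aeg t).mono fun x hx => by simp only [hx])
    have e3 : ∫ t in Ioi (0 : ℝ), ∫ x,
        (-(m : ℂ) * fst F t x + N2 b (fst F t x) (snd F t x)) * φ (t, x) =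
        Complex.I * ∫ t in Ioi (0 : ℝ), ∫ x,
          H1.ev (x - -1 * t) (field a b m t (F t)).2 * φ (t, x) := by
      rw [← integral_const_mul]
      congr 1; ext t
      rw [← integral_const_mul]
      apply integral_congr_ae
      filter_upwards [aef t, aeg t] with x h1 h2
      rw [h1, h2, ev_field_snd, rhs, N2, ← mul_assoc, ← mul_assoc, mul_neg, Complex.I_mul_I,
        neg_neg, show x - -1 * t - 2 * t = x - 1 * t by ring, one_mul (_ + _)]
    rw [e1, e2, e3, ← key]
    ring

end

/-! ### The nonlinearity as a curve in `L¹` -/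

/-- The product `L² × L² → L¹`. -/
def mulL1 : L2 →L[ℂ] L2 →L[ℂ] L1 :=
  (ContinuousLinearMap.mul ℂ ℂ).holderL (volume : Measure ℝ) 2 2 1

lemma coeFn_mulL1 (f g : L2) : mulL1 f g =ᵐ[volume] fun x => f x * g x :=
  (ContinuousLinearMap.mul ℂ ℂ).coeFn_holder f g

lemma coeFn_linear (c d : ℂ) (f : L2) :
    (c • f + d • conjL2 f : L2) =ᵐ[volume] fun x => c * f x + d * conj (f x) := by
  filter_upwards [Lp.coeFn_add (c • f) (d • conjL2 f), Lp.coeFn_smul c f,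
    Lp.coeFn_smul d (conjL2 f), coeFn_conjL2 f] with x h1 h2 h3 h4
  rw [h1, Pi.add_apply, h2, h3, Pi.smul_apply, Pi.smul_apply, h4, smul_eq_mul, smul_eq_mul]

/-- The cubic nonlinearity `L² × H¹ → L¹`. -/
def cubicL1 (a : Fin 2 → Fin 3 → ℂ) (f : L2) (q : H1) : L1 :=
  mulL1 (a 0 0 • f + a 1 0 • conjL2 f) (H1.mulL q (H1.conjL q)).toL2
    + mulL1 (a 0 1 • f + a 1 1 • conjL2 f) (H1.mulL q q).toL2
    + mulL1 (a 0 2 • f + a 1 2 • conjL2 f) (H1.mulL (H1.conjL q) (H1.conjL q)).toL2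

lemma coeFn_cubicL1 (a : Fin 2 → Fin 3 → ℂ) (f : L2) (q : H1) :
    cubicL1 a f q =ᵐ[volume] fun x => cubic a (f x) (H1.ev x q) := by
  unfold cubicL1
  refine (Lp.coeFn_add _ _).trans ?_
  filter_upwards [Lp.coeFn_add (mulL1 (a 0 0 • f + a 1 0 • conjL2 f) (H1.mulL q (H1.conjL q)).toL2)
      (mulL1 (a 0 1 • f + a 1 1 • conjL2 f) (H1.mulL q q).toL2),
    coeFn_mulL1 (a 0 0 • f + a 1 0 • conjL2 f) (H1.mulL q (H1.conjL q)).toL2,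
    coeFn_mulL1 (a 0 1 • f + a 1 1 • conjL2 f) (H1.mulL q q).toL2,
    coeFn_mulL1 (a 0 2 • f + a 1 2 • conjL2 f) (H1.mulL (H1.conjL q) (H1.conjL q)).toL2,
    coeFn_linear (a 0 0) (a 1 0) f, coeFn_linear (a 0 1) (a 1 1) f, coeFn_linear (a 0 2) (a 1 2) f,
    (H1.mulL q (H1.conjL q)).coeFn_ae_eq, (H1.mulL q q).coeFn_ae_eq,
    (H1.mulL (H1.conjL q) (H1.conjL q)).coeFn_ae_eq] with x h1 h2 h3 h4 h5 h6 h7 h8 h9 h10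
  rw [Pi.add_apply, h1, Pi.add_apply, h2, h3, h4, h5, h6, h7, h8, h9, h10]
  simp only [H1.mulL_apply, H1.ev_mul, H1.ev_conjL, cubic,
    Complex.mul_conj, Complex.normSq_eq_norm_sq]
  ring

/-- Continuity in time makes the nonlinear terms of the approximating solutions strongly measurable
and locally integrable as `L¹`-valued functions. -/
lemma continuous_cubicL1_comp {X : Type*} [TopologicalSpace X] (a : Fin 2 → Fin 3 → ℂ) {f : X → L2}
    {q : X → H1} (hf : Continuous f) (hq : Continuous q) :
    Continuous fun x => cubicL1 a (f x) (q x) := by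
  have hl : ∀ c d : ℂ, Continuous fun x => c • f x + d • conjL2 (f x) := fun c d =>
    (hf.const_smul c).add ((conjL2.continuous.comp hf).const_smul d)
  have hqc : Continuous fun x => H1.conjL (q x) := H1.conjL.continuous.comp hq
  have hm : ∀ {p r : X → H1}, Continuous p → Continuous r →
      Continuous fun x => (H1.mulL (p x) (r x)).toL2 := fun hp hr =>
    H1.toL2.continuous.comp ((H1.mulL.continuous.comp hp).clm_apply hr)
  have hM : ∀ {g h : X → L2}, Continuous g → Continuous h →
      Continuous fun x => mulL1 (g x) (h x) := fun hg hh =>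
    (mulL1.continuous.comp hg).clm_apply hh
  exact ((hM (hl _ _) (hm hq hqc)).add (hM (hl _ _) (hm hq hq))).add (hM (hl _ _) (hm hqc hqc))

/-! ### Limits of nonlinear terms -/

lemma exists_subseq_tendsto_ae {α E : Type*} [MeasurableSpace α] {μ : Measure α}
    [NormedAddCommGroup E] {p : ℝ≥0∞} [Fact (1 ≤ p)] {f : ℕ → Lp E p μ} {g : Lp E p μ}
    (h : Tendsto f atTop (𝓝 g)) :
    ∃ σ : ℕ → ℕ, Tendsto σ atTop atTop ∧
      ∀ᵐ x ∂μ, Tendsto (fun i => f (σ i) x) atTop (𝓝 (g x)) := by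
  obtain ⟨σ, h1, h2⟩ := (tendstoInMeasure_of_tendsto_Lp h).exists_seq_tendsto_ae
  exact ⟨σ, h1.tendsto_atTop, h2⟩

/-- Three successive subsequences make the nonlinear terms and both components converge almost
everywhere. Continuity of `N` then identifies the limit, with no growth condition on `N`. -/
lemma ae_eq_of_tendsto {N : ℂ → ℂ → ℂ} (hN : Continuous (Function.uncurry N)) {u v : ℕ → L2}
    {u' v' : L2} {n : ℕ → L1} {n' : L1}
    (hn : ∀ k, n k =ᵐ[volume] fun x => N (u k x) (v k x)) (hu : Tendsto u atTop (𝓝 u'))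
    (hv : Tendsto v atTop (𝓝 v')) {σ : ℕ → ℕ} (hσ : Tendsto σ atTop atTop)
    (hn' : Tendsto (fun i => n (σ i)) atTop (𝓝 n')) :
    n' =ᵐ[volume] fun x => N (u' x) (v' x) := by
  obtain ⟨τ, hτ, h1⟩ := exists_subseq_tendsto_ae hn'
  obtain ⟨ρ, hρ, h2⟩ := exists_subseq_tendsto_ae (hu.comp (hσ.comp hτ))
  obtain ⟨κ, hκ, h3⟩ := exists_subseq_tendsto_ae (hv.comp (hσ.comp (hτ.comp hρ)))
  filter_upwards [h1, h2, h3, ae_all_iff.2 hn] with x e1 e2 e3 e4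
  have l1 := e1.comp (hρ.comp hκ)
  have l2 := (hN.tendsto (u' x, v' x)).comp ((e2.comp hκ).prodMk_nhds e3)
  refine tendsto_nhds_unique l1 (l2.congr fun i => ?_)
  exact (e4 _).symm

lemma exists_L1_limit {E : Type*} [NormedAddCommGroup E] [CompleteSpace E] {μ : Measure ℝ}
    {n : ℕ → ℝ → E} (hn : ∀ k, Integrable (n k) μ)
    (hc : ∀ ε : ℝ≥0∞, 0 < ε → ∃ K, ∀ j, K ≤ j → ∀ k, K ≤ k → ∫⁻ t, ‖n j t - n k t‖ₑ ∂μ < ε) :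
    ∃ w : ℝ → E, Integrable w μ ∧ Tendsto (fun k => ∫⁻ t, ‖n k t - w t‖ₑ ∂μ) atTop (𝓝 0) ∧
      ∃ σ : ℕ → ℕ, Tendsto σ atTop atTop ∧
        ∀ᵐ t ∂μ, Tendsto (fun i => n (σ i) t) atTop (𝓝 (w t)) := by
  have hcs : CauchySeq fun k => (hn k).toL1 (n k) := by
    rw [EMetric.cauchySeq_iff]
    intro ε hε
    obtain ⟨K, hK⟩ := hc ε hε
    refine ⟨K, fun j hj k hk => ?_⟩
    rw [Integrable.edist_toL1_toL1]
    simpa only [edist_eq_enorm_sub] using hK j hj k hk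
  obtain ⟨W, hW⟩ := cauchySeq_tendsto_of_complete hcs
  refine ⟨W, L1.integrable_coeFn W, ?_, ?_⟩
  · rw [tendsto_iff_edist_tendsto_0] at hW
    refine hW.congr fun k => ?_
    rw [L1.edist_def]
    apply lintegral_congr_ae
    filter_upwards [(hn k).coeFn_toL1] with t ht
    rw [ht, edist_eq_enorm_sub]
  · obtain ⟨σ, hσ, h⟩ := exists_subseq_tendsto_ae hW
    refine ⟨σ, hσ, ?_⟩
    filter_upwards [h, ae_all_iff.2 fun k => (hn k).coeFn_toL1] with t h1 h2
    exact h1.congr fun i => h2 _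

/-- Completeness provides a limit of the nonlinear terms on each bounded interval. Convergence of
the components in `L²` identifies it with the nonlinear term of the limit for almost every time. -/
lemma exists_nonlinear_limit {N : ℂ → ℂ → ℂ} (hN : Continuous (Function.uncurry N))
    {u v : ℕ → ℝ → L2} {u' v' : ℝ → L2} {n : ℕ → ℝ → L1} (hn : ∀ k, Continuous (n k))
    (hnN : ∀ k t, n k t =ᵐ[volume] fun x => N (u k t x) (v k t x))
    (hu : ∀ t, 0 ≤ t → Tendsto (fun k => u k t) atTop (𝓝 (u' t)))
    (hv : ∀ t, 0 ≤ t → Tendsto (fun k => v k t) atTop (𝓝 (v' t)))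
    (hc : ∀ T : ℝ, 0 ≤ T → ∀ ε : ℝ≥0∞, 0 < ε → ∃ K, ∀ j, K ≤ j → ∀ k, K ≤ k →
      ∫⁻ t in Ioc 0 T, ‖n j t - n k t‖ₑ < ε) :
    ∃ n' : ℝ → L1, (∀ T, IntegrableOn n' (Ioc 0 T)) ∧
      (∀ᵐ t ∂(volume.restrict (Ioi (0 : ℝ))), n' t =ᵐ[volume] fun x => N (u' t x) (v' t x)) ∧
      ∀ T, 0 ≤ T → Tendsto (fun k => ∫⁻ t in Ioc 0 T, ‖n k t - n' t‖ₑ) atTop (𝓝 0) := by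
  classical
  -- The limit is prescribed directly from `u'` and `v'`, with value 0 where the expression is not
  -- integrable. One function thus serves all `T`, and limits on different intervals need not be
  -- glued.
  let n' : ℝ → L1 := fun t => if h : MemLp (fun x => N (u' t x) (v' t x)) 1 then h.toLp _ else 0
  have key : ∀ {t : ℝ} {w : L1}, w =ᵐ[volume] (fun x => N (u' t x) (v' t x)) → n' t = w := by
    intro t w hw
    have hm : MemLp (fun x => N (u' t x) (v' t x)) 1 := (memLp_congr_ae hw).1 (Lp.memLp w)
    simp only [n', dif_pos hm]
    exact Lp.ext (hm.coeFn_toLp.trans hw.symm)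
  have step : ∀ T : ℝ, 0 ≤ T → IntegrableOn n' (Ioc 0 T) ∧
      (∀ᵐ t ∂(volume.restrict (Ioc 0 T)), n' t =ᵐ[volume] fun x => N (u' t x) (v' t x)) ∧
      Tendsto (fun k => ∫⁻ t in Ioc 0 T, ‖n k t - n' t‖ₑ) atTop (𝓝 0) := by
    intro T hT
    have hi : ∀ k, Integrable (n k) (volume.restrict (Ioc 0 T)) := fun k => (hn k).integrableOn_Ioc
    obtain ⟨w, hw, hwt, σ, hσ, hae⟩ := exists_L1_limit hi (hc T hT)
    have e : ∀ᵐ t ∂(volume.restrict (Ioc 0 T)),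
        w t =ᵐ[volume] fun x => N (u' t x) (v' t x) := by
      filter_upwards [hae, ae_restrict_mem measurableSet_Ioc] with t h1 h2
      exact ae_eq_of_tendsto hN (fun k => hnN k t) (hu t h2.1.le) (hv t h2.1.le) hσ h1
    have e' : n' =ᵐ[volume.restrict (Ioc 0 T)] w := e.mono fun t ht => key ht
    refine ⟨hw.congr e'.symm, ?_, hwt.congr fun k => ?_⟩
    · filter_upwards [e, e'] with t h1 h2
      rw [h2]; exact h1
    · exact lintegral_congr_ae (e'.mono fun t ht => by simp only [ht])
  refine ⟨n', fun T => ?_, ?_, fun T hT => (step T hT).2.2⟩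
  · rcases le_total 0 T with hT | hT
    · exact (step T hT).1
    · rw [Ioc_eq_empty (not_lt.2 hT)]; exact integrableOn_empty
  · have h : ∀ j : ℕ, ∀ᵐ t : ℝ, t ∈ Ioc (0 : ℝ) j →
        n' t =ᵐ[volume] fun x => N (u' t x) (v' t x) := fun j =>
      (ae_restrict_iff' measurableSet_Ioc).1 (step j (Nat.cast_nonneg j)).2.1
    rw [ae_restrict_iff' measurableSet_Ioi]
    filter_upwards [ae_all_iff.2 h] with t ht h0
    obtain ⟨j, hj⟩ := exists_nat_ge t
    exact ht j ⟨h0, hj⟩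

/-! ### Limits in the weak form -/

lemma integrableOn_bilin {X Y : Type*} [NormedAddCommGroup X] [NormedSpace ℂ X]
    [NormedAddCommGroup Y] [NormedSpace ℂ Y] (B : X →L[ℂ] Y →L[ℂ] ℂ) {s : ℝ → Y}
    (hs : Continuous s) {R : ℝ} {n : ℝ → X} (hn : IntegrableOn n (Ioc 0 R)) :
    IntegrableOn (fun t => B (n t) (s t)) (Ioc 0 R) := by
  obtain ⟨M, hM⟩ := (isCompact_Icc (a := (0 : ℝ)) (b := R)).exists_bound_of_continuousOn
    hs.continuousOn
  refine Integrable.mono' (hn.norm.const_mul (‖B‖ * M))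
    (B.aestronglyMeasurable_comp₂ hn.1 hs.aestronglyMeasurable) ?_
  filter_upwards [ae_restrict_mem measurableSet_Ioc] with t ht
  refine (B.le_opNorm₂ _ _).trans ?_
  rw [mul_right_comm]
  gcongr
  exact hM t (Ioc_subset_Icc_self ht)

lemma tendsto_integral_bilin {X Y : Type*} [NormedAddCommGroup X] [NormedSpace ℂ X]
    [NormedAddCommGroup Y] [NormedSpace ℂ Y] (B : X →L[ℂ] Y →L[ℂ] ℂ) {s : ℝ → Y}
    (hs : Continuous s) {R : ℝ} {n : ℕ → ℝ → X} {n' : ℝ → X}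
    (hn : ∀ k, IntegrableOn (n k) (Ioc 0 R)) (hn' : IntegrableOn n' (Ioc 0 R))
    (h : Tendsto (fun k => ∫⁻ t in Ioc 0 R, ‖n k t - n' t‖ₑ) atTop (𝓝 0)) :
    Tendsto (fun k => ∫ t in Ioc 0 R, B (n k t) (s t)) atTop
      (𝓝 (∫ t in Ioc 0 R, B (n' t) (s t))) := by
  obtain ⟨M, hM⟩ := (isCompact_Icc (a := (0 : ℝ)) (b := R)).exists_bound_of_continuousOn
    hs.continuousOn
  refine tendsto_integral_of_L1 _ (integrableOn_bilin B hs hn').1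
    (Eventually.of_forall fun k => integrableOn_bilin B hs (hn k)) ?_
  have h0 : Tendsto (fun k => ENNReal.ofReal (‖B‖ * M) * ∫⁻ t in Ioc 0 R, ‖n k t - n' t‖ₑ) atTop
      (𝓝 0) := by
    simpa using ENNReal.Tendsto.const_mul h (Or.inr ENNReal.ofReal_ne_top)
  refine tendsto_of_tendsto_of_tendsto_of_le_of_le tendsto_const_nhds h0 (fun _ => zero_le)
    fun k => ?_
  rw [← lintegral_const_mul' _ _ ENNReal.ofReal_ne_top]
  refine setLIntegral_mono' measurableSet_Ioc fun t ht => ?_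
  have hM0 : 0 ≤ M := (norm_nonneg _).trans (hM t (Ioc_subset_Icc_self ht))
  rw [← _root_.sub_apply, ← map_sub, ← ofReal_norm, ← ofReal_norm,
    ← ENNReal.ofReal_mul (by positivity)]
  refine ENNReal.ofReal_le_ofReal ((B.le_opNorm₂ _ _).trans ?_)
  rw [mul_right_comm]
  gcongr
  exact hM t (Ioc_subset_Icc_self ht)

lemma tendsto_lintegral_of_tendstoUniformlyOn {E : Type*} [NormedAddCommGroup E]
    {u : ℕ → ℝ → E} {u' : ℝ → E} {R : ℝ} (h : TendstoUniformlyOn u u' atTop (Icc 0 R)) :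
    Tendsto (fun k => ∫⁻ t in Ioc 0 R, ‖u k t - u' t‖ₑ) atTop (𝓝 0) := by
  have h0 : Tendsto (fun δ : ℝ => ENNReal.ofReal δ * volume (Ioc 0 R)) (𝓝[>] 0) (𝓝 0) := by
    have h1 : Tendsto (fun δ : ℝ => ENNReal.ofReal δ * volume (Ioc 0 R)) (𝓝 0)
        (𝓝 (ENNReal.ofReal 0 * volume (Ioc 0 R))) :=
      ENNReal.Tendsto.mul_const (ENNReal.continuous_ofReal.tendsto 0) (Or.inr (by simp))
    simpa using h1.mono_left nhdsWithin_le_nhds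
  rw [ENNReal.tendsto_nhds_zero]
  intro ε hε
  obtain ⟨δ, h1, h2⟩ := ((ENNReal.tendsto_nhds_zero.1 h0 ε hε).and
    (self_mem_nhdsWithin : Ioi (0 : ℝ) ∈ 𝓝[>] 0)).exists
  filter_upwards [Metric.tendstoUniformlyOn_iff.1 h δ h2] with k hk
  refine le_trans ?_ h1
  rw [← setLIntegral_const]
  refine setLIntegral_mono' measurableSet_Ioc fun t ht => ?_
  rw [← ofReal_norm, ← dist_eq_norm, dist_comm]
  exact ENNReal.ofReal_le_ofReal (hk t (Ioc_subset_Icc_self ht)).le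

lemma setIntegral_Ioi_eq_Ioc {g : ℝ → ℂ} {R : ℝ} (h : ∀ t, R < t → g t = 0) :
    ∫ t in Ioi (0 : ℝ), g t = ∫ t in Ioc 0 R, g t :=
  setIntegral_eq_of_subset_of_forall_sdiff_eq_zero measurableSet_Ioi Ioc_subset_Ioi_self
    fun t ht => h t (not_le.1 fun hle => ht.2 ⟨ht.1, hle⟩)

/-- The weak form passes to the limit. -/
lemma weak_form_of_tendsto {m c : ℝ} {u₀ : ℕ → L2} {u₀' : L2} {u v : ℕ → ℝ → L2} {u' v' : ℝ → L2}
    {n : ℕ → ℝ → L1} {n' : ℝ → L1} {G : ℕ → ℝ → ℝ → ℂ} {G' : ℝ → ℝ → ℂ}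
    (h0 : Tendsto u₀ atTop (𝓝 u₀'))
    (cu : ∀ k, Continuous (u k)) (cv : ∀ k, Continuous (v k)) (cn : ∀ k, Continuous (n k))
    (cu' : ContinuousOn u' (Ici 0)) (cv' : ContinuousOn v' (Ici 0))
    (cn' : ∀ T, IntegrableOn n' (Ioc 0 T))
    (hG : ∀ k t, n k t =ᵐ[volume] G k t)
    (hG' : ∀ᵐ t ∂(volume.restrict (Ioi (0 : ℝ))), n' t =ᵐ[volume] G' t)
    (hu : ∀ T, 0 ≤ T → TendstoUniformlyOn u u' atTop (Icc 0 T))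
    (hv : ∀ T, 0 ≤ T → TendstoUniformlyOn v v' atTop (Icc 0 T))
    (hn : ∀ T, 0 ≤ T → Tendsto (fun k => ∫⁻ t in Ioc 0 T, ‖n k t - n' t‖ₑ) atTop (𝓝 0))
    {φ : ℝ × ℝ → ℂ} (hφ : ContDiff ℝ ∞ φ) (hs : HasCompactSupport φ)
    (hk : ∀ k, -Complex.I * (∫ x, u₀ k x * φ (0, x))
        - Complex.I * (∫ t in Ioi (0 : ℝ), ∫ x, u k t x * fderiv ℝ φ (t, x) (1, c))
      = ∫ t in Ioi (0 : ℝ), ∫ x, (-(m : ℂ) * v k t x + G k t x) * φ (t, x)) :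
    -Complex.I * (∫ x, u₀' x * φ (0, x))
        - Complex.I * (∫ t in Ioi (0 : ℝ), ∫ x, u' t x * fderiv ℝ φ (t, x) (1, c))
      = ∫ t in Ioi (0 : ℝ), ∫ x, (-(m : ℂ) * v' t x + G' t x) * φ (t, x) := by
  have hc := hφ.continuous
  have hcd := continuous_fderiv_apply hφ (1, c)
  have hsd := hasCompactSupport_fderiv_apply hs (1, c)
  obtain ⟨R₁, hR₁, h₁⟩ := exists_support_bound hs
  obtain ⟨R₂, hR₂, h₂⟩ := exists_support_bound hsd
  -- A common bound for the supports of `φ` and its derivative reduces both sides to `(0,R]`, where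
  -- integrability and convergence are available.
  set R := max R₁ R₂
  have hR : 0 ≤ R := hR₁.trans (le_max_left _ _)
  have zφ : ∀ t, R < t → ∀ x, φ (t, x) = 0 := fun t ht x =>
    h₁ t x (Or.inl (((le_max_left _ _).trans_lt ht).trans_le (le_abs_self t)))
  have zd : ∀ t, R < t → ∀ x, fderiv ℝ φ (t, x) (1, c) = 0 := fun t ht x =>
    h₂ t x (Or.inl (((le_max_right _ _).trans_lt ht).trans_le (le_abs_self t)))
  have lhs : ∀ w : ℝ → L2, ∫ t in Ioi (0 : ℝ), ∫ x, w t x * fderiv ℝ φ (t, x) (1, c) =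
      ∫ t in Ioc 0 R, dual 2 2 (w t) (slice 2 hcd hsd t) := by
    intro w
    rw [setIntegral_Ioi_eq_Ioc (R := R) fun t ht => by simp [zd t ht]]
    simp only [dual_slice]
  have rhs : ∀ (w : ℝ → L2) (n : ℝ → L1) (G : ℝ → ℝ → ℂ), IntegrableOn w (Ioc 0 R) →
      IntegrableOn n (Ioc 0 R) →
      (∀ᵐ t ∂(volume.restrict (Ioi (0 : ℝ))), n t =ᵐ[volume] G t) →
      ∫ t in Ioi (0 : ℝ), ∫ x, (-(m : ℂ) * w t x + G t x) * φ (t, x) =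
      -(m : ℂ) * (∫ t in Ioc 0 R, dual 2 2 (w t) (slice 2 hc hs t)) +
        ∫ t in Ioc 0 R, dual 1 ⊤ (n t) (slice ⊤ hc hs t) := by
    intro w n G hw hn hG
    rw [setIntegral_Ioi_eq_Ioc (R := R) fun t ht => by simp [zφ t ht], ← integral_const_mul,
      ← integral_add ((integrableOn_bilin _ (continuous_slice 2 hc hs) hw).const_mul _)
        (integrableOn_bilin _ (continuous_slice ⊤ hc hs) hn)]
    apply integral_congr_ae
    filter_upwards [ae_restrict_of_ae_restrict_of_subset Ioc_subset_Ioi_self hG] with t ht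
    rw [dual_slice, dual_slice, ← integral_const_mul,
      ← integral_add ((integrable_mul_slice (q := 2) hc hs (w t) t).const_mul _)
        (integrable_mul_slice (q := ⊤) hc hs (n t) t)]
    apply integral_congr_ae
    filter_upwards [ht] with x hx
    rw [hx]; ring
  have iu' : IntegrableOn u' (Ioc 0 R) :=
    ((cu'.mono Icc_subset_Ici_self).integrableOn_Icc).mono_set Ioc_subset_Icc_self
  have iv' : IntegrableOn v' (Ioc 0 R) :=
    ((cv'.mono Icc_subset_Ici_self).integrableOn_Icc).mono_set Ioc_subset_Icc_self
  rw [lhs, rhs v' n' G' iv' (cn' R) hG']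
  have hk' : ∀ k, -Complex.I * dual 2 2 (u₀ k) (slice 2 hc hs 0) -
      Complex.I * (∫ t in Ioc 0 R, dual 2 2 (u k t) (slice 2 hcd hsd t)) =
      -(m : ℂ) * (∫ t in Ioc 0 R, dual 2 2 (v k t) (slice 2 hc hs t)) +
        ∫ t in Ioc 0 R, dual 1 ⊤ (n k t) (slice ⊤ hc hs t) := by
    intro k
    rw [← rhs (v k) (n k) (G k) (cv k).integrableOn_Ioc (cn k).integrableOn_Ioc
      (Eventually.of_forall (hG k)), ← hk k, lhs, dual_slice]
  rw [← dual_slice (q := 2) hc hs u₀' 0]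
  have t0 : Tendsto (fun k => dual 2 2 (u₀ k) (slice 2 hc hs 0)) atTop
      (𝓝 (dual 2 2 u₀' (slice 2 hc hs 0))) :=
    (((dual 2 2).flip (slice 2 hc hs 0)).continuous.tendsto u₀').comp h0
  have t1 := tendsto_integral_bilin (dual 2 2) (continuous_slice 2 hcd hsd)
    (fun k => ((cu k).integrableOn_Ioc : IntegrableOn (u k) (Ioc 0 R))) iu'
    (tendsto_lintegral_of_tendstoUniformlyOn (hu R hR))
  have t2 := tendsto_integral_bilin (dual 2 2) (continuous_slice 2 hc hs)
    (fun k => ((cv k).integrableOn_Ioc : IntegrableOn (v k) (Ioc 0 R))) iv'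
    (tendsto_lintegral_of_tendstoUniformlyOn (hv R hR))
  have t3 := tendsto_integral_bilin (dual 1 ⊤) (continuous_slice ⊤ hc hs)
    (fun k => ((cn k).integrableOn_Ioc : IntegrableOn (n k) (Ioc 0 R))) (cn' R) (hn R hR)
  exact tendsto_nhds_unique ((t0.const_mul _).sub (t1.const_mul _))
    (((t2.const_mul _).add t3).congr fun k => (hk' k).symm)

/-! ### Stability of solution curves and their limits -/

lemma enorm_L1_sub {n n' : L1} {g g' : ℝ → ℂ} (h : n =ᵐ[volume] g) (h' : n' =ᵐ[volume] g') :
    ‖n - n'‖ₑ = ∫⁻ x, ‖g x - g' x‖ₑ := by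
  rw [Lp.enorm_def, eLpNorm_one_eq_lintegral_enorm]
  apply lintegral_congr_ae
  filter_upwards [h, h', Lp.coeFn_sub n n'] with x h1 h2 h3
  rw [h3, Pi.sub_apply, h1, h2]

namespace IsGlobalCurve

variable {a b : Fin 2 → Fin 3 → ℂ} {m C : ℝ} {F G : ℝ → H1 × H1}

/-- The first nonlinear term along a curve. -/
def nonlinFst (a : Fin 2 → Fin 3 → ℂ) (F : ℝ → H1 × H1) (t : ℝ) : L1 :=
  cubicL1 a (fst F t) (H1.shift t (F t).2)

/-- The second nonlinear term along a curve. -/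
def nonlinSnd (b : Fin 2 → Fin 3 → ℂ) (F : ℝ → H1 × H1) (t : ℝ) : L1 :=
  cubicL1 b (snd F t) (H1.shift (-t) (F t).1)

lemma continuous_nonlinFst (a : Fin 2 → Fin 3 → ℂ) (h : Continuous F) :
    Continuous (nonlinFst a F) :=
  continuous_cubicL1_comp a (continuous_fst h)
    (H1.continuous_shift_comp continuous_id (_root_.continuous_snd.comp h))

lemma continuous_nonlinSnd (b : Fin 2 → Fin 3 → ℂ) (h : Continuous F) :
    Continuous (nonlinSnd b F) :=
  continuous_cubicL1_comp b (continuous_snd h)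
    (H1.continuous_shift_comp continuous_neg (_root_.continuous_fst.comp h))

lemma coeFn_fst (F : ℝ → H1 × H1) (t : ℝ) :
    fst F t =ᵐ[volume] fun x => H1.ev (x + -t) (F t).1 := coeFn_shift_toL2 (-t) (F t).1

lemma coeFn_snd (F : ℝ → H1 × H1) (t : ℝ) :
    snd F t =ᵐ[volume] fun x => H1.ev (x + t) (F t).2 := coeFn_shift_toL2 t (F t).2

lemma coeFn_nonlinFst' (a : Fin 2 → Fin 3 → ℂ) (F : ℝ → H1 × H1) (t : ℝ) :
    nonlinFst a F t =ᵐ[volume]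
      fun x => cubic a (H1.ev (x + -t) (F t).1) (H1.ev (x + t) (F t).2) := by
  filter_upwards [coeFn_cubicL1 a (fst F t) (H1.shift t (F t).2), coeFn_fst F t] with x h1 h2
  rw [nonlinFst, h1, h2, H1.ev_shift]

lemma coeFn_nonlinSnd' (b : Fin 2 → Fin 3 → ℂ) (F : ℝ → H1 × H1) (t : ℝ) :
    nonlinSnd b F t =ᵐ[volume]
      fun x => cubic b (H1.ev (x + t) (F t).2) (H1.ev (x + -t) (F t).1) := by
  filter_upwards [coeFn_cubicL1 b (snd F t) (H1.shift (-t) (F t).1), coeFn_snd F t] with x h1 h2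
  rw [nonlinSnd, h1, h2, H1.ev_shift]

lemma coeFn_nonlinFst (a : Fin 2 → Fin 3 → ℂ) (F : ℝ → H1 × H1) (t : ℝ) :
    nonlinFst a F t =ᵐ[volume] fun x => N1 a (fst F t x) (snd F t x) := by
  filter_upwards [coeFn_nonlinFst' a F t, coeFn_fst F t, coeFn_snd F t] with x h1 h2 h3
  rw [h1, h2, h3, N1]

lemma coeFn_nonlinSnd (b : Fin 2 → Fin 3 → ℂ) (F : ℝ → H1 × H1) (t : ℝ) :
    nonlinSnd b F t =ᵐ[volume] fun x => N2 b (fst F t x) (snd F t x) := by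
  filter_upwards [coeFn_nonlinSnd' b F t, coeFn_fst F t, coeFn_snd F t] with x h1 h2 h3
  rw [h1, h2, h3, N2]

lemma lintegral_nonlinFst_sub (a : Fin 2 → Fin 3 → ℂ) (F G : ℝ → H1 × H1) (T : ℝ) :
    ∫⁻ t in Ioc 0 T, ‖nonlinFst a F t - nonlinFst a G t‖ₑ =
      cubicDist a T (fun t x => H1.ev x (F t).1) (fun t x => H1.ev x (F t).2)
        (fun t x => H1.ev x (G t).1) (fun t x => H1.ev x (G t).2) := by
  unfold cubicDist
  congr 1; ext t
  rw [enorm_L1_sub (coeFn_nonlinFst' a F t) (coeFn_nonlinFst' a G t),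
    ← lintegral_add_right_eq_self _ t]
  congr 1; ext x
  rw [show x + t + -t = x by ring, show x + t + t = x + 2 * t by ring]

/-- Reflecting space turns the second nonlinear distance into the first one for the exchanged
system, so `CharSol.reflect` makes a separate estimate unnecessary. -/
lemma lintegral_nonlinSnd_sub (b : Fin 2 → Fin 3 → ℂ) (F G : ℝ → H1 × H1) (T : ℝ) :
    ∫⁻ t in Ioc 0 T, ‖nonlinSnd b F t - nonlinSnd b G t‖ₑ =
      cubicDist b T (fun t x => H1.ev (-x) (F t).2) (fun t x => H1.ev (-x) (F t).1)
        (fun t x => H1.ev (-x) (G t).2) (fun t x => H1.ev (-x) (G t).1) := by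
  unfold cubicDist
  congr 1; ext t
  rw [enorm_L1_sub (coeFn_nonlinSnd' b F t) (coeFn_nonlinSnd' b G t),
    ← lintegral_neg_eq_self, ← lintegral_add_right_eq_self _ t]
  congr 1; ext x
  rw [show -(x + t) + t = -x by ring, show -(x + t) + -t = -(x + 2 * t) by ring]

/-- The squared distance of the data of two curves. -/
def dataDist (F G : ℝ → H1 × H1) : ℝ :=
  ‖(F 0).1.toL2 - (G 0).1.toL2‖ ^ 2 + ‖(F 0).2.toL2 - (G 0).2.toL2‖ ^ 2

/-- The number of short intervals depends on `m` and `T` only, hence one constant serves all pairs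
of curves with charge at most `C`. This uniformity yields the Cauchy property of the sequence. -/
lemma stability (hab : ChargeCondition a b) (hm : 0 ≤ m) (hC : 0 ≤ C)
    (hκa : coeffSum a * C ≤ 1 / 100) (hκb : coeffSum b * C ≤ 1 / 100) {T : ℝ} (hT : 0 ≤ T) :
    ∃ K : ℝ, 0 ≤ K ∧ ∀ F G, IsGlobalCurve a b m F → IsGlobalCurve a b m G →
      charge (F 0) ≤ C → charge (G 0) ≤ C →
      (∀ t ∈ Icc 0 T, ‖fst F t - fst G t‖ ^ 2 + ‖snd F t - snd G t‖ ^ 2 ≤ K * dataDist F G) ∧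
      (∫⁻ t in Ioc 0 T, ‖nonlinFst a F t - nonlinFst a G t‖ₑ) ^ 2 ≤
        ENNReal.ofReal (K * dataDist F G) ∧
      (∫⁻ t in Ioc 0 T, ‖nonlinSnd b F t - nonlinSnd b G t‖ₑ) ^ 2 ≤
        ENNReal.ofReal (K * dataDist F G) := by
  set T₀ : ℝ := 1 / (10 * (m + 1)) with hT₀
  have hT₀0 : 0 < T₀ := by positivity
  have hT₀1 : T₀ ≤ 1 := by
    rw [hT₀, div_le_one (by positivity)]; linarith
  have hmT : m * T₀ ≤ 1 / 10 := by
    rw [hT₀, mul_one_div, div_le_div_iff₀ (by positivity) (by norm_num)]; linarith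
  obtain ⟨n, hn⟩ := exists_nat_ge (T / T₀)
  rw [div_le_iff₀ hT₀0] at hn
  refine ⟨192 ^ n, by positivity, fun F G hF hG cF cG => ?_⟩
  have SF := (hF.isCurve T).charSol hab continuous_const (fun _ => by simp) cF
  have SG := (hG.isCurve T).charSol hab continuous_const (fun _ => by simp) cG
  have hδ : ∀ p q p' q' : H1, nsq (fun x => H1.ev x p - H1.ev x q) +
      nsq (fun x => H1.ev x p' - H1.ev x q') =
      ENNReal.ofReal (‖p.toL2 - q.toL2‖ ^ 2 + ‖p'.toL2 - q'.toL2‖ ^ 2) := fun p q p' q' => by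
    rw [nsq_ev_sub, nsq_ev_sub, ENNReal.ofReal_add (by positivity) (by positivity)]
  have h192 : ∀ d : ℝ, 192 ^ n * ENNReal.ofReal d = ENNReal.ofReal (192 ^ n * d) := fun d => by
    rw [ENNReal.ofReal_mul (by positivity), ENNReal.ofReal_pow (by norm_num)]
    norm_num
  obtain ⟨h1, h2⟩ := CharSol.stability_long hab hm hC hκa hκb hT₀0.le hT₀1 hmT n hT hn SF SG
  obtain ⟨-, h3⟩ := CharSol.stability_long hab.symm hm hC hκb hκa hT₀0.le hT₀1 hmT n hT hn
    SF.reflect SG.reflect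
  have d0 : 0 ≤ dataDist F G := by unfold dataDist; positivity
  refine ⟨fun t ht => ?_, ?_, ?_⟩
  · have h := h1 t ht
    simp only [hδ, h192] at h
    rw [fst, fst, snd, snd, ← (shift (-t)).map_sub, ← (shift t).map_sub,
      LinearIsometry.norm_map, LinearIsometry.norm_map]
    exact (ENNReal.ofReal_le_ofReal_iff (mul_nonneg (by positivity) d0)).1 h
  · simp only [hδ, h192] at h2
    rw [lintegral_nonlinFst_sub]
    exact h2
  · rw [nsq_comp_neg (fun x => H1.ev x (F 0).2 - H1.ev x (G 0).2),
      nsq_comp_neg (fun x => H1.ev x (F 0).1 - H1.ev x (G 0).1), hδ, h192, add_comm] at h3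
    rw [lintegral_nonlinSnd_sub]
    exact h3

end IsGlobalCurve

lemma continuous_N1 (a : Fin 2 → Fin 3 → ℂ) : Continuous (Function.uncurry (N1 a)) :=
  continuous_cubic_comp a continuous_fst continuous_snd

lemma continuous_N2 (b : Fin 2 → Fin 3 → ℂ) : Continuous (Function.uncurry (N2 b)) :=
  continuous_cubic_comp b continuous_snd continuous_fst

/-- The pointwise limit is chosen once for all nonnegative times, so the same function is the
uniform limit on every `[0,T]`; at negative times its value is arbitrary. -/
lemma exists_tendstoUniformlyOn {E : Type*} [NormedAddCommGroup E] [CompleteSpace E]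
    {u : ℕ → ℝ → E} (hu : ∀ k, Continuous (u k))
    (h : ∀ T : ℝ, 0 ≤ T → ∀ ε : ℝ, 0 < ε → ∃ K, ∀ j, K ≤ j → ∀ k, K ≤ k →
      ∀ t ∈ Icc 0 T, ‖u j t - u k t‖ < ε) :
    ∃ u' : ℝ → E, ContinuousOn u' (Ici 0) ∧
      ∀ T, 0 ≤ T → TendstoUniformlyOn u u' atTop (Icc 0 T) := by
  have hlim : ∀ t : ℝ, ∃ l, 0 ≤ t → Tendsto (fun k => u k t) atTop (𝓝 l) := by
    intro t
    by_cases ht : 0 ≤ t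
    · have : CauchySeq fun k => u k t := by
        rw [Metric.cauchySeq_iff]
        intro ε hε
        obtain ⟨K, hK⟩ := h t ht ε hε
        exact ⟨K, fun j hj k hk => by rw [dist_eq_norm]; exact hK j hj k hk t ⟨ht, le_rfl⟩⟩
      obtain ⟨l, hl⟩ := cauchySeq_tendsto_of_complete this
      exact ⟨l, fun _ => hl⟩
    · exact ⟨0, fun h => absurd h ht⟩
  choose u' hu' using hlim
  have hunif : ∀ T, 0 ≤ T → TendstoUniformlyOn u u' atTop (Icc 0 T) := by
    intro T hT
    refine UniformCauchySeqOn.tendstoUniformlyOn_of_tendsto ?_ fun t ht => hu' t ht.1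
    rw [Metric.uniformCauchySeqOn_iff]
    intro ε hε
    obtain ⟨K, hK⟩ := h T hT ε hε
    exact ⟨K, fun j hj k hk t ht => by rw [dist_eq_norm]; exact hK j hj k hk t ht⟩
  refine ⟨u', fun t ht => ?_, hunif⟩
  have ht' : (0 : ℝ) ≤ t := ht
  have hc := (hunif (t + 1) (by linarith)).continuousOn
    (Eventually.of_forall fun k => (hu k).continuousOn).frequently
  refine (hc t ⟨ht, by linarith⟩).mono_of_mem_nhdsWithin ?_
  rw [← Ici_inter_Iic]
  exact inter_mem_nhdsWithin _ (Iic_mem_nhds (lt_add_one t))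

lemma nonlinearTendsto_of_tendsto {N : ℂ → ℂ → ℂ} {u v : ℕ → ℝ → L2} {u' v' : ℝ → L2}
    {n : ℕ → ℝ → L1} {n' : ℝ → L1} {T : ℝ}
    (hnN : ∀ k t, n k t =ᵐ[volume] fun x => N (u k t x) (v k t x))
    (hn' : ∀ᵐ t ∂(volume.restrict (Ioi (0 : ℝ))), n' t =ᵐ[volume] fun x => N (u' t x) (v' t x))
    (h : Tendsto (fun k => ∫⁻ t in Ioc 0 T, ‖n k t - n' t‖ₑ) atTop (𝓝 0)) :
    NonlinearTendsto N u v u' v' T := by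
  refine h.congr fun k => lintegral_congr_ae ?_
  filter_upwards [ae_restrict_of_ae_restrict_of_subset Ioc_subset_Ioi_self hn'] with t ht
  exact enorm_L1_sub (hnN k t) ht

section

open IsGlobalCurve

variable {a b : Fin 2 → Fin 3 → ℂ} {m C : ℝ}

/-- Only the data need converge in `L²`: stability transfers their Cauchy property to the solutions
and to the nonlinear terms. No uniform `H¹` bound on the sequence enters. -/
lemma exists_weak_limit (hab : ChargeCondition a b) (hm : 0 ≤ m) (hC : 0 ≤ C)
    (hκa : coeffSum a * C ≤ 1 / 100) (hκb : coeffSum b * C ≤ 1 / 100) {F : ℕ → ℝ → H1 × H1}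
    (hF : ∀ k, IsGlobalCurve a b m (F k)) (hFC : ∀ k, charge (F k 0) ≤ C) {u₀' v₀' : L2}
    (hu₀ : Tendsto (fun k => (F k 0).1.toL2) atTop (𝓝 u₀'))
    (hv₀ : Tendsto (fun k => (F k 0).2.toL2) atTop (𝓝 v₀')) :
    ∃ u' v' : ℝ → L2, IsWeakSolution a b m u₀' v₀' u' v' ∧ ∀ T : ℝ, 0 ≤ T →
      TendstoUniformlyOn (fun k => fst (F k)) u' atTop (Icc 0 T) ∧
      TendstoUniformlyOn (fun k => snd (F k)) v' atTop (Icc 0 T) ∧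
      NonlinearTendsto (N1 a) (fun k => fst (F k)) (fun k => snd (F k)) u' v' T ∧
      NonlinearTendsto (N2 b) (fun k => fst (F k)) (fun k => snd (F k)) u' v' T := by
  have hδ : ∀ η : ℝ, 0 < η → ∃ K, ∀ j, K ≤ j → ∀ k, K ≤ k → dataDist (F j) (F k) < η := by
    intro η hη
    have h1 := cauchySeq_iff_tendsto_dist_atTop_0.1 hu₀.cauchySeq
    have h2 := cauchySeq_iff_tendsto_dist_atTop_0.1 hv₀.cauchySeq
    have h3 := (h1.pow 2).add (h2.pow 2)
    simp only [dist_eq_norm, ne_eq, OfNat.ofNat_ne_zero, not_false_eq_true, zero_pow,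
      add_zero] at h3
    obtain ⟨K, hK⟩ := eventually_atTop_prod_self'.1 (h3.eventually (Iio_mem_nhds hη))
    exact ⟨K, fun j hj k hk => hK j hj k hk⟩
  have hδK : ∀ K : ℝ, 0 ≤ K → ∀ η : ℝ, 0 < η → ∃ M, ∀ j, M ≤ j → ∀ k, M ≤ k →
      K * dataDist (F j) (F k) < η := by
    intro K hK η hη
    obtain ⟨M, hM⟩ := hδ (η / (K + 1)) (by positivity)
    refine ⟨M, fun j hj k hk => ?_⟩
    have h1 := hM j hj k hk
    rw [lt_div_iff₀ (by positivity)] at h1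
    have h2 : 0 ≤ dataDist (F j) (F k) := by unfold dataDist; positivity
    nlinarith
  have small : ∀ T : ℝ, 0 ≤ T → ∀ ε : ℝ, 0 < ε → ∃ M, ∀ j, M ≤ j → ∀ k, M ≤ k →
      ∀ t ∈ Icc 0 T, ‖fst (F j) t - fst (F k) t‖ < ε ∧ ‖snd (F j) t - snd (F k) t‖ < ε := by
    intro T hT ε hε
    obtain ⟨K, hK, hs⟩ := IsGlobalCurve.stability hab hm hC hκa hκb hT
    obtain ⟨M, hM⟩ := hδK K hK (ε ^ 2) (by positivity)
    refine ⟨M, fun j hj k hk t ht => ?_⟩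
    have h := (((hs _ _ (hF j) (hF k) (hFC j) (hFC k)).1 t ht).trans_lt (hM j hj k hk))
    constructor
    · exact lt_of_pow_lt_pow_left₀ 2 hε.le (by nlinarith [sq_nonneg ‖snd (F j) t - snd (F k) t‖])
    · exact lt_of_pow_lt_pow_left₀ 2 hε.le (by nlinarith [sq_nonneg ‖fst (F j) t - fst (F k) t‖])
  -- Passing from squares to small quantities is done with `min ε 1`, which is finite even when `ε =
  -- ⊤`.
  have root : ∀ {ε : ℝ≥0∞}, 0 < ε → ∃ η : ℝ, 0 < η ∧ ∀ {I : ℝ≥0∞} {d : ℝ},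
      I ^ 2 ≤ ENNReal.ofReal d → d < η → I < ε := by
    intro ε hε
    have h1 : min ε 1 ≠ ⊤ := ((min_le_right _ _).trans_lt ENNReal.one_lt_top).ne
    have h0 : 0 < min ε 1 := lt_min hε zero_lt_one
    have h2 : 0 < (min ε 1).toReal := ENNReal.toReal_pos h0.ne' h1
    refine ⟨(min ε 1).toReal ^ 2, by positivity, fun {I d} hI hd => ?_⟩
    refine lt_of_lt_of_le (not_le.1 fun hle => ?_) (min_le_left ε 1)
    have h3 : min ε 1 ^ 2 ≤ ENNReal.ofReal d := (pow_le_pow_left' hle 2).trans hI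
    rw [← ENNReal.ofReal_toReal h1, ← ENNReal.ofReal_pow h2.le] at h3
    exact absurd ((ENNReal.ofReal_lt_ofReal_iff (by positivity)).2 hd) (not_lt.2 h3)
  have small1 : ∀ T : ℝ, 0 ≤ T → ∀ ε : ℝ≥0∞, 0 < ε → ∃ M, ∀ j, M ≤ j → ∀ k, M ≤ k →
      ∫⁻ t in Ioc 0 T, ‖nonlinFst a (F j) t - nonlinFst a (F k) t‖ₑ < ε := by
    intro T hT ε hε
    obtain ⟨K, hK, hs⟩ := IsGlobalCurve.stability hab hm hC hκa hκb hT
    obtain ⟨η, hη, hr⟩ := root hε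
    obtain ⟨M, hM⟩ := hδK K hK η hη
    exact ⟨M, fun j hj k hk =>
      hr (hs _ _ (hF j) (hF k) (hFC j) (hFC k)).2.1 (hM j hj k hk)⟩
  have small2 : ∀ T : ℝ, 0 ≤ T → ∀ ε : ℝ≥0∞, 0 < ε → ∃ M, ∀ j, M ≤ j → ∀ k, M ≤ k →
      ∫⁻ t in Ioc 0 T, ‖nonlinSnd b (F j) t - nonlinSnd b (F k) t‖ₑ < ε := by
    intro T hT ε hε
    obtain ⟨K, hK, hs⟩ := IsGlobalCurve.stability hab hm hC hκa hκb hT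
    obtain ⟨η, hη, hr⟩ := root hε
    obtain ⟨M, hM⟩ := hδK K hK η hη
    exact ⟨M, fun j hj k hk =>
      hr (hs _ _ (hF j) (hF k) (hFC j) (hFC k)).2.2 (hM j hj k hk)⟩
  have cu : ∀ k, Continuous (fst (F k)) := fun k => IsGlobalCurve.continuous_fst (hF k).1
  have cv : ∀ k, Continuous (snd (F k)) := fun k => IsGlobalCurve.continuous_snd (hF k).1
  have cn1 : ∀ k, Continuous (nonlinFst a (F k)) := fun k => continuous_nonlinFst a (hF k).1
  have cn2 : ∀ k, Continuous (nonlinSnd b (F k)) := fun k => continuous_nonlinSnd b (hF k).1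
  obtain ⟨u', cu', hu'⟩ := exists_tendstoUniformlyOn (u := fun k => fst (F k)) cu
    fun T hT ε hε => (small T hT ε hε).imp fun M hM j hj k hk t ht => (hM j hj k hk t ht).1
  obtain ⟨v', cv', hv'⟩ := exists_tendstoUniformlyOn (u := fun k => snd (F k)) cv
    fun T hT ε hε => (small T hT ε hε).imp fun M hM j hj k hk t ht => (hM j hj k hk t ht).2
  have pu : ∀ t, 0 ≤ t → Tendsto (fun k => fst (F k) t) atTop (𝓝 (u' t)) := fun t ht =>
    (hu' t ht).tendsto_at ⟨ht, le_rfl⟩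
  have pv : ∀ t, 0 ≤ t → Tendsto (fun k => snd (F k) t) atTop (𝓝 (v' t)) := fun t ht =>
    (hv' t ht).tendsto_at ⟨ht, le_rfl⟩
  obtain ⟨n₁, i1, e1, t1⟩ := exists_nonlinear_limit (continuous_N1 a) cn1
    (fun k t => coeFn_nonlinFst a (F k) t) pu pv small1
  obtain ⟨n₂, i2, e2, t2⟩ := exists_nonlinear_limit (continuous_N2 b) cn2
    (fun k t => coeFn_nonlinSnd b (F k) t) pu pv small2
  refine ⟨u', v', ⟨?_, ?_, cu', cv', ⟨n₁, i1, e1⟩, ⟨n₂, i2, e2⟩, fun φ hφ hs => ⟨?_, ?_⟩⟩,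
    fun T hT => ⟨hu' T hT, hv' T hT, ?_, ?_⟩⟩
  · refine tendsto_nhds_unique (pu 0 le_rfl) (hu₀.congr fun k => ?_)
    rw [fst, neg_zero, shift_zero]
  · refine tendsto_nhds_unique (pv 0 le_rfl) (hv₀.congr fun k => ?_)
    rw [snd, shift_zero]
  · exact weak_form_of_tendsto (G' := fun t x => N1 a (u' t x) (v' t x)) hu₀ cu cv cn1 cu' cv' i1
      (fun k t => coeFn_nonlinFst a (F k) t) e1 hu' hv' t1 hφ hs
      fun k => ((hF k).weak_form hφ hs).1
  · exact weak_form_of_tendsto (G' := fun t x => N2 b (u' t x) (v' t x)) hv₀ cv cu cn2 cv' cu' i2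
      (fun k t => coeFn_nonlinSnd b (F k) t) e2 hv' hu' t2 hφ hs
      fun k => ((hF k).weak_form hφ hs).2
  · exact nonlinearTendsto_of_tendsto (fun k t => coeFn_nonlinFst a (F k) t) e1 (t1 T hT)
  · exact nonlinearTendsto_of_tendsto (fun k t => coeFn_nonlinSnd b (F k) t) e2 (t2 T hT)

end

end Dirac

end

theorem theorem1p2 (a b : Fin 2 → Fin 3 → ℂ) (hab : Dirac.ChargeCondition a b) :
    ∃ C₀ : ℝ, 0 < C₀ ∧
      ∀ (m : ℝ), 0 ≤ m →
      ∀ (u₀ v₀ : ℕ → Dirac.L2) (u₀inf v₀inf : Dirac.L2),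
        (∀ k, Dirac.MemH1 (u₀ k) ∧ Dirac.MemH1 (v₀ k)) →
        (∀ k, ‖u₀ k‖ ^ 2 + ‖v₀ k‖ ^ 2 ≤ C₀) →
        Tendsto (fun k => ‖u₀ k - u₀inf‖ + ‖v₀ k - v₀inf‖) atTop (𝓝 0) →
        ∃ u v : ℕ → ℝ → Dirac.L2,
          -- `(u k, v k)` is the classical solution with data `(u₀ k, v₀ k)`
          (∀ k, Dirac.IsClassicalSolution a b m (u₀ k) (v₀ k) (u k) (v k) ∧
            ∀ u' v' : ℝ → Dirac.L2,
              Dirac.IsClassicalSolution a b m (u₀ k) (v₀ k) u' v' →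
              EqOn u' (u k) (Ici 0) ∧ EqOn v' (v k) (Ici 0)) ∧
          ∃ uinf vinf : ℝ → Dirac.L2,
            Dirac.IsWeakSolution a b m u₀inf v₀inf uinf vinf ∧
            ∀ T : ℝ, 0 ≤ T →
              TendstoUniformlyOn u uinf atTop (Icc 0 T) ∧
              TendstoUniformlyOn v vinf atTop (Icc 0 T) ∧
              Dirac.NonlinearTendsto (Dirac.N1 a) u v uinf vinf T ∧
              Dirac.NonlinearTendsto (Dirac.N2 b) u v uinf vinf T := by
  have ha := Dirac.coeffSum_nonneg a
  have hb := Dirac.coeffSum_nonneg b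
  -- The summand 1 keeps `S` positive when all coefficients vanish. The threshold `C` does not
  -- involve `m`, since the mass enters only through the length of the short intervals.
  set S : ℝ := Dirac.coeffSum a + Dirac.coeffSum b + 1 with hS
  have hS0 : 0 < S := by positivity
  set C : ℝ := 1 / (100 * S) with hCdef
  have hC : 0 < C := by positivity
  have hCS : S * C = 1 / 100 := by rw [hCdef]; field_simp
  have hκa : Dirac.coeffSum a * C ≤ 1 / 100 :=
    hCS ▸ mul_le_mul_of_nonneg_right (by linarith) hC.le
  have hκb : Dirac.coeffSum b * C ≤ 1 / 100 :=
    hCS ▸ mul_le_mul_of_nonneg_right (by linarith) hC.le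
  refine ⟨C, hC, fun m hm u₀ v₀ u₀inf v₀inf hH1 hcharge hlim => ?_⟩
  have hlift : ∀ k, ∃ F : ℝ → Dirac.H1 × Dirac.H1, Dirac.IsGlobalCurve a b m F ∧
      (F 0).1.toL2 = u₀ k ∧ (F 0).2.toL2 = v₀ k := by
    intro k
    obtain ⟨⟨g, hg⟩, ⟨h, hh⟩⟩ := hH1 k
    obtain ⟨F, hF0, hF⟩ := Dirac.exists_globalCurve hab hm hκa hκb
      (x₀ := (⟨(u₀ k, g), Dirac.mem_H1.2 hg⟩, ⟨(v₀ k, h), Dirac.mem_H1.2 hh⟩)) (hcharge k)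
    refine ⟨F, hF, ?_, ?_⟩ <;> rw [hF0] <;> rfl
  choose F hF hFu hFv using hlift
  have hu : Tendsto u₀ atTop (𝓝 u₀inf) := tendsto_iff_norm_sub_tendsto_zero.2
    (squeeze_zero (fun _ => norm_nonneg _) (fun k => le_add_of_nonneg_right (norm_nonneg _)) hlim)
  have hv : Tendsto v₀ atTop (𝓝 v₀inf) := tendsto_iff_norm_sub_tendsto_zero.2
    (squeeze_zero (fun _ => norm_nonneg _) (fun k => le_add_of_nonneg_left (norm_nonneg _)) hlim)
  refine ⟨fun k => Dirac.IsGlobalCurve.fst (F k), fun k => Dirac.IsGlobalCurve.snd (F k),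
    fun k => ?_, ?_⟩
  · rw [← hFu k, ← hFv k]
    exact ⟨(hF k).isClassicalSolution, fun u' v' h => h.eqOn (hF k)⟩
  · refine Dirac.exists_weak_limit hab hm hC.le hκa hκb hF (fun k => ?_)
      (hu.congr fun k => (hFu k).symm) (hv.congr fun k => (hFv k).symm)
    rw [Dirac.charge, hFu, hFv]
    exact hcharge k
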